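/- **Setting.** Let $k$ be a non-archimedean local field with normalized valuation $\mathrm{val}$, ring of integers $\mathcal R$ and odd residual characteristic $p$. Let $V$ be a quadratic space of dimension $n=2m+d$ over $k$ with basis $v_1,\dots,v_m,w_1,\dots,w_m,z_1,\dots,z_d$ such that $B(v_i,w_j)=\delta_{ij}$, $B(z_\ell,z_\kappa)=\delta_{\ell\kappa}\rho_\ell$ and all other products of basis vectors vanish, where $\langle\rho_1,\dots,\rho_d\rangle$ is anisotropic and entries in the same square class are equal. Let $q$ be its form, and assume $p>h$, where $h=n-1$ for $n$ odd and $h=n-2$ for $n$ even. Write $a\sim b$ if $a=t^2b$ for some $t\in k^\times$. **Partitions.** Let $\lambda$ be a partition of $n$ in which each even part has even multiplicity, $m_i$ the multiplicity of $i$, $|\lambda|$ the number of parts, and $\mathcal I=\{(i,j): i\in\lambda,\ 1\le j\le m_i\}$. For $i$ odd let $q_i=\langle r_{i,1},\dots,r_{i,m_i}\rangle$ with $r_{i,j}\in k^\times$, and assume that $\bigoplus_{i\text{ odd}}q_i$ and $q$ have the same Witt class. Let $\Gamma$ be a partition of $\mathcal I$ into nonempty sets of the following shapes (the last five involving only odd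 parts), at most two of them of shape trip, sign or ani: * even: $\{(i,j),(i,j+1)\}$, $i$ even; * hyp: $\{(i,j),(i,j')\}$, $i$ odd, $j\ne j'$, $r_{i,j}\sim -r_{i,j'}$; * pairs: $\{(i,j),(i',j')\}$, $i\neq i'$, $r_{i,j}\sim -r_{i',j'}$; * quad (only if $-1\notin (k^{\times})^2$): four index pairs with distinct parts and equivalent $r_{i,j}$; * trip (only if $-1\notin (k^{\times})^2$): three index pairs with distinct parts and all $r_{i,j}\sim-\rho_\ell$ for some $\ell$; * sign (only if $-1\notin (k^{\times})^2$): two index pairs with distinct parts and both $r_{i,j}\sim-\rho_\ell\sim-\rho_\kappa$ for some $\ell<\kappa$; * ani: a set of index pairs with $r_{i,j}\sim\rho_{\ell(i,j)}$ for an injection $(i,j)\mapsto\ell(i,j)$. Let $\Gamma_{\rm even}$, $\Gamma_{\rm hyp}$ be the sets of members of the first two shapes. **The triple.** A *realization* of $\Gamma$ consists of disjoint subsets $B_\gamma$ ($\gamma\in\Gamma$) exhausting the given basis of $V$, each being formed of some hyperbolic pairs $\{v_a,w_a\}$ and some $z_\ell$, and of a sequence of $i$ vectors in $\mathrm{span}(B_\gamma)$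 (an $\mathfrak{sl}_2$-basis) for each $(i,j)\in\gamma$, as follows; in each case the hyperbolic pairs of $B_\gamma$ are numbered in an arbitrary way. * even, hyp: $B_\gamma=\{v_1,\dots,v_i,w_1,\dots,w_i\}$, with sequences $v_1,\dots,v_i$ and $-w_i,w_{i-1},\dots,(-1)^iw_1$. * Otherwise list the members of $\gamma$ as $(i_t,j_t)$ (with $i_1>i_2>\cdots$ for pairs, quad, trip and sign), and let $i_t=2K_t+1$. The sequence for $(i_t,j_t)$ is $\tau v_1,\dots,\tau v_{K_t},x_t,-\varepsilon w_{K_t},\varepsilon w_{K_t-1},\dots,(-1)^{K_t}\varepsilon w_1$, using $K_t$ hyperbolic pairs, different ones for different $t$, with $\varepsilon=1$ except where stated. Besides these, $B_\gamma$ contains the vectors with indices $a,b,\ell,\kappa$ named below; $c,s\in k$ satisfy $c^2+s^2=-1$. * pairs: $\tau=u\sim r_{i_1,j_1}$, $x_1=\frac u2v_a+w_a$, $x_2=\frac u2v_a-w_a$, and $\varepsilon=-1$ for $t=2$. * quad: $\tau=u\sim r_{i_1,j_1}$, $x_1=\frac u2v_a+w_a$, $x_2=\frac u2v_b+w_b$,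 $x_3=\frac{cu}2v_a+\frac{su}2v_b-cw_a-sw_b$, $x_4=-\frac{su}2v_a+\frac{cu}2v_b+sw_a-cw_b$. * trip, with $r=\rho_\ell$: $\tau=-r$, $x_1=\frac{cr}2v_a+cw_a+sz_\ell$, $x_2=\frac r2v_a-w_a$, $x_3=-\frac{sr}2v_a-sw_a+cz_\ell$. * sign, with $r=\rho_\ell=\rho_\kappa$: $\tau=-r$, $x_1=cz_\ell-sz_\kappa$, $x_2=sz_\ell+cz_\kappa$. * ani: $\tau=\rho_{\ell(i_t,j_t)}$, $x_t=z_{\ell(i_t,j_t)}$. If all parts of $\lambda$ are even ($\lambda$ is *very even*) and $\gamma_0\in\Gamma$, a *realization twisted at $\gamma_0$* is defined in the same way, except that for $\gamma_0$ the sequences are $v_1,\dots,v_{i-1},w_i$ and $v_i,-w_{i-1},w_{i-2},\dots,(-1)^{i-1}w_1$. A triple $\mathrm d\phi_\Gamma=\{Y,H,X\}$ of endomorphisms of $V$ is *determined* by the realization if on each of the sequences $b_1,\dots,b_i$ one has $Xb_1=0$, $Xb_{s+1}=b_s$, $Hb_s=(i+1-2s)b_s$, $Yb_s=s(i-s)b_{s+1}$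 for $s<i$, and $Yb_i=0$. **The apartment.** Let $\mathcal A=\mathbb R^m$ with coordinate functions $\varepsilon_1,\dots,\varepsilon_m$ be the standard apartment of the Bruhat-Tits building of $\mathrm{SO}(q)$, with facets cut out by the affine root hyperplanes $\varepsilon_i-\varepsilon_j=N$, $\varepsilon_i+\varepsilon_j=N$ ($i\neq j$) and $\varepsilon_i+\frac12\mathrm{val}(\rho_\ell)=N$, where $N\in\mathbb Z$. For $x\in\mathcal A$ give $v_i,w_i,z_\ell$ the weights $\mathrm{wt}=x_i,-x_i,\frac12\mathrm{val}(\rho_\ell)$, and let $\mathfrak g_{x,0}$ be the set of $X\in\mathfrak{so}(q)$ whose nonzero matrix entries in the given basis satisfy $\mathrm{val}(X_{ab})+\mathrm{wt}_a-\mathrm{wt}_b\ge0$. Put $\mathcal B(\mathrm d\phi_\Gamma)\cap\mathcal A=\{x\in\mathcal A: Y,H,X\in\mathfrak g_{x,0}\}$. A facet contained in this set is *maximal* if it does not lie in the closure of another facet contained in it. **Proposition.** Each realization of $\Gamma$ determines exactly one triple $\mathrm d\phi_\Gamma$; its members lie in $\mathfrak{so}(q)$ and satisfy $[H,X]=2X$,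 $[H,Y]=-2Y$, $[X,Y]=H$. The set $\mathcal B(\mathrm d\phi_\Gamma)\cap\mathcal A$ contains maximal facets, every maximal facet $\mathcal F$ satisfies $$\dim\mathcal F=|\Gamma_{\rm even}|+|\Gamma_{\rm hyp}|,$$ and no facet contained in the set has larger dimension. If $\lambda$ is very even, then $|\lambda|$ is even and this dimension is $\frac12|\lambda|$. Moreover, for each $\gamma_0\in\Gamma$, each realization twisted at $\gamma_0$ determines exactly one triple $\{Y',H',X'\}$; its members also lie in $\mathfrak{so}(q)$ and satisfy the relations above, and the maximal facets of $\mathcal B(Y',H',X')\cap\mathcal A$ exist, all have the same dimension $\frac12|\lambda|$, and no facet contained in that set has larger dimension. For every triple $\{Y,H,X\}$ determined by an untwisted realization of $\Gamma$, the elements $X$ and $X'$ are conjugate under $\mathrm O(q)$ but not under $\mathrm{SO}(q)$: they represent the two $\mathrm{SO}(q)$-orbits attached to $\lambda$. -/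

import Mathlib

open scoped Matrix
open ValuativeRel

noncomputable section

namespace OrthNil

/-! ### Square classes, diagonal forms and Witt equivalence -/

/-- The one-dimensional forms `⟨a⟩` and `⟨b⟩` are isometric: `a` and `b` differ by a nonzero
square. -/
def SameClass {k : Type*} [Field k] (a b : k) : Prop :=
  ∃ t : k, t ≠ 0 ∧ a = t ^ 2 * b

/-- The diagonal entries `⟨1, …, 1, -1, …, -1⟩` of an orthogonal sum of `a` hyperbolic planes. -/
def hypEntries (k : Type*) [Field k] (a : ℕ) : Fin a ⊕ Fin a → k :=
  Sum.elim (fun _ => 1) (fun _ => -1)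

/-- Two diagonal quadratic forms have the same class in the Witt group: they become isometric
after adding hyperbolic planes to both. -/
def WittEquiv {k : Type*} [Field k] {ι κ : Type*} [Fintype ι] [Fintype κ]
    (w : ι → k) (w' : κ → k) : Prop :=
  ∃ a b : ℕ, QuadraticMap.Equivalent
    (QuadraticMap.weightedSumSquares k (Sum.elim w (hypEntries k a)))
    (QuadraticMap.weightedSumSquares k (Sum.elim w' (hypEntries k b)))

/-- The Coxeter number attached to `SO(q)`, `deg q = n`: it is `n - 1` for odd `n` (type `B`) and
`n - 2` for even `n` (type `D`). -/
def coxeterNumber (n : ℕ) : ℕ := if Odd n then n - 1 else n - 2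

/-! ### The quadratic space in a Witt basis, and `𝔰𝔬(q)` -/

/-- Indices of the basis `v₁, …, v_m, w₁, …, w_m, z₁, …, z_d` of `V`. -/
abbrev WIdx (m d : ℕ) : Type := Fin m ⊕ Fin m ⊕ Fin d

/-- The space `V`, in coordinates relative to the basis `v, w, z`. -/
abbrev WSpace (k : Type*) (m d : ℕ) : Type _ := WIdx m d → k

section Space

variable {k : Type*} [Field k] {m d : ℕ}

/-- The basis vector `v_i`. -/
def vv (i : Fin m) : WSpace k m d := Pi.single (Sum.inl i) 1

/-- The basis vector `w_i`. -/
def ww (i : Fin m) : WSpace k m d := Pi.single (Sum.inr (Sum.inl i)) 1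

/-- The basis vector `z_ℓ`. -/
def zz (l : Fin d) : WSpace k m d := Pi.single (Sum.inr (Sum.inr l)) 1

/-- The matrix of the bilinear form of `q = ℍ^m ⊕ ⟨ρ₁, …, ρ_d⟩`: `B(v_i, w_j) = δ_{ij}`,
`B(z_ℓ, z_κ) = δ_{ℓκ} ρ_ℓ`, and all other products of basis vectors vanish. -/
def gram (ρ : Fin d → k) : Matrix (WIdx m d) (WIdx m d) k
  | Sum.inl i, Sum.inr (Sum.inl j) => if i = j then 1 else 0
  | Sum.inr (Sum.inl i), Sum.inl j => if i = j then 1 else 0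
  | Sum.inr (Sum.inr l), Sum.inr (Sum.inr l') => if l = l' then ρ l else 0
  | _, _ => 0

/-- `X ∈ 𝔰𝔬(q)`. -/
def IsSkew (ρ : Fin d → k) (X : Matrix (WIdx m d) (WIdx m d) k) : Prop :=
  Xᵀ * gram ρ + gram ρ * X = 0

/-- `g ∈ O(q)`. -/
def IsOrth (ρ : Fin d → k) (g : Matrix (WIdx m d) (WIdx m d) k) : Prop :=
  gᵀ * gram ρ * g = gram ρ

/-- `X` and `X'` lie in the same `O(q)`-orbit for the adjoint action. -/
def OConj (ρ : Fin d → k) (X X' : Matrix (WIdx m d) (WIdx m d) k) : Prop :=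
  ∃ g, IsOrth ρ g ∧ g * X = X' * g

/-- `X` and `X'` lie in the same `SO(q)`-orbit for the adjoint action. -/
def SOConj (ρ : Fin d → k) (X X' : Matrix (WIdx m d) (WIdx m d) k) : Prop :=
  ∃ g, IsOrth ρ g ∧ g.det = 1 ∧ g * X = X' * g

variable (k m d) in
/-- Three endomorphisms `Y, H, X` of `V`. -/
structure Triple where
  Y : Matrix (WIdx m d) (WIdx m d) k
  H : Matrix (WIdx m d) (WIdx m d) k
  X : Matrix (WIdx m d) (WIdx m d) k

/-- The relations of a Lie triple in `𝔰𝔬(q)` (the zero triple, attached to the zero orbit, is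
allowed). -/
def Triple.IsLieTriple (ρ : Fin d → k) (D : Triple k m d) : Prop :=
  IsSkew ρ D.Y ∧ IsSkew ρ D.H ∧ IsSkew ρ D.X ∧
    D.H * D.X - D.X * D.H = 2 • D.X ∧
    D.H * D.Y - D.Y * D.H = -(2 • D.Y) ∧
    D.X * D.Y - D.Y * D.X = D.H

/-- `D` acts on the sequence `b 0, …, b (i - 1)` as the standard basis
`X^{i-1} v, …, X v, v` (with `v` a lowest weight vector) of the irreducible
`𝔰𝔩₂`-module of dimension `i`; in particular `Y (X^{i-s} v) = s (i - s) X^{i-s-1} v`. -/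
def Triple.ActsStandard (D : Triple k m d) (i : ℕ) (b : ℕ → WSpace k m d) : Prop :=
  (∀ s < i, D.H *ᵥ b s = ((i : k) - 1 - 2 * (s : k)) • b s) ∧
  D.X *ᵥ b 0 = 0 ∧
  (∀ s, s + 1 < i → D.X *ᵥ b (s + 1) = b s) ∧
  (∀ s, s + 1 < i → D.Y *ᵥ b s = (((s : k) + 1) * ((i : k) - ((s : k) + 1))) • b (s + 1)) ∧
  D.Y *ᵥ b (i - 1) = 0

end Space

/-! ### The index set of a partition and the admissible set partitions `Γ` -/

/-- The set of index pairs `(i, j)`, where `i` is a part of the partition and `j` runs over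
`0, …, mᵢ - 1`, with `mᵢ` the multiplicity of `i`. -/
abbrev PIdx {n : ℕ} (P : Nat.Partition n) : Type := ↥(P.parts.toEnumFinset)

section Parts

variable {k : Type*} [Field k] {d n : ℕ} {P : Nat.Partition n}

/-- The part `i` of the index pair `(i, j)`. -/
abbrev len (x : PIdx P) : ℕ := x.1.1

/-- Index pairs `(i, j)` and `(i, j + 1)` with `i` even. -/
def EvenRel (x y : PIdx P) : Prop :=
  Even (len x) ∧ len y = len x ∧ y.1.2 = x.1.2 + 1

/-- Distinct index pairs `(i, j)`, `(i, j')` with `i` odd and `⟨r_{i,j}⟩ ≅ ⟨-r_{i,j'}⟩`. -/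
def HypRel (r : PIdx P → k) (x y : PIdx P) : Prop :=
  Odd (len x) ∧ len y = len x ∧ x ≠ y ∧ SameClass (r x) (-r y)

/-- Odd `i > i'`, carrying opposite forms. (A set of two such index pairs can be listed in this order.) -/
def PairsRel (r : PIdx P → k) (x y : PIdx P) : Prop :=
  Odd (len x) ∧ Odd (len y) ∧ len y < len x ∧ SameClass (r x) (-r y)

/-- If `-1` is not a square: four distinct odd parts (listed in decreasing order) carrying the same form. -/
def QuadRel (r : PIdx P → k) (x : Fin 4 → PIdx P) : Prop :=
  ¬ IsSquare (-1 : k) ∧ (∀ t, Odd (len (x t))) ∧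
    StrictAnti (fun t => len (x t)) ∧ ∀ t, SameClass (r (x t)) (r (x 0))

/-- If `-1` is not a square: three distinct odd parts carrying the form `⟨-ρ_ℓ⟩`. -/
def TripRel (r : PIdx P → k) (ρ : Fin d → k) (x : Fin 3 → PIdx P) (l : Fin d) : Prop :=
  ¬ IsSquare (-1 : k) ∧ (∀ t, Odd (len (x t))) ∧
    StrictAnti (fun t => len (x t)) ∧ ∀ t, SameClass (r (x t)) (-ρ l)

/-- If `-1` is not a square: two distinct odd parts carrying the form `⟨-ρ_ℓ⟩ ≅ ⟨-ρ_κ⟩`, `ℓ < κ`. -/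
def SignRel (r : PIdx P → k) (ρ : Fin d → k) (x : Fin 2 → PIdx P) (l l' : Fin d) : Prop :=
  ¬ IsSquare (-1 : k) ∧ (∀ t, Odd (len (x t))) ∧
    StrictAnti (fun t => len (x t)) ∧ l < l' ∧
    ∀ t, SameClass (r (x t)) (-ρ l) ∧ SameClass (r (x t)) (-ρ l')

/-- Odd parts whose forms are distinct entries of the diagonal form `⟨ρ₁, …, ρ_d⟩`. -/
def AniRel (r : PIdx P → k) (ρ : Fin d → k) (γ : Finset (PIdx P)) (f : ↥γ ↪ Fin d) : Prop :=
  ∀ x : ↥γ, Odd (len x.1) ∧ SameClass (r x.1) (ρ (f x))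

def IsEvenPart (γ : Finset (PIdx P)) : Prop := ∃ x y, EvenRel x y ∧ γ = {x, y}

def IsHypPart (r : PIdx P → k) (γ : Finset (PIdx P)) : Prop :=
  ∃ x y, HypRel r x y ∧ γ = {x, y}

/-- A pair of distinct odd parts carrying opposite forms. -/
def IsPairsPart (r : PIdx P → k) (γ : Finset (PIdx P)) : Prop :=
  ∃ x y, PairsRel r x y ∧ γ = {x, y}

def IsQuadPart (r : PIdx P → k) (γ : Finset (PIdx P)) : Prop :=
  ∃ x, QuadRel r x ∧ γ = Finset.univ.image x

def IsTripPart (r : PIdx P → k) (ρ : Fin d → k) (γ : Finset (PIdx P)) : Prop :=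
  ∃ x l, TripRel r ρ x l ∧ γ = Finset.univ.image x

def IsSignPart (r : PIdx P → k) (ρ : Fin d → k) (γ : Finset (PIdx P)) : Prop :=
  ∃ x l l', SignRel r ρ x l l' ∧ γ = Finset.univ.image x

def IsAniPart (r : PIdx P → k) (ρ : Fin d → k) (γ : Finset (PIdx P)) : Prop :=
  ∃ f, AniRel r ρ γ f

open Classical in
/-- `Γ` is a partition of the index set all of whose parts have one of the seven admissible
shapes, at most two of them being of shape trip, sign or ani. -/
def IsAdmissible (r : PIdx P → k) (ρ : Fin d → k)
    (Γ : Finpartition (Finset.univ : Finset (PIdx P))) : Prop :=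
  (∀ γ ∈ Γ.parts, IsEvenPart γ ∨ IsHypPart r γ ∨ IsPairsPart r γ ∨ IsQuadPart r γ ∨
    IsTripPart r ρ γ ∨ IsSignPart r ρ γ ∨ IsAniPart r ρ γ) ∧
  (Γ.parts.filter fun γ => IsTripPart r ρ γ ∨ IsSignPart r ρ γ ∨ IsAniPart r ρ γ).card ≤ 2

open Classical in
/-- `Γ_even`. -/
def evenParts (Γ : Finpartition (Finset.univ : Finset (PIdx P))) : Finset (Finset (PIdx P)) :=
  Γ.parts.filter IsEvenPart

open Classical in
/-- `Γ_hyp`. -/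
def hypParts (r : PIdx P → k) (Γ : Finpartition (Finset.univ : Finset (PIdx P))) :
    Finset (Finset (PIdx P)) :=
  Γ.parts.filter (IsHypPart r)

/-- All parts are even. -/
def VeryEven (P : Nat.Partition n) : Prop := ∀ i ∈ P.parts, Even i

end Parts

/-! ### The `𝔰𝔩₂`-bases attached to the parts of `Γ`

For `γ ∈ Γ` the subset `B_γ` of the basis of `V` is recorded by the set `S` of the indices of the
`v`'s and `w`'s that it contains and the set `T` of the indices of the `z`'s; `ch x` is the
`𝔰𝔩₂`-basis of the irreducible module attached to the index pair `x`. -/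

section Blocks

variable {k : Type*} [Field k] {m d n : ℕ} {P : Nat.Partition n}

/-- Two copies of `U_i`, with bases `v₁, …, v_i` and `-w_i, w_{i-1}, …, (-1)^i w₁`. -/
def SplitBlock (x y : PIdx P) (S : Finset (Fin m)) (T : Finset (Fin d))
    (ch : PIdx P → ℕ → WSpace k m d) : Prop :=
  ∃ e : Fin (len x) ↪ Fin m, S = Finset.univ.map e ∧ T = ∅ ∧
    ∀ s : Fin (len x), ch x s = vv (e s) ∧
      ch y s = ((-1 : k) ^ ((s : ℕ) + 1)) • ww (e s.rev)

/-- Two copies of `U_i`, with bases `v₁, …, v_{i-1}, w_i` and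
`v_i, -w_{i-1}, w_{i-2}, …, (-1)^{i-1} w₁`. -/
def TwistedSplitBlock (x y : PIdx P) (S : Finset (Fin m)) (T : Finset (Fin d))
    (ch : PIdx P → ℕ → WSpace k m d) : Prop :=
  ∃ e : Fin (len x) ↪ Fin m, S = Finset.univ.map e ∧ T = ∅ ∧
    ∀ s : Fin (len x),
      ch x s = (if (s : ℕ) + 1 = len x then ww (e s) else vv (e s)) ∧
      ch y s = (if (s : ℕ) = 0 then vv (e s.rev) else ((-1 : k) ^ (s : ℕ)) • ww (e s.rev))

/-- The sequence `τ v₁, …, τ v_K, c, -ε w_K, ε w_{K-1}, …, (-1)^K ε w₁`, where `v_j, w_j` stand for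
the hyperbolic pair of index `a j`, and `c` is the vector of weight zero. -/
def oddChain {K : ℕ} (a : Fin K → Fin m) (τ ε : k) (c : WSpace k m d) (s : ℕ) : WSpace k m d :=
  if h : s < K then τ • vv (a ⟨s, h⟩)
  else if h' : K < s ∧ s ≤ 2 * K then
    (ε * (-1) ^ (s - K)) • ww (a ⟨2 * K - s, by omega⟩)
  else c

/-- For each `t`, the chain of `x t` is an `oddChain`. Here `e` lists injectively all the indices
of hyperbolic pairs in use: `(len (x t) - 1) / 2` of them for each `t`, and a set `C` of further
ones, spanning part of the zero weight space. -/
def OddChains {ι C : Type} (x : ι → PIdx P)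
    (e : ((Σ t, Fin (len (x t) / 2)) ⊕ C) ↪ Fin m) (τ ε : ι → k) (c : ι → WSpace k m d)
    (ch : PIdx P → ℕ → WSpace k m d) : Prop :=
  ∀ t, ∀ s < len (x t),
    ch (x t) s = oddChain (fun j => e (Sum.inl ⟨t, j⟩)) (τ t) (ε t) (c t) s

def EvenBlock (γ : Finset (PIdx P)) (S : Finset (Fin m)) (T : Finset (Fin d))
    (ch : PIdx P → ℕ → WSpace k m d) : Prop :=
  ∃ x y, EvenRel x y ∧ γ = {x, y} ∧ SplitBlock x y S T ch

def TwistedEvenBlock (γ : Finset (PIdx P)) (S : Finset (Fin m)) (T : Finset (Fin d))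
    (ch : PIdx P → ℕ → WSpace k m d) : Prop :=
  ∃ x y, EvenRel x y ∧ γ = {x, y} ∧ TwistedSplitBlock x y S T ch

def HypBlock (r : PIdx P → k) (γ : Finset (PIdx P)) (S : Finset (Fin m)) (T : Finset (Fin d))
    (ch : PIdx P → ℕ → WSpace k m d) : Prop :=
  ∃ x y, HypRel r x y ∧ γ = {x, y} ∧ SplitBlock x y S T ch

/-- The zero weight space is the hyperbolic plane `⟨v_p, w_p⟩`, with orthogonal basis
`(u/2) v_p ± w_p`. -/
def PairsBlock (r : PIdx P → k) (γ : Finset (PIdx P)) (S : Finset (Fin m)) (T : Finset (Fin d))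
    (ch : PIdx P → ℕ → WSpace k m d) : Prop :=
  ∃ x : Fin 2 → PIdx P, PairsRel r (x 0) (x 1) ∧ γ = {x 0, x 1} ∧
    ∃ u : k, SameClass (r (x 0)) u ∧
    ∃ e : ((Σ t, Fin (len (x t) / 2)) ⊕ Fin 1) ↪ Fin m, S = Finset.univ.map e ∧ T = ∅ ∧
      OddChains x e ![u, u] ![1, -1]
        ![(u / 2) • vv (e (Sum.inr 0)) + ww (e (Sum.inr 0)),
          (u / 2) • vv (e (Sum.inr 0)) - ww (e (Sum.inr 0))] ch

/-- The zero weight space is spanned by two hyperbolic planes. -/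
def QuadBlock (r : PIdx P → k) (γ : Finset (PIdx P)) (S : Finset (Fin m)) (T : Finset (Fin d))
    (ch : PIdx P → ℕ → WSpace k m d) : Prop :=
  ∃ x : Fin 4 → PIdx P, QuadRel r x ∧ γ = Finset.univ.image x ∧
    ∃ u : k, SameClass (r (x 0)) u ∧
    ∃ c s : k, c ^ 2 + s ^ 2 = -1 ∧
    ∃ e : ((Σ t, Fin (len (x t) / 2)) ⊕ Fin 2) ↪ Fin m, S = Finset.univ.map e ∧ T = ∅ ∧
      OddChains x e (fun _ => u) (fun _ => 1)
        ![(u / 2) • vv (e (Sum.inr 0)) + ww (e (Sum.inr 0)),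
          (u / 2) • vv (e (Sum.inr 1)) + ww (e (Sum.inr 1)),
          (c * u / 2) • vv (e (Sum.inr 0)) + (s * u / 2) • vv (e (Sum.inr 1))
            - c • ww (e (Sum.inr 0)) - s • ww (e (Sum.inr 1)),
          (-(s * u / 2)) • vv (e (Sum.inr 0)) + (c * u / 2) • vv (e (Sum.inr 1))
            + s • ww (e (Sum.inr 0)) - c • ww (e (Sum.inr 1))] ch

/-- The zero weight space is spanned by a hyperbolic plane and the vector `z_ℓ`. -/
def TripBlock (r : PIdx P → k) (ρ : Fin d → k) (γ : Finset (PIdx P)) (S : Finset (Fin m))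
    (T : Finset (Fin d)) (ch : PIdx P → ℕ → WSpace k m d) : Prop :=
  ∃ (x : Fin 3 → PIdx P) (l : Fin d), TripRel r ρ x l ∧ γ = Finset.univ.image x ∧
    ∃ c s : k, c ^ 2 + s ^ 2 = -1 ∧
    ∃ e : ((Σ t, Fin (len (x t) / 2)) ⊕ Fin 1) ↪ Fin m, S = Finset.univ.map e ∧ T = {l} ∧
      OddChains x e (fun _ => -ρ l) (fun _ => 1)
        ![(c * ρ l / 2) • vv (e (Sum.inr 0)) + c • ww (e (Sum.inr 0)) + s • zz l,
          (ρ l / 2) • vv (e (Sum.inr 0)) - ww (e (Sum.inr 0)),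
          (-(s * ρ l / 2)) • vv (e (Sum.inr 0)) - s • ww (e (Sum.inr 0)) + c • zz l] ch

/-- The zero weight space is spanned by `z_ℓ` and `z_κ`. -/
def SignBlock (r : PIdx P → k) (ρ : Fin d → k) (γ : Finset (PIdx P)) (S : Finset (Fin m))
    (T : Finset (Fin d)) (ch : PIdx P → ℕ → WSpace k m d) : Prop :=
  ∃ (x : Fin 2 → PIdx P) (l l' : Fin d), SignRel r ρ x l l' ∧ γ = Finset.univ.image x ∧
    ∃ c s : k, c ^ 2 + s ^ 2 = -1 ∧
    ∃ e : ((Σ t, Fin (len (x t) / 2)) ⊕ Fin 0) ↪ Fin m, S = Finset.univ.map e ∧ T = {l, l'} ∧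
      OddChains x e (fun _ => -ρ l) (fun _ => 1)
        ![c • zz l - s • zz l', s • zz l + c • zz l'] ch

/-- Each index pair of `γ` uses one vector `z_ℓ` as its zero weight space. -/
def AniBlock (r : PIdx P → k) (ρ : Fin d → k) (γ : Finset (PIdx P)) (S : Finset (Fin m))
    (T : Finset (Fin d)) (ch : PIdx P → ℕ → WSpace k m d) : Prop :=
  ∃ f : ↥γ ↪ Fin d, AniRel r ρ γ f ∧ T = Finset.univ.map f ∧
    ∃ e : ((Σ t : ↥γ, Fin (len t.1 / 2)) ⊕ Fin 0) ↪ Fin m, S = Finset.univ.map e ∧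
      OddChains (fun t : ↥γ => t.1) e (fun t => ρ (f t)) (fun _ => 1) (fun t => zz (f t)) ch

/-- A realization of `Γ` in the basis of `V`: disjoint subsets `B_γ` exhausting the basis, and the
`𝔰𝔩₂`-bases attached to the index pairs. The parts in `W` (necessarily even) are given the
twisted bases. -/
structure Realization (r : PIdx P → k) (ρ : Fin d → k) (m : ℕ)
    (Γ : Finpartition (Finset.univ : Finset (PIdx P))) (W : Finset (Finset (PIdx P))) where
  S : Finset (PIdx P) → Finset (Fin m)
  T : Finset (PIdx P) → Finset (Fin d)
  ch : PIdx P → ℕ → WSpace k m d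
  S_disj : (Γ.parts : Set (Finset (PIdx P))).PairwiseDisjoint S
  T_disj : (Γ.parts : Set (Finset (PIdx P))).PairwiseDisjoint T
  S_cover : ∀ a, ∃ γ ∈ Γ.parts, a ∈ S γ
  T_cover : ∀ l, ∃ γ ∈ Γ.parts, l ∈ T γ
  twisted : ∀ γ ∈ Γ.parts, γ ∈ W → TwistedEvenBlock γ (S γ) (T γ) ch
  plain : ∀ γ ∈ Γ.parts, γ ∉ W →
    EvenBlock γ (S γ) (T γ) ch ∨ HypBlock r γ (S γ) (T γ) ch ∨ PairsBlock r γ (S γ) (T γ) ch ∨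
    QuadBlock r γ (S γ) (T γ) ch ∨ TripBlock r ρ γ (S γ) (T γ) ch ∨
    SignBlock r ρ γ (S γ) (T γ) ch ∨ AniBlock r ρ γ (S γ) (T γ) ch

/-- `D` is the triple determined by the realization: it acts in the standard way on each of the
`𝔰𝔩₂`-bases. -/
def Realization.Determines {r : PIdx P → k} {ρ : Fin d → k}
    {Γ : Finpartition (Finset.univ : Finset (PIdx P))} {W : Finset (Finset (PIdx P))}
    (R : Realization r ρ m Γ W) (D : Triple k m d) : Prop :=
  ∀ x : PIdx P, D.ActsStandard (len x) (R.ch x)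

end Blocks

/-! ### The standard apartment -/

section Apartment

variable {k : Type*} [Field k] [ValuativeRel k] [TopologicalSpace k] [IsNonarchimedeanLocalField k]
variable {m d : ℕ}

/-- The normalized valuation on nonzero elements of `k`: a uniformizer has valuation `1`. -/
def val (a : k) : ℤ :=
  -WithZero.log (IsNonarchimedeanLocalField.valueGroupWithZeroIsoInt k (valuation k a))

/-- The apartment `A = X_*(T) ⊗ ℝ`, with `ε_i` the `i`-th coordinate. -/
abbrev Apt (m : ℕ) : Type := Fin m → ℝ

/-- The affine roots on `A`, up to sign: `ε_i - ε_j + n`, `ε_i + ε_j + n` for `i ≠ j`, and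
`ε_i + val(ρ_ℓ)/2 + n`, where `n` is an integer. (Relative to the chosen pinning, the root vector
attached to `ε_i` and `z_ℓ` has valuation `val(ρ_ℓ)/2`.) -/
def affineRoots (m : ℕ) (ρ : Fin d → k) : Set (Apt m → ℝ) :=
  {ψ | (∃ (i j : Fin m) (n : ℤ), i ≠ j ∧ ψ = fun x : Apt m => x i - x j + n) ∨
    (∃ (i j : Fin m) (n : ℤ), i ≠ j ∧ ψ = fun x : Apt m => x i + x j + n) ∨
    (∃ (i : Fin m) (l : Fin d) (n : ℤ), ψ = fun x : Apt m => x i + (val (ρ l) : ℝ) / 2 + n)}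

/-- A facet of `A`: a class of points which lie on the same side of, or on, each affine root
hyperplane. -/
def IsFacet (ρ : Fin d → k) (F : Set (Apt m)) : Prop :=
  ∃ x : Apt m, F = {y | ∀ ψ ∈ affineRoots m ρ, SignType.sign (ψ y) = SignType.sign (ψ x)}

/-- The dimension of a facet: that of its affine span. -/
def facetDim (F : Set (Apt m)) : ℕ := Module.finrank ℝ (vectorSpan ℝ F)

/-- The weight of each basis vector at the point `x`, with `z_ℓ` shifted by `val(ρ_ℓ)/2`; the
lattice function attached to `x` is `t ↦ {u | val(u_a) + wt_a ≥ t for all a}`. -/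
def wt (ρ : Fin d → k) (x : Apt m) : WIdx m d → ℝ
  | Sum.inl i => x i
  | Sum.inr (Sum.inl i) => -x i
  | Sum.inr (Sum.inr l) => (val (ρ l) : ℝ) / 2

/-- The lattice `𝔤_{x,0}` in `𝔰𝔬(q)` attached to a point `x` of `A`: for each `α`, the component of
`X` in the root space of `α` has valuation at least `-α(x)`, where the pinning is such that the
coefficient of a root vector of `±ε_i ± ε_j` counts with its own valuation, and that of a root
vector of `±ε_i` attached to `z_ℓ` is shifted by `val(ρ_ℓ)/2`; and the component in the centralizer
of the torus is integral. Equivalently, `X` preserves the lattice function attached to `x`. -/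
def parahoricLattice (ρ : Fin d → k) (x : Apt m) : Set (Matrix (WIdx m d) (WIdx m d) k) :=
  {X | IsSkew ρ X ∧ ∀ a b, X a b ≠ 0 → 0 ≤ (val (X a b) : ℝ) + wt ρ x a - wt ρ x b}

/-- The set `B(Y, H, X) ∩ A`. -/
def buildingSet (ρ : Fin d → k) (D : Triple k m d) : Set (Apt m) :=
  {x | D.Y ∈ parahoricLattice ρ x ∧ D.H ∈ parahoricLattice ρ x ∧ D.X ∈ parahoricLattice ρ x}

/-- `F` is a maximal facet in `Ω`: a facet contained in `Ω` and not a proper face of another one. -/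
def IsMaximalFacet (ρ : Fin d → k) (Ω F : Set (Apt m)) : Prop :=
  IsFacet ρ F ∧ F ⊆ Ω ∧ ∀ F', IsFacet ρ F' → F' ⊆ Ω → F ⊆ closure F' → F' = F

/-- There are maximal facets in `Ω`, they all have dimension `N`, and this is the largest dimension
of a facet in `Ω`. -/
def MaximalFacetsHaveDim (ρ : Fin d → k) (Ω : Set (Apt m)) (N : ℕ) : Prop :=
  (∃ F, IsMaximalFacet ρ Ω F) ∧ (∀ F, IsMaximalFacet ρ Ω F → facetDim F = N) ∧
    ∀ F, IsFacet ρ F → F ⊆ Ω → facetDim F ≤ N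

end Apartment

end OrthNil

end

/-!
The sequences of a realization are paired with one another by the form exactly as the strings of an
`𝔰𝔩₂`-module with invariant form are: each is orthogonal to all but one of them (itself, or its
partner), and is dual to that one read backwards, with alternating signs (`IsChainSystem`). So their
vectors form a basis, the triple exists and is unique, and the relations and membership in `𝔰𝔬(q)`
are checked on this basis.

A point `x` of the apartment is a norm on `V`, and `x ∈ B(Y, H, X)` says that `X`, `H`, `Y` do not
decrease levels. Since `p > h`, the integers occurring in `Y` are units, so all vectors of a sequence
must have the same level (`inLattice_chain_iff`); conversely, if the sequences have constant levels
that are dual to one another, the norm splits along them and `x ∈ B(Y, H, X)`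
(`IsChainSystem.mem_buildingSet`). These conditions are linear equations in the coordinates of `x`,
separate for each member of `Γ` (`IsBlock`). For two sequences in duality, spanning complementary
isotropic spaces, they leave one parameter (`isBlock_of_dual`); for all other shapes each sequence is
self-dual, and the coordinates are pinned down to half-integers (`isBlock_of_oddChains`). For the
shapes quad, trip and sign this uses that `c` and `s` are integral, which holds because `-1` is not a
square (`val_nonneg_of_sq_add_sq`). In all cases the equations hold on the whole facet of each of their
solutions, the prescribed values being visible on affine root hyperplanes.

Hence `B(Y, H, X)` is an affine subspace and a union of facets, whose dimension is the number of
members of `Γ` of the shapes even and hyp. Moving its points a little in a generic direction leads to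
facets open in it, and these are the maximal ones (`maximalFacetsHaveDim_of_submodule`).

In the very even case, the permutation of the basis that matches the hyperbolic pairs of the two
realizations and exchanges `v` and `w` in one of them carries `X` to `X'`, and has determinant `-1`.
That no element of determinant `1` does so follows from `det_eq_one_of_commute`: the centralizer of
`X` in `O(q)` lies in `SO(q)`, since all Jordan blocks of `X` have even size.
-/

open scoped Matrix
open ValuativeRel

noncomputable section

namespace OrthNil

/-! ### The normalized valuation -/

section Valuation

variable {k : Type*} [Field k] [ValuativeRel k] [TopologicalSpace k] [IsNonarchimedeanLocalField k]

theorem valuation_val {a : k} (ha : a ≠ 0) :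
    IsNonarchimedeanLocalField.valueGroupWithZeroIsoInt k (valuation k a) =
      WithZero.exp (-val a) := by
  rw [val, neg_neg, WithZero.exp_log]
  simpa using ha

theorem val_mul {a b : k} (ha : a ≠ 0) (hb : b ≠ 0) : val (a * b) = val a + val b := by
  rw [val, map_mul, map_mul, WithZero.log_mul (by simpa using ha) (by simpa using hb), val, val]
  ring

@[simp] theorem val_one : val (1 : k) = 0 := by simp [val]

@[simp] theorem val_neg (a : k) : val (-a) = val a := by simp [val, Valuation.map_neg]

theorem val_inv (a : k) : val a⁻¹ = -val a := by simp [val]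

theorem val_div {a b : k} (ha : a ≠ 0) (hb : b ≠ 0) : val (a / b) = val a - val b := by
  rw [div_eq_mul_inv, val_mul ha (inv_ne_zero hb), val_inv, sub_eq_add_neg]

theorem valuation_le_iff {a b : k} (ha : a ≠ 0) (hb : b ≠ 0) :
    valuation k a ≤ valuation k b ↔ val b ≤ val a := by
  rw [← map_le_map_iff (IsNonarchimedeanLocalField.valueGroupWithZeroIsoInt k), valuation_val ha,
    valuation_val hb, WithZero.exp_le_exp, neg_le_neg_iff]

theorem valuation_le_one_iff {a : k} (ha : a ≠ 0) : valuation k a ≤ 1 ↔ 0 ≤ val a := by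
  simpa using valuation_le_iff ha one_ne_zero

theorem le_val_add {a b : k} {t : ℝ} (ha : a ≠ 0 → t ≤ val a) (hb : b ≠ 0 → t ≤ val b)
    (hab : a + b ≠ 0) : t ≤ val (a + b) := by
  rcases eq_or_ne a 0 with rfl | ha0
  · simpa using hb (by simpa using hab)
  rcases eq_or_ne b 0 with rfl | hb0
  · simpa using ha ha0
  rcases (valuation k).map_add' a b with h | h
  · exact (ha ha0).trans (by exact_mod_cast (valuation_le_iff hab ha0).1 h)
  · exact (hb hb0).trans (by exact_mod_cast (valuation_le_iff hab hb0).1 h)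

theorem val_intCast_nonneg (N : ℤ) (h : (N : k) ≠ 0) : 0 ≤ val (N : k) := by
  rw [← valuation_le_one_iff h]
  exact intCast_mem (valuation k).integer N

/-- An integer prime to the residual characteristic is a unit. -/
theorem val_natCast_of_not_dvd {p : ℕ} [CharP 𝓀[k] p] {N : ℕ} (h : ¬ p ∣ N) :
    (N : k) ≠ 0 ∧ val (N : k) = 0 := by
  have h1 : (N : 𝓀[k]) ≠ 0 := by rwa [Ne, CharP.cast_eq_zero_iff 𝓀[k] p]
  have h2 : IsUnit (N : 𝒪[k]) := by
    rw [← map_natCast (IsLocalRing.residue 𝒪[k])] at h1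
    exact (IsLocalRing.residue_ne_zero_iff_isUnit _).1 h1
  have h3 : valuation k (N : k) = 1 := by
    have := (Valuation.integer.integers (valuation k)).isUnit_iff_valuation_eq_one.1 h2
    simpa using this
  have h4 : (N : k) ≠ 0 := by
    intro h0; simp [h0] at h3
  exact ⟨h4, by simp [val, h3]⟩

/-- When `-1` is not a square in a local field, the solutions of `c² + s² = -1` are integral:
otherwise `s / c` reduces to a square root of `-1` in the residue field, and Hensel's lemma lifts
it. -/
theorem val_nonneg_of_sq_add_sq (h2 : (2 : k) ≠ 0 ∧ val (2 : k) = 0) (hsq : ¬ IsSquare (-1 : k))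
    {c s : k} (hcs : c ^ 2 + s ^ 2 = -1) (hc : c ≠ 0) : 0 ≤ val c := by
  by_contra! hlt
  let := IsTopologicalAddGroup.rightUniformSpace k
  have := isUniformAddGroup_of_addCommGroup (G := k)
  have hs : s ≠ 0 := by
    rintro rfl
    exact hsq ⟨c, by rw [← hcs]; ring⟩
  have hquot : (s / c) ^ 2 + 1 = -(c⁻¹ * c⁻¹) := by
    field_simp
    linear_combination hcs
  have hval : val ((s / c) ^ 2 + 1) = -2 * val c := by
    rw [hquot, val_neg, val_mul (inv_ne_zero hc) (inv_ne_zero hc), val_inv]; ring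
  have hne : (s / c) ^ 2 + 1 ≠ 0 := by
    rw [hquot]; simpa using hc
  have ha0 : s / c ≠ 0 := div_ne_zero hs hc
  have ha : val (s / c) = 0 := by
    have h1 : val ((s / c) ^ 2) = 0 := by
      have hsq0 : (s / c) ^ 2 ≠ 0 := pow_ne_zero 2 ha0
      apply le_antisymm
      · by_contra! h
        have := le_val_add (a := (s / c) ^ 2 + 1) (b := -(s / c) ^ 2) (t := 1)
          (fun _ => by rw [hval]; exact_mod_cast (by omega : (1 : ℤ) ≤ -2 * val c))
          (fun _ => by rw [val_neg]; exact_mod_cast h) (by simp)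
        simp at this
        linarith
      · have := le_val_add (a := (s / c) ^ 2 + 1) (b := -1) (t := 0)
          (fun _ => by rw [hval]; exact_mod_cast (by omega : (0 : ℤ) ≤ -2 * val c))
          (fun _ => by simp) (by simpa using ha0)
        rw [add_neg_cancel_right] at this
        exact_mod_cast this
    rw [pow_two, val_mul ha0 ha0] at h1
    omega
  have hint := Valuation.integer.integers (valuation k)
  let a : 𝒪[k] := ⟨s / c, (valuation_le_one_iff ha0).2 ha.ge⟩
  have hunit : ∀ x : 𝒪[k], (x : k) ≠ 0 → (IsUnit x ↔ val (x : k) = 0) := by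
    intro x hx
    rw [hint.isUnit_iff_valuation_eq_one]
    change valuation k (x : k) = 1 ↔ _
    rw [le_antisymm_iff, valuation_le_one_iff hx, ← map_one (valuation k),
      valuation_le_iff one_ne_zero hx, val_one, le_antisymm_iff]
    exact and_comm
  have h0 : (Polynomial.X ^ 2 + 1 : Polynomial 𝒪[k]).eval a ∈ 𝓂[k] := by
    rw [IsLocalRing.mem_maximalIdeal, mem_nonunits_iff]
    have hcoe : (((Polynomial.X ^ 2 + 1 : Polynomial 𝒪[k]).eval a : 𝒪[k]) : k) = (s / c) ^ 2 + 1 := by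
      simp [a]
    rw [hunit _ (by rwa [hcoe]), hcoe, hval]
    omega
  have h1 : IsUnit ((Polynomial.X ^ 2 + 1 : Polynomial 𝒪[k]).derivative.eval a) := by
    have hcoe : (((Polynomial.X ^ 2 + 1 : Polynomial 𝒪[k]).derivative.eval a : 𝒪[k]) : k) =
        2 * (s / c) := by
      simp [a]
      norm_num
    rw [hunit _ (by rw [hcoe]; exact mul_ne_zero h2.1 ha0), hcoe, val_mul h2.1 ha0, h2.2, ha,
      add_zero]
  obtain ⟨b, hb, -⟩ := HenselianRing.is_henselian (I := 𝓂[k]) (Polynomial.X ^ 2 + 1) (by monicity!)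
    a h0 (h1.map _)
  refine hsq ⟨b, ?_⟩
  have hb' : b ^ 2 + 1 = 0 := by simpa [Polynomial.IsRoot] using hb
  have := congrArg (Subtype.val) hb'
  push_cast at this
  linear_combination -this

end Valuation

/-! ### The quadratic space -/

section Form

variable {k : Type*} [Field k] {m d : ℕ}

/-- The bilinear form `B` of the quadratic space, with matrix `gram ρ`. -/
def form (ρ : Fin d → k) : LinearMap.BilinForm k (WSpace k m d) := Matrix.toBilin' (gram ρ)

theorem form_eq_dotProduct (ρ : Fin d → k) (u u' : WSpace k m d) :
    form ρ u u' = u ⬝ᵥ gram ρ *ᵥ u' := Matrix.toBilin'_apply' ..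

theorem gram_mulVec_v (ρ : Fin d → k) (u : WSpace k m d) (i : Fin m) :
    (gram ρ *ᵥ u) (Sum.inl i) = u (Sum.inr (Sum.inl i)) := by
  simp [Matrix.mulVec, dotProduct, gram]

theorem gram_mulVec_w (ρ : Fin d → k) (u : WSpace k m d) (i : Fin m) :
    (gram ρ *ᵥ u) (Sum.inr (Sum.inl i)) = u (Sum.inl i) := by
  simp [Matrix.mulVec, dotProduct, gram]

theorem gram_mulVec_z (ρ : Fin d → k) (u : WSpace k m d) (l : Fin d) :
    (gram ρ *ᵥ u) (Sum.inr (Sum.inr l)) = ρ l * u (Sum.inr (Sum.inr l)) := by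
  simp [Matrix.mulVec, dotProduct, gram]

theorem form_apply (ρ : Fin d → k) (u u' : WSpace k m d) :
    form ρ u u' = ∑ i, u (Sum.inl i) * u' (Sum.inr (Sum.inl i)) +
      (∑ i, u (Sum.inr (Sum.inl i)) * u' (Sum.inl i) +
        ∑ l, u (Sum.inr (Sum.inr l)) * (ρ l * u' (Sum.inr (Sum.inr l)))) := by
  rw [form_eq_dotProduct, dotProduct, Fintype.sum_sum_type, Fintype.sum_sum_type]
  simp only [gram_mulVec_v, gram_mulVec_w, gram_mulVec_z]

@[simp] theorem form_vv (ρ : Fin d → k) (i : Fin m) (u : WSpace k m d) :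
    form ρ (vv i) u = u (Sum.inr (Sum.inl i)) := by
  rw [form_eq_dotProduct, vv, single_one_dotProduct, gram_mulVec_v]

@[simp] theorem form_ww (ρ : Fin d → k) (i : Fin m) (u : WSpace k m d) :
    form ρ (ww i) u = u (Sum.inl i) := by
  rw [form_eq_dotProduct, ww, single_one_dotProduct, gram_mulVec_w]

@[simp] theorem form_zz (ρ : Fin d → k) (l : Fin d) (u : WSpace k m d) :
    form ρ (zz l) u = ρ l * u (Sum.inr (Sum.inr l)) := by
  rw [form_eq_dotProduct, zz, single_one_dotProduct, gram_mulVec_z]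

theorem form_comm (ρ : Fin d → k) (u u' : WSpace k m d) : form ρ u u' = form ρ u' u := by
  simp only [form_apply, mul_comm, mul_left_comm]
  ring

theorem form_nondegenerate {ρ : Fin d → k} (hρ : ∀ l, ρ l ≠ 0) {u : WSpace k m d}
    (h : ∀ u', form ρ u u' = 0) : u = 0 := by
  ext a
  rcases a with i | i | l
  · simpa using (form_comm ρ _ _).trans (h (ww i))
  · simpa using (form_comm ρ _ _).trans (h (vv i))
  · simpa [hρ l] using (form_comm ρ _ _).trans (h (zz l))

/-- Vectors whose supports involve no common `z_ℓ` and no common hyperbolic pair are orthogonal. -/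
theorem form_eq_zero_of_disjoint (ρ : Fin d → k) {u u' : WSpace k m d}
    (h1 : ∀ i, (u (Sum.inl i) = 0 ∧ u (Sum.inr (Sum.inl i)) = 0) ∨
      (u' (Sum.inl i) = 0 ∧ u' (Sum.inr (Sum.inl i)) = 0))
    (h2 : ∀ l, u (Sum.inr (Sum.inr l)) = 0 ∨ u' (Sum.inr (Sum.inr l)) = 0) : form ρ u u' = 0 := by
  rw [form_apply, Finset.sum_eq_zero, Finset.sum_eq_zero, Finset.sum_eq_zero]
  · simp
  · rintro l -
    rcases h2 l with h | h <;> simp [h]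
  · rintro i -
    rcases h1 i with h | h <;> simp [h.1, h.2]
  · rintro i -
    rcases h1 i with h | h <;> simp [h.1, h.2]

theorem isSkew_iff (ρ : Fin d → k) (X : Matrix (WIdx m d) (WIdx m d) k) :
    IsSkew ρ X ↔ ∀ u u', form ρ (X *ᵥ u) u' = -form ρ u (X *ᵥ u') := by
  have key : ∀ u u' : WSpace k m d, form ρ (X *ᵥ u) u' + form ρ u (X *ᵥ u') =
      u ⬝ᵥ (Xᵀ * gram ρ + gram ρ * X) *ᵥ u' := by
    intro u u'
    rw [form_eq_dotProduct, form_eq_dotProduct, Matrix.add_mulVec, dotProduct_add,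
      ← Matrix.mulVec_mulVec, ← Matrix.mulVec_mulVec, Matrix.dotProduct_mulVec u Xᵀ,
      Matrix.vecMul_transpose]
  simp only [eq_neg_iff_add_eq_zero, key, IsSkew]
  constructor
  · intro h u u'
    simp [h]
  · intro h
    ext a b
    simpa using h (Pi.single a 1) (Pi.single b 1)

theorem isOrth_iff (ρ : Fin d → k) (g : Matrix (WIdx m d) (WIdx m d) k) :
    IsOrth ρ g ↔ ∀ u u', form ρ (g *ᵥ u) (g *ᵥ u') = form ρ u u' := by
  have key : ∀ u u' : WSpace k m d, form ρ (g *ᵥ u) (g *ᵥ u') =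
      u ⬝ᵥ (gᵀ * gram ρ * g) *ᵥ u' := by
    intro u u'
    rw [form_eq_dotProduct, ← Matrix.mulVec_mulVec, ← Matrix.mulVec_mulVec,
      Matrix.dotProduct_mulVec u gᵀ, Matrix.vecMul_transpose]
  simp only [key, IsOrth]
  constructor
  · intro h u u'
    rw [h, form_eq_dotProduct]
  · intro h
    ext a b
    simpa [form_eq_dotProduct] using h (Pi.single a 1) (Pi.single b 1)

end Form

/-! ### Norms attached to points of the apartment -/

section Lattice

variable {k : Type*} [Field k] [ValuativeRel k] [TopologicalSpace k] [IsNonarchimedeanLocalField k]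
variable {m d : ℕ} {ρ : Fin d → k} {x : Apt m}

/-- The vector `u` lies in the lattice of level `t` attached to the point `x` of the apartment. -/
def InLattice (ρ : Fin d → k) (x : Apt m) (t : ℝ) (u : WSpace k m d) : Prop :=
  ∀ a, u a ≠ 0 → t ≤ val (u a) + wt ρ x a

theorem InLattice.zero (t : ℝ) : InLattice ρ x t (0 : WSpace k m d) := fun _ h => absurd rfl h

theorem InLattice.mono {t t' : ℝ} {u : WSpace k m d} (h : InLattice ρ x t u) (ht : t' ≤ t) :
    InLattice ρ x t' u := fun a ha => ht.trans (h a ha)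

theorem InLattice.add {t : ℝ} {u u' : WSpace k m d} (h : InLattice ρ x t u)
    (h' : InLattice ρ x t u') : InLattice ρ x t (u + u') := by
  intro a ha
  have := le_val_add (a := u a) (b := u' a) (t := t - wt ρ x a) (fun h0 => by linarith [h a h0])
    (fun h0 => by linarith [h' a h0]) ha
  rw [Pi.add_apply]
  linarith

theorem InLattice.sum {ι : Type*} {t : ℝ} (s : Finset ι) {u : ι → WSpace k m d}
    (h : ∀ i ∈ s, InLattice ρ x t (u i)) : InLattice ρ x t (∑ i ∈ s, u i) :=
  Finset.sum_induction u (InLattice ρ x t) (fun _ _ => InLattice.add) (InLattice.zero t) h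

theorem inLattice_smul_iff {c : k} (hc : c ≠ 0) {t : ℝ} {u : WSpace k m d} :
    InLattice ρ x t (c • u) ↔ InLattice ρ x (t - val c) u := by
  refine forall_congr' fun a => ?_
  simp only [Pi.smul_apply, smul_eq_mul, ne_eq, mul_eq_zero, hc, false_or]
  refine imp_congr_right fun ha => ?_
  rw [val_mul hc ha]
  push_cast
  constructor <;> intro h <;> linarith

theorem InLattice.smul {c : k} {t t' : ℝ} {u : WSpace k m d} (h : InLattice ρ x t u)
    (hc : c ≠ 0 → t' ≤ val c + t) : InLattice ρ x t' (c • u) := by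
  rcases eq_or_ne c 0 with rfl | h0
  · rw [zero_smul]; exact InLattice.zero _
  · exact (inLattice_smul_iff h0).2 (h.mono (by linarith [hc h0]))

theorem inLattice_single {t : ℝ} {a : WIdx m d} :
    InLattice ρ x t (Pi.single a (1 : k)) ↔ t ≤ wt ρ x a := by
  constructor
  · intro h
    simpa using h a (by simp)
  · intro h b hb
    obtain rfl : b = a := by
      by_contra hne
      exact hb (by simp [hne])
    simpa using h

theorem inLattice_vv {t : ℝ} {i : Fin m} : InLattice ρ x t (vv i) ↔ t ≤ x i := inLattice_single

theorem inLattice_ww {t : ℝ} {i : Fin m} : InLattice ρ x t (ww i) ↔ t ≤ -x i := inLattice_single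

theorem inLattice_zz {t : ℝ} {l : Fin d} : InLattice ρ x t (zz l) ↔ t ≤ (val (ρ l) : ℝ) / 2 :=
  inLattice_single

/-- The pairing of two vectors is as integral as their levels predict. -/
theorem InLattice.le_val_form_single (hρ : ∀ l, ρ l ≠ 0) {t : ℝ} {u : WSpace k m d}
    (h : InLattice ρ x t u) (a : WIdx m d) (h0 : form ρ (Pi.single a 1) u ≠ 0) :
    wt ρ x a + t ≤ val (form ρ (Pi.single a 1) u) := by
  rcases a with i | i | l
  · have e := form_vv ρ i u
    rw [vv] at e
    rw [e] at h0 ⊢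
    have := h _ h0
    simp only [wt] at this ⊢
    linarith
  · have e := form_ww ρ i u
    rw [ww] at e
    rw [e] at h0 ⊢
    have := h _ h0
    simp only [wt] at this ⊢
    linarith
  · have e := form_zz ρ l u
    rw [zz] at e
    rw [e] at h0 ⊢
    have hu := right_ne_zero_of_mul h0
    have := h _ hu
    rw [val_mul (hρ l) hu]
    push_cast
    simp only [wt] at this ⊢
    linarith

theorem inLattice_mulVec {X : Matrix (WIdx m d) (WIdx m d) k} (hX : X ∈ parahoricLattice ρ x)
    {t : ℝ} {u : WSpace k m d} (hu : InLattice ρ x t u) : InLattice ρ x t (X *ᵥ u) := by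
  rw [Matrix.mulVec_eq_sum]
  refine InLattice.sum _ fun b _ => ?_
  rw [op_smul_eq_smul]
  rcases eq_or_ne (u b) 0 with h0 | h0
  · rw [h0, zero_smul]; exact InLattice.zero _
  rw [inLattice_smul_iff h0]
  intro a ha
  have h1 := hX.2 a b ha
  have h2 := hu b h0
  rw [Matrix.transpose_apply]
  linarith

theorem mem_parahoricLattice_of {X : Matrix (WIdx m d) (WIdx m d) k} (hX : IsSkew ρ X)
    (h : ∀ b, InLattice ρ x (wt ρ x b) (X *ᵥ Pi.single b 1)) : X ∈ parahoricLattice ρ x := by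
  refine ⟨hX, fun a b hab => ?_⟩
  have := h b a (by simpa using hab)
  simp only [Matrix.mulVec_single_one, Matrix.col_apply] at this
  linarith

end Lattice

/-! ### Systems of chains in duality -/

section Chains

variable {k : Type*} [Field k] {m d : ℕ} {I : Type*}

/-- A family of sequences `ch x 0, …, ch x (L x - 1)` of vectors, paired with one another by the
form in the way the strings of an `𝔰𝔩₂`-module with invariant form are: the sequence of `x` is
orthogonal to all but the sequence of `σ x`, read backwards, and the products alternate between
`η x` and `-η x`. -/
structure IsChainSystem (ρ : Fin d → k) (L : I → ℕ) (ch : I → ℕ → WSpace k m d) (σ : I → I)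
    (η : I → k) : Prop where
  invol : ∀ x, σ (σ x) = x
  len_eq : ∀ x, L (σ x) = L x
  ne_zero : ∀ x, η x ≠ 0
  pair : ∀ x s s', s + s' + 1 = L x → form ρ (ch x s) (ch (σ x) s') = η x * (-1) ^ s
  orth : ∀ x y s s', s < L x → s' < L y → ¬ (y = σ x ∧ s + s' + 1 = L x) →
    form ρ (ch x s) (ch y s') = 0

variable {ρ : Fin d → k} {L : I → ℕ} {ch : I → ℕ → WSpace k m d} {σ : I → I} {η : I → k}

theorem actsStandard_iff (D : Triple k m d) {i : ℕ} (hi : 0 < i) (b : ℕ → WSpace k m d) :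
    D.ActsStandard i b ↔ ∀ s < i, D.H *ᵥ b s = ((i : k) - 1 - 2 * (s : k)) • b s ∧
      D.X *ᵥ b s = (if s = 0 then 0 else b (s - 1)) ∧
      D.Y *ᵥ b s = (((s : k) + 1) * ((i : k) - ((s : k) + 1))) • b (s + 1) := by
  constructor
  · rintro ⟨h1, h2, h3, h4, h5⟩ s hs
    refine ⟨h1 s hs, ?_, ?_⟩
    · rcases s with _ | s
      · simpa using h2
      · simpa using h3 s hs
    · rcases Nat.lt_or_ge (s + 1) i with h | h
      · exact h4 s h
      · obtain rfl : i = s + 1 := by omega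
        simpa using h5
  · intro h
    refine ⟨fun s hs => (h s hs).1, by simpa using (h 0 hi).2.1, fun s hs => by
      simpa using (h (s + 1) hs).2.1, fun s hs => (h s (by omega)).2.2, ?_⟩
    obtain ⟨j, rfl⟩ : ∃ j, i = j + 1 := ⟨i - 1, by omega⟩
    simpa using (h j (by omega)).2.2

namespace IsChainSystem

variable [Fintype I]

/-- The coordinate of a combination of chain vectors is read off by pairing with the opposite
vector of the opposite chain. -/
theorem form_sum (h : IsChainSystem ρ L ch σ η) (g : (Σ x, Fin (L x)) → k)
    (x : I) (s : Fin (L x)) :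
    form ρ (∑ i, g i • ch i.1 i.2) (ch (σ x) (L x - 1 - s)) = g ⟨x, s⟩ * (η x * (-1) ^ (s : ℕ)) := by
  have hs := s.2
  rw [map_sum, LinearMap.sum_apply, Finset.sum_eq_single ⟨x, s⟩]
  · rw [map_smul, LinearMap.smul_apply, smul_eq_mul, h.pair x s _ (by omega)]
  · rintro ⟨y, t⟩ - hne
    rw [map_smul, LinearMap.smul_apply, h.orth y (σ x) _ _ t.2 (by rw [h.len_eq]; omega), smul_zero]
    rintro ⟨h1, h2⟩
    obtain rfl : y = x := by
      have := congrArg σ h1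
      rw [h.invol, h.invol] at this
      exact this.symm
    exact hne (by congr 1; ext; omega)
  · simp

theorem linearIndependent (h : IsChainSystem ρ L ch σ η) :
    LinearIndependent k (fun i : Σ x, Fin (L x) => ch i.1 i.2) := by
  rw [Fintype.linearIndependent_iff]
  rintro g hg ⟨x, s⟩
  have := h.form_sum g x s
  rw [hg, map_zero, LinearMap.zero_apply] at this
  rcases mul_eq_zero.1 this.symm with h0 | h0
  · exact h0
  · exact absurd h0 (mul_ne_zero (h.ne_zero x) (pow_ne_zero _ (by simp)))

/-- The vectors of the chains form a basis of `V`. -/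
def basis (h : IsChainSystem ρ L ch σ η) (hL : ∑ x, L x = 2 * m + d) :
    Module.Basis (Σ x, Fin (L x)) k (WSpace k m d) :=
  Module.Basis.mk h.linearIndependent (h.linearIndependent.span_eq_top_of_card_eq_finrank' (by
    simp [hL]; ring)).ge

variable (hL : ∑ x, L x = 2 * m + d)
include hL

theorem basis_apply (h : IsChainSystem ρ L ch σ η) (i : Σ x, Fin (L x)) :
    h.basis hL i = ch i.1 i.2 := by simp [basis]

theorem basis_repr (h : IsChainSystem ρ L ch σ η) (u : WSpace k m d) (i : Σ x, Fin (L x)) :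
    (h.basis hL).repr u i =
      form ρ u (ch (σ i.1) (L i.1 - 1 - i.2)) * (η i.1 * (-1) ^ (i.2 : ℕ))⁻¹ := by
  have h1 := h.form_sum ((h.basis hL).repr u) i.1 i.2
  have h2 := (h.basis hL).sum_repr u
  simp only [basis_apply] at h2
  rw [h2] at h1
  rw [h1, mul_assoc, mul_inv_cancel₀, mul_one]
  exact mul_ne_zero (h.ne_zero _) (pow_ne_zero _ (by simp))

theorem matrix_ext (h : IsChainSystem ρ L ch σ η) {A B : Matrix (WIdx m d) (WIdx m d) k}
    (hAB : ∀ x, ∀ s < L x, A *ᵥ ch x s = B *ᵥ ch x s) : A = B := by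
  apply Matrix.toLin'.injective
  refine (h.basis hL).ext fun i => ?_
  rw [basis_apply, Matrix.toLin'_apply, Matrix.toLin'_apply]
  exact hAB i.1 i.2 i.2.2

theorem form_ext (h : IsChainSystem ρ L ch σ η) {B B' : LinearMap.BilinForm k (WSpace k m d)}
    (hB : ∀ x y s t, s < L x → t < L y → B (ch x s) (ch y t) = B' (ch x s) (ch y t)) : B = B' := by
  refine LinearMap.ext_basis (h.basis hL) (h.basis hL) fun i j => ?_
  rw [basis_apply, basis_apply]
  exact hB _ _ _ _ i.2.2 j.2.2

/-- An operator that acts on the chain vectors in a prescribed way. -/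
theorem exists_matrix (h : IsChainSystem ρ L ch σ η) (f : I → ℕ → WSpace k m d) :
    ∃ A : Matrix (WIdx m d) (WIdx m d) k, ∀ x, ∀ s < L x, A *ᵥ ch x s = f x s := by
  refine ⟨LinearMap.toMatrix' ((h.basis hL).constr k fun i => f i.1 i.2), fun x s hs => ?_⟩
  rw [LinearMap.toMatrix'_mulVec, ← basis_apply hL h ⟨x, ⟨s, hs⟩⟩, Module.Basis.constr_basis]

theorem existsUnique_triple (h : IsChainSystem ρ L ch σ η) (hpos : ∀ x, 0 < L x) :
    ∃! D : Triple k m d, ∀ x, D.ActsStandard (L x) (ch x) := by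
  simp only [actsStandard_iff _ (hpos _)]
  obtain ⟨H, hH⟩ := h.exists_matrix hL fun x s => ((L x : k) - 1 - 2 * (s : k)) • ch x s
  obtain ⟨X, hX⟩ := h.exists_matrix hL fun x s => if s = 0 then 0 else ch x (s - 1)
  obtain ⟨Y, hY⟩ := h.exists_matrix hL fun x s =>
    (((s : k) + 1) * ((L x : k) - ((s : k) + 1))) • ch x (s + 1)
  refine ⟨⟨Y, H, X⟩, fun x s hs => ⟨hH x s hs, hX x s hs, hY x s hs⟩, ?_⟩
  rintro ⟨Y', H', X'⟩ hD
  congr 1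
  · exact h.matrix_ext hL fun x s hs => (hD x s hs).2.2.trans (hY x s hs).symm
  · exact h.matrix_ext hL fun x s hs => (hD x s hs).1.trans (hH x s hs).symm
  · exact h.matrix_ext hL fun x s hs => (hD x s hs).2.1.trans (hX x s hs).symm

theorem isSkew_of (h : IsChainSystem ρ L ch σ η) {X : Matrix (WIdx m d) (WIdx m d) k}
    (hX : ∀ x y s t, s < L x → t < L y →
      form ρ (X *ᵥ ch x s) (ch y t) = -form ρ (ch x s) (X *ᵥ ch y t)) : IsSkew ρ X := by
  rw [isSkew_iff]
  have := h.form_ext hL (B := (form ρ).compl₁₂ X.mulVecLin LinearMap.id)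
    (B' := -(form ρ).compl₁₂ LinearMap.id X.mulVecLin) (fun x y s t hs ht => by
      simpa using hX x y s t hs ht)
  intro u u'
  simpa using LinearMap.congr_fun₂ this u u'

/-- A triple acting on the chains in the standard way is a Lie triple in `𝔰𝔬(q)`. -/
theorem isLieTriple (h : IsChainSystem ρ L ch σ η) (hpos : ∀ x, 0 < L x) {D : Triple k m d}
    (hD : ∀ x, D.ActsStandard (L x) (ch x)) : D.IsLieTriple ρ := by
  simp only [actsStandard_iff _ (hpos _)] at hD
  have hH := fun x s hs => (hD x s hs).1
  have hX := fun x s hs => (hD x s hs).2.1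
  have hY := fun x s hs => (hD x s hs).2.2
  -- the vector `ch x (s + 1)` only occurs with coefficient zero when it lies outside the chain
  have hcoef : ∀ x s, s < L x → ¬ s + 1 < L x → ((L x : k) - ((s : k) + 1)) = 0 := by
    intro x s h1 h2
    have : L x = s + 1 := by omega
    rw [this]; push_cast; ring
  refine ⟨?_, ?_, ?_, ?_, ?_, ?_⟩
  · refine h.isSkew_of hL fun x y s t hs ht => ?_
    rw [hY x s hs, hY y t ht, map_smul, map_smul, LinearMap.smul_apply, smul_eq_mul, smul_eq_mul]
    by_cases hc : y = σ x ∧ s + t + 2 = L x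
    · obtain ⟨rfl, hc⟩ := hc
      rw [h.pair x (s + 1) t (by omega), h.pair x s (t + 1) (by omega), h.len_eq]
      have : (L x : k) = s + t + 2 := by rw [← hc]; push_cast; ring
      rw [this, pow_succ]; ring
    · have e1 : ((s : k) + 1) * ((L x : k) - (s + 1)) * form ρ (ch x (s + 1)) (ch y t) = 0 := by
        by_cases h1 : s + 1 < L x
        · rw [h.orth x y (s + 1) t h1 ht (by rintro ⟨h2, h3⟩; exact hc ⟨h2, by omega⟩), mul_zero]
        · rw [hcoef x s hs h1]; ring
      have e2 : ((t : k) + 1) * ((L y : k) - (t + 1)) * form ρ (ch x s) (ch y (t + 1)) = 0 := by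
        by_cases h1 : t + 1 < L y
        · rw [h.orth x y s (t + 1) hs h1 (by rintro ⟨h2, h3⟩; exact hc ⟨h2, by omega⟩), mul_zero]
        · rw [hcoef y t ht h1]; ring
      rw [e1, e2, neg_zero]
  · refine h.isSkew_of hL fun x y s t hs ht => ?_
    rw [hH x s hs, hH y t ht, map_smul, map_smul, LinearMap.smul_apply, smul_eq_mul, smul_eq_mul]
    by_cases hc : y = σ x ∧ s + t + 1 = L x
    · obtain ⟨rfl, hc⟩ := hc
      rw [h.len_eq, ← hc]; push_cast; ring
    · rw [h.orth x y s t hs ht hc]; simp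
  · refine h.isSkew_of hL fun x y s t hs ht => ?_
    rw [hX x s hs, hX y t ht]
    by_cases hc : y = σ x ∧ s + t = L x
    · obtain ⟨rfl, hc⟩ := hc
      rw [h.len_eq] at ht
      obtain ⟨s, rfl⟩ : ∃ j, s = j + 1 := ⟨s - 1, by omega⟩
      obtain ⟨t, rfl⟩ : ∃ j, t = j + 1 := ⟨t - 1, by omega⟩
      simp only [Nat.add_eq_zero_iff, one_ne_zero, and_false, if_false, Nat.add_sub_cancel]
      rw [h.pair x s (t + 1) (by omega), h.pair x (s + 1) t (by omega), pow_succ]; ring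
    · have e1 : form ρ (if s = 0 then 0 else ch x (s - 1)) (ch y t) = 0 := by
        split_ifs with h0
        · simp
        · exact h.orth _ _ _ _ (by omega) ht (by rintro ⟨h2, h3⟩; exact hc ⟨h2, by omega⟩)
      have e2 : form ρ (ch x s) (if t = 0 then 0 else ch y (t - 1)) = 0 := by
        split_ifs with h0
        · simp
        · exact h.orth _ _ _ _ hs (by omega) (by rintro ⟨h2, h3⟩; exact hc ⟨h2, by omega⟩)
      rw [e1, e2, neg_zero]
  · refine h.matrix_ext hL fun x s hs => ?_
    rw [Matrix.sub_mulVec, ← Matrix.mulVec_mulVec, ← Matrix.mulVec_mulVec, Matrix.smul_mulVec,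
      hX x s hs, hH x s hs, Matrix.mulVec_smul, hX x s hs]
    rcases s with _ | s
    · simp
    · simp only [Nat.add_eq_zero_iff, one_ne_zero, and_false, if_false, Nat.add_sub_cancel]
      rw [hH x s (by omega), ← sub_smul, ← Nat.cast_smul_eq_nsmul k]
      congr 1; push_cast; ring
  · refine h.matrix_ext hL fun x s hs => ?_
    rw [Matrix.sub_mulVec, ← Matrix.mulVec_mulVec, ← Matrix.mulVec_mulVec, Matrix.neg_mulVec,
      Matrix.smul_mulVec, hY x s hs, hH x s hs, Matrix.mulVec_smul, Matrix.mulVec_smul, hY x s hs]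
    by_cases h1 : s + 1 < L x
    · rw [hH x (s + 1) h1, ← Nat.cast_smul_eq_nsmul k, smul_smul, smul_smul, smul_smul,
        ← sub_smul, ← neg_smul]
      congr 1; push_cast; ring
    · rw [hcoef x s hs h1]; simp
  · refine h.matrix_ext hL fun x s hs => ?_
    rw [Matrix.sub_mulVec, ← Matrix.mulVec_mulVec, ← Matrix.mulVec_mulVec, hY x s hs, hX x s hs,
      hH x s hs, Matrix.mulVec_smul]
    have e1 : (((s : k) + 1) * ((L x : k) - (s + 1))) • D.X *ᵥ ch x (s + 1) =
        (((s : k) + 1) * ((L x : k) - (s + 1))) • ch x s := by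
      by_cases h1 : s + 1 < L x
      · rw [hX x (s + 1) h1]; simp
      · rw [hcoef x s hs h1]; simp
    rw [e1]
    rcases s with _ | s
    · simp
    · simp only [Nat.add_eq_zero_iff, one_ne_zero, and_false, if_false, Nat.add_sub_cancel]
      rw [hY x s (by omega), ← sub_smul]
      congr 1; push_cast; ring

end IsChainSystem

end Chains

/-! ### Chains at points of the apartment -/

section Lattice

variable {k : Type*} [Field k] [ValuativeRel k] [TopologicalSpace k] [IsNonarchimedeanLocalField k]
variable {m d : ℕ} {ρ : Fin d → k} {I : Type*} {L : I → ℕ} {ch : I → ℕ → WSpace k m d}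
  {σ : I → I} {η : I → k} {D : Triple k m d} {x : Apt m}

/-- If the chains are adapted to the lattice function of the point `x`, in the sense that their
rescalings by the levels `o` split it, then an operator not decreasing the levels of the chain
vectors preserves the lattice function. -/
theorem IsChainSystem.mem_parahoricLattice [Fintype I] (h : IsChainSystem ρ L ch σ η)
    (hL : ∑ y, L y = 2 * m + d) (hρ : ∀ l, ρ l ≠ 0) {o : I → ℝ}
    (ho : ∀ y, ∀ s < L y, InLattice ρ x (o y) (ch y s))
    (hη : ∀ y, (val (η y) : ℝ) ≤ o y + o (σ y)) {X : Matrix (WIdx m d) (WIdx m d) k}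
    (hX : IsSkew ρ X) (hXo : ∀ y, ∀ s < L y, InLattice ρ x (o y) (X *ᵥ ch y s)) :
    X ∈ parahoricLattice ρ x := by
  refine mem_parahoricLattice_of hX fun b => ?_
  have h2 := (h.basis hL).sum_repr (Pi.single b 1)
  simp only [basis_apply] at h2
  rw [← h2, Matrix.mulVec_sum]
  refine InLattice.sum _ fun i _ => ?_
  rw [Matrix.mulVec_smul]
  refine (hXo i.1 i.2 i.2.2).smul fun h0 => ?_
  rw [basis_repr] at h0 ⊢
  have hi := i.2.2
  have h3 := (ho (σ i.1) (L i.1 - 1 - i.2) (by rw [h.len_eq]; omega)).le_val_form_single hρ b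
    (left_ne_zero_of_mul h0)
  have h4 := hη i.1
  have hval : val (η i.1 * (-1) ^ (i.2 : ℕ)) = val (η i.1) := by
    rcases neg_one_pow_eq_or k (i.2 : ℕ) with e | e <;> rw [e] <;> simp
  rw [val_mul (left_ne_zero_of_mul h0) (right_ne_zero_of_mul h0), val_inv, hval]
  push_cast
  linarith

theorem IsChainSystem.mem_buildingSet [Fintype I] (h : IsChainSystem ρ L ch σ η)
    (hL : ∑ y, L y = 2 * m + d) (hpos : ∀ y, 0 < L y) (hρ : ∀ l, ρ l ≠ 0) {o : I → ℝ}
    (ho : ∀ y, ∀ s < L y, InLattice ρ x (o y) (ch y s))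
    (hη : ∀ y, (val (η y) : ℝ) ≤ o y + o (σ y)) (hD : ∀ y, D.ActsStandard (L y) (ch y)) :
    x ∈ buildingSet ρ D := by
  have hskew := h.isLieTriple hL hpos hD
  simp only [actsStandard_iff _ (hpos _)] at hD
  refine ⟨h.mem_parahoricLattice hL hρ ho hη hskew.1 fun y s hs => ?_,
    h.mem_parahoricLattice hL hρ ho hη hskew.2.1 fun y s hs => ?_,
    h.mem_parahoricLattice hL hρ ho hη hskew.2.2.1 fun y s hs => ?_⟩
  · rw [(hD y s hs).2.2]
    by_cases h1 : s + 1 < L y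
    · have e : ((s : k) + 1) * ((L y : k) - (s + 1)) =
          (((s : ℤ) + 1) * ((L y : ℤ) - (s + 1)) : ℤ) := by push_cast; ring
      refine (ho y _ h1).smul fun h0 => ?_
      rw [e] at h0 ⊢
      have : (0 : ℝ) ≤ val ((((s : ℤ) + 1) * ((L y : ℤ) - (s + 1)) : ℤ) : k) := by
        exact_mod_cast val_intCast_nonneg _ h0
      linarith
    · obtain e : L y = s + 1 := by omega
      rw [e]
      simp [InLattice.zero]
  · rw [(hD y s hs).1]
    have e : ((L y : k) - 1 - 2 * s) = ((L y - 1 - 2 * s : ℤ) : k) := by push_cast; ring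
    refine (ho y _ hs).smul fun h0 => ?_
    rw [e] at h0 ⊢
    have : (0 : ℝ) ≤ val ((L y - 1 - 2 * s : ℤ) : k) := by
      exact_mod_cast val_intCast_nonneg _ h0
    linarith
  · rw [(hD y s hs).2.1]
    split_ifs
    · exact InLattice.zero _
    · exact ho y _ (by omega)

/-- At a point of `B(Y, H, X)`, all vectors of a chain have the same level, as long as the
coefficients `s (i - s)` of `Y` are units. -/
theorem inLattice_chain_iff {i : ℕ} {b : ℕ → WSpace k m d} (hD : D.ActsStandard i b)
    (hx : x ∈ buildingSet ρ D) (hunit : ∀ N : ℕ, 0 < N → N < i → (N : k) ≠ 0 ∧ val (N : k) = 0)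
    {s s' : ℕ} (hs : s < i) (hs' : s' < i) {t : ℝ} :
    InLattice ρ x t (b s) ↔ InLattice ρ x t (b s') := by
  have step : ∀ s, s + 1 < i → (InLattice ρ x t (b s) ↔ InLattice ρ x t (b (s + 1))) := by
    intro s hs
    refine ⟨fun h => ?_, fun h => ?_⟩
    · have h1 := inLattice_mulVec hx.1 h
      rw [hD.2.2.2.1 s hs] at h1
      have e : ((s : k) + 1) * ((i : k) - (s + 1)) = ((s + 1 : ℕ) : k) * ((i - (s + 1) : ℕ) : k) := by
        rw [Nat.cast_sub hs.le]; push_cast; ring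
      obtain ⟨h2, h3⟩ := hunit (s + 1) (by omega) hs
      obtain ⟨h4, h5⟩ := hunit (i - (s + 1)) (by omega) (by omega)
      rw [e, inLattice_smul_iff (mul_ne_zero h2 h4), val_mul h2 h4, h3, h5] at h1
      simpa using h1
    · have h1 := inLattice_mulVec hx.2.2 h
      rwa [hD.2.2.1 s hs] at h1
  have all : ∀ s < i, (InLattice ρ x t (b 0) ↔ InLattice ρ x t (b s)) := by
    intro s
    induction s with
    | zero => simp
    | succ s ih => exact fun hs => (ih (by omega)).trans (step s hs)
  exact (all s hs).symm.trans (all s' hs')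

end Lattice

/-! ### Facets in affine subspaces of the apartment -/

section Facets

open Filter Topology

variable {k : Type*} [Field k] [ValuativeRel k] [TopologicalSpace k] [IsNonarchimedeanLocalField k]
variable {m d : ℕ}

/-- Labels for the families of parallel affine root hyperplanes. -/
abbrev RootIdx (m d : ℕ) : Type := (Fin m × Fin m) ⊕ (Fin m × Fin m) ⊕ (Fin m × Fin d)

/-- The linear part of the affine roots in a family. -/
def rootLin : RootIdx m d → Apt m →ₗ[ℝ] ℝ
  | Sum.inl (i, j) => LinearMap.proj (R := ℝ) (φ := fun _ : Fin m => ℝ) i - LinearMap.proj j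
  | Sum.inr (Sum.inl (i, j)) => LinearMap.proj (R := ℝ) (φ := fun _ : Fin m => ℝ) i + LinearMap.proj j
  | Sum.inr (Sum.inr (i, _)) => LinearMap.proj i

/-- The constant term, modulo `ℤ`, of the affine roots in a family. -/
def rootShift (ρ : Fin d → k) : RootIdx m d → ℝ
  | Sum.inl _ => 0
  | Sum.inr (Sum.inl _) => 0
  | Sum.inr (Sum.inr (_, l)) => (val (ρ l) : ℝ) / 2

theorem exists_rootLin {ρ : Fin d → k} {ψ : Apt m → ℝ} (hψ : ψ ∈ affineRoots m ρ) :
    ∃ (κ : RootIdx m d) (n : ℤ), ∀ y, ψ y = rootLin κ y + rootShift ρ κ + n := by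
  rcases hψ with ⟨i, j, n, -, rfl⟩ | ⟨i, j, n, -, rfl⟩ | ⟨i, l, n, rfl⟩
  · exact ⟨Sum.inl (i, j), n, fun y => by simp [rootLin, rootShift]⟩
  · exact ⟨Sum.inr (Sum.inl (i, j)), n, fun y => by simp [rootLin, rootShift]⟩
  · exact ⟨Sum.inr (Sum.inr (i, l)), n, fun y => by simp [rootLin, rootShift]⟩

/-- The facet through the point `x`. -/
def facetOf (ρ : Fin d → k) (x : Apt m) : Set (Apt m) :=
  {y | ∀ ψ ∈ affineRoots m ρ, SignType.sign (ψ y) = SignType.sign (ψ x)}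

theorem exists_pos_le_abs_add_int (r : ℝ) : ∃ ε > 0, ∀ n : ℤ, r + n ≠ 0 → ε ≤ |r + n| := by
  rcases (Int.fract_nonneg r).eq_or_lt with h | h
  · refine ⟨1, one_pos, fun n hn => ?_⟩
    have hr : r = ⌊r⌋ := by rw [← Int.floor_add_fract r, ← h]; simp
    rw [hr] at hn ⊢
    exact_mod_cast Int.one_le_abs (by exact_mod_cast hn)
  · refine ⟨min (Int.fract r) (1 - Int.fract r), lt_min h (by linarith [Int.fract_lt_one r]),
      fun n _ => ?_⟩
    have hr := Int.floor_add_fract r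
    rcases le_or_gt 0 (⌊r⌋ + n) with h0 | h0
    · have : (0 : ℝ) ≤ ⌊r⌋ + n := by exact_mod_cast h0
      rw [abs_of_nonneg (by linarith)]
      exact (min_le_left _ _).trans (by linarith)
    · have : (⌊r⌋ : ℝ) + n ≤ -1 := by exact_mod_cast (by omega : ⌊r⌋ + n ≤ -1)
      rw [abs_of_nonpos (by linarith [Int.fract_lt_one r])]
      exact (min_le_right _ _).trans (by linarith)

/-- The arrangement of the affine root hyperplanes is locally finite. -/
theorem eventually_sign_eq (ρ : Fin d → k) (x w : Apt m) :
    ∀ᶠ δ : ℝ in 𝓝[>] 0, ∀ ψ ∈ affineRoots m ρ, ψ x ≠ 0 →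
      SignType.sign (ψ (x + δ • w)) = SignType.sign (ψ x) := by
  have key : ∀ κ : RootIdx m d, ∀ᶠ δ : ℝ in 𝓝[>] 0, ∀ n : ℤ,
      rootLin κ x + rootShift ρ κ + n ≠ 0 →
      SignType.sign (rootLin κ x + rootShift ρ κ + n + δ * rootLin κ w) =
        SignType.sign (rootLin κ x + rootShift ρ κ + n) := by
    intro κ
    obtain ⟨ε, hε, h⟩ := exists_pos_le_abs_add_int (rootLin κ x + rootShift ρ κ)
    have hlim : Tendsto (fun δ : ℝ => |δ * rootLin κ w|) (𝓝[>] 0) (𝓝 0) := by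
      refine tendsto_nhdsWithin_of_tendsto_nhds ?_
      have : Continuous fun δ : ℝ => |δ * rootLin κ w| := by fun_prop
      simpa using this.tendsto 0
    filter_upwards [hlim.eventually_lt_const hε] with δ hδ n hn
    have h1 := hδ.trans_le (h n hn)
    rcases lt_or_gt_of_ne hn with h0 | h0
    · rw [abs_of_neg h0] at h1
      rw [sign_neg h0, sign_neg (by linarith [le_abs_self (δ * rootLin κ w)])]
    · rw [abs_of_pos h0] at h1
      rw [sign_pos h0, sign_pos (by linarith [neg_abs_le (δ * rootLin κ w)])]
  filter_upwards [eventually_all.2 key] with δ hδ ψ hψ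
  obtain ⟨κ, n, hκ⟩ := exists_rootLin hψ
  rw [hκ, hκ]
  intro h
  rw [← hδ κ n h]
  congr 1
  simp only [map_add, map_smul, smul_eq_mul]
  ring

/-- Let `Ω` be an affine subspace of the apartment that is a union of facets, and suppose that it has
a direction `w` that is not parallel to any root hyperplane unless all of `Ω` is. Pushing a point of
`Ω` a little along `w` leads to a facet that is open in `Ω`, so these facets are the maximal ones. -/
theorem maximalFacetsHaveDim_of_submodule (ρ : Fin d → k) (Ω : Set (Apt m)) (V : Submodule ℝ (Apt m))
    (x₀ : Apt m) (hΩ : ∀ x, x ∈ Ω ↔ x - x₀ ∈ V)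
    (hsat : ∀ x ∈ Ω, facetOf ρ x ⊆ Ω) (w : Apt m) (hw : w ∈ V)
    (hgen : ∀ κ : RootIdx m d, rootLin κ w = 0 → ∀ v ∈ V, rootLin κ v = 0) :
    MaximalFacetsHaveDim ρ Ω (Module.finrank ℝ V) := by
  have hadd : ∀ x ∈ Ω, ∀ v ∈ V, x + v ∈ Ω := by
    intro x hx v hv
    rw [hΩ] at hx ⊢
    rw [add_sub_right_comm]
    exact V.add_mem hx hv
  have hself : ∀ x : Apt m, x ∈ facetOf ρ x := fun x ψ _ => rfl
  have hspan : ∀ F ⊆ Ω, vectorSpan ℝ F ≤ V := by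
    intro F hF
    rw [vectorSpan_def, Submodule.span_le]
    rintro _ ⟨x, hx, y, hy, rfl⟩
    have := V.sub_mem ((hΩ x).1 (hF hx)) ((hΩ y).1 (hF hy))
    simpa using this
  have hle : ∀ F ⊆ Ω, facetDim F ≤ Module.finrank ℝ V := fun F hF =>
    Submodule.finrank_mono (hspan F hF)
  -- every point of `Ω` is in the closure of a facet that is open in `Ω`
  have hgeneric : ∀ x ∈ Ω, ∃ x' ∈ Ω,
      (∀ ψ ∈ affineRoots m ρ, ψ x ≠ 0 → SignType.sign (ψ x') = SignType.sign (ψ x)) ∧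
      ∀ ψ ∈ affineRoots m ρ, ψ x' = 0 → ∀ v ∈ V, ψ (x' + v) = 0 := by
    intro x hx
    obtain ⟨δ, h1, h2⟩ := ((eventually_sign_eq ρ x w).and self_mem_nhdsWithin).exists
    have h2 : (0 : ℝ) < δ := h2
    refine ⟨x + δ • w, hadd x hx _ (V.smul_mem _ hw), h1, fun ψ hψ h0 v hv => ?_⟩
    have hx0 : ψ x = 0 := by
      by_contra hne
      have := h1 ψ hψ hne
      rw [h0, sign_zero, eq_comm, sign_eq_zero_iff] at this
      exact hne this
    obtain ⟨κ, n, hκ⟩ := exists_rootLin hψ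
    have hd : rootLin κ w = 0 := by
      rw [hκ] at h0 hx0
      simp only [map_add, map_smul, smul_eq_mul] at h0
      have : δ * rootLin κ w = 0 := by linarith
      exact (mul_eq_zero.1 this).resolve_left h2.ne'
    rw [hκ] at h0 ⊢
    rw [map_add, hgen κ hd v hv]
    linarith
  have hdim : ∀ x' ∈ Ω, (∀ ψ ∈ affineRoots m ρ, ψ x' = 0 → ∀ v ∈ V, ψ (x' + v) = 0) →
      facetDim (facetOf ρ x') = Module.finrank ℝ V := by
    intro x' hx' h0
    refine le_antisymm (hle _ (hsat x' hx')) (Submodule.finrank_mono fun v hv => ?_)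
    obtain ⟨δ, h1, h2⟩ := ((eventually_sign_eq ρ x' v).and self_mem_nhdsWithin).exists
    have h2 : (0 : ℝ) < δ := h2
    have hmem : x' + δ • v ∈ facetOf ρ x' := by
      intro ψ hψ
      by_cases hψ0 : ψ x' = 0
      · rw [h0 ψ hψ hψ0 _ (V.smul_mem _ hv), hψ0]
      · exact h1 ψ hψ hψ0
    have := vsub_mem_vectorSpan ℝ hmem (hself x')
    rw [vsub_eq_sub, add_sub_cancel_left] at this
    exact ((vectorSpan ℝ (facetOf ρ x')).smul_mem_iff h2.ne').1 this
  have hclosure : ∀ x x' : Apt m,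
      (∀ ψ ∈ affineRoots m ρ, ψ x ≠ 0 → SignType.sign (ψ x') = SignType.sign (ψ x)) →
      facetOf ρ x ⊆ closure (facetOf ρ x') := by
    intro x x' h1 y hy
    have hlim : Tendsto (fun ε : ℝ => (1 - ε) • y + ε • x') (𝓝[>] 0) (𝓝 y) := by
      refine tendsto_nhdsWithin_of_tendsto_nhds ?_
      have : Continuous fun ε : ℝ => (1 - ε) • y + ε • x' := by fun_prop
      simpa using this.tendsto 0
    refine mem_closure_of_tendsto hlim ?_
    filter_upwards [self_mem_nhdsWithin,
      mem_nhdsWithin_of_mem_nhds (Iio_mem_nhds (zero_lt_one' ℝ))] with ε hε0 hε1 ψ hψ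
    have hε0 : (0 : ℝ) < ε := hε0
    have hε1 : ε < 1 := hε1
    have hcomb : ψ ((1 - ε) • y + ε • x') = (1 - ε) * ψ y + ε * ψ x' := by
      obtain ⟨κ, n, hκ⟩ := exists_rootLin hψ
      simp only [hκ, map_add, map_smul, smul_eq_mul]
      ring
    rw [hcomb]
    have hyx := hy ψ hψ
    have h3 : 0 < 1 - ε := by linarith
    by_cases hψ0 : ψ x = 0
    · rw [hψ0, sign_zero, sign_eq_zero_iff] at hyx
      rw [hyx, mul_zero, zero_add, sign_mul, sign_pos hε0, one_mul]
    · have h4 := h1 ψ hψ hψ0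
      rw [h4]
      rcases lt_or_gt_of_ne hψ0 with h | h
      · rw [sign_neg h, sign_eq_neg_one_iff] at hyx h4
        rw [sign_neg h, sign_eq_neg_one_iff]
        nlinarith
      · rw [sign_pos h, sign_eq_one_iff] at hyx h4
        rw [sign_pos h, sign_eq_one_iff]
        nlinarith
  refine ⟨?_, ?_, fun F _ hF => hle F hF⟩
  · obtain ⟨x', hx', -, h0⟩ := hgeneric x₀ ((hΩ _).2 (by simp))
    refine ⟨facetOf ρ x', ⟨x', rfl⟩, hsat x' hx', ?_⟩
    rintro _ ⟨y, rfl⟩ hsub hcl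
    change facetOf ρ y ⊆ Ω at hsub
    change facetOf ρ x' ⊆ closure (facetOf ρ y) at hcl
    change facetOf ρ y = facetOf ρ x'
    have hsign : ∀ ψ ∈ affineRoots m ρ, SignType.sign (ψ y) = SignType.sign (ψ x') := by
      intro ψ hψ
      by_cases hψ0 : ψ x' = 0
      · have := h0 ψ hψ hψ0 (y - x') (by
          have := V.sub_mem ((hΩ y).1 (hsub (hself y))) ((hΩ x').1 hx')
          simpa using this)
        rw [add_sub_cancel] at this
        rw [this, hψ0]
      · have hcont : Continuous ψ := by
          obtain ⟨κ, n, hκ⟩ := exists_rootLin hψ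
          rw [funext hκ]
          have := (rootLin κ).continuous_of_finiteDimensional
          fun_prop
        have hx'cl := hcl (hself x')
        rcases lt_or_gt_of_ne hψ0 with h | h
        · obtain ⟨z, hz, hz'⟩ := mem_closure_iff_nhds.1 hx'cl _
            (hcont.continuousAt.eventually (gt_mem_nhds h))
          rw [← hz' ψ hψ, sign_neg h, sign_neg hz]
        · obtain ⟨z, hz, hz'⟩ := mem_closure_iff_nhds.1 hx'cl _
            (hcont.continuousAt.eventually (lt_mem_nhds h))
          rw [← hz' ψ hψ, sign_pos h, sign_pos hz]
    ext z
    exact forall₂_congr fun ψ hψ => by rw [hsign ψ hψ]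
  · rintro _ ⟨⟨x, rfl⟩, hsub, hmax⟩
    change facetOf ρ x ⊆ Ω at hsub
    obtain ⟨x', hx', h1, h0⟩ := hgeneric x (hsub (hself x))
    have := hmax (facetOf ρ x') ⟨x', rfl⟩ (hsat x' hx') (hclosure x x' h1)
    rw [← this]
    exact hdim x' hx' h0

/-- The case of a set `Ω` in which the coordinates are grouped into blocks: those of a block are
either constant (`sg = 0`) or all equal, up to the signs `sg`, to one free parameter. -/
theorem maximalFacetsHaveDim_of_blocks {ι : Type*} [Finite ι] (ρ : Fin d → k) (Ω : Set (Apt m))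
    (blk : Fin m → ι) (ctr sg : Fin m → ℝ) (hsg : ∀ a, sg a = 0 ∨ sg a = 1 ∨ sg a = -1)
    (hΩ : ∀ x, x ∈ Ω ↔ ∃ t : ι → ℝ, ∀ a, x a = ctr a + sg a * t (blk a))
    (hsat : ∀ x ∈ Ω, facetOf ρ x ⊆ Ω) :
    MaximalFacetsHaveDim ρ Ω {j | ∃ a, blk a = j ∧ sg a ≠ 0}.ncard := by
  classical
  have := Fintype.ofFinite ι
  let Φ : (ι → ℝ) →ₗ[ℝ] Apt m := LinearMap.pi fun a => sg a • LinearMap.proj (blk a)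
  have hΦ : ∀ t a, Φ t a = sg a * t (blk a) := fun t a => by simp [Φ]
  let J : Set ι := {j | ∃ a, blk a = j ∧ sg a ≠ 0}
  have hrank : Module.finrank ℝ (LinearMap.range Φ) = J.ncard := by
    let E : (J → ℝ) →ₗ[ℝ] (ι → ℝ) := Function.ExtendByZero.linearMap ℝ ((↑) : J → ι)
    have hE : ∀ t (j : J), E t j = t j := fun t j => Subtype.val_injective.extend_apply _ _ _
    have hinj : Function.Injective (Φ.comp E) := by
      rw [← LinearMap.ker_eq_bot, LinearMap.ker_eq_bot']
      intro t ht
      ext ⟨j, a, rfl, ha⟩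
      have h1 := congrFun ht a
      rw [LinearMap.comp_apply, hΦ] at h1
      have h2 := hE t ⟨blk a, a, rfl, ha⟩
      simp only at h2
      rw [h2] at h1
      exact (mul_eq_zero.1 h1).resolve_left ha
    have hrange : LinearMap.range Φ = LinearMap.range (Φ.comp E) := by
      refine le_antisymm ?_ (LinearMap.range_comp_le_range _ _)
      rintro _ ⟨t, rfl⟩
      refine ⟨fun j => t j, ?_⟩
      ext a
      rw [LinearMap.comp_apply, hΦ, hΦ]
      by_cases ha : sg a = 0
      · rw [ha, zero_mul, zero_mul]
      · have h2 := hE (fun j => t j) ⟨blk a, a, rfl, ha⟩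
        simp only at h2
        rw [h2]
    rw [hrange, LinearMap.finrank_range_of_inj hinj, Module.finrank_fintype_fun_eq_card,
      ← Nat.card_coe_set_eq, Nat.card_eq_fintype_card]
  change MaximalFacetsHaveDim ρ Ω J.ncard
  rw [← hrank]
  -- positive parameters, different for different blocks
  let θ : ι → ℝ := fun j => (Fintype.equivFin ι j : ℕ) + 1
  have hθpos : ∀ j, 0 < θ j := fun j => by positivity
  have hθinj : ∀ i j, θ i = θ j → i = j := fun i j h => by
    simp only [θ, add_left_inj, Nat.cast_inj] at h
    exact (Fintype.equivFin ι).injective (Fin.ext h)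
  refine maximalFacetsHaveDim_of_submodule ρ Ω (LinearMap.range Φ) ctr ?_ hsat (Φ θ) ⟨θ, rfl⟩ ?_
  · intro x
    rw [hΩ]
    refine exists_congr fun t => ?_
    rw [eq_sub_iff_add_eq, funext_iff]
    refine forall_congr' fun a => ?_
    rw [Pi.add_apply, hΦ, eq_comm, add_comm]
  · rintro (⟨i, j⟩ | ⟨i, j⟩ | ⟨i, l⟩) h0 _ ⟨t, rfl⟩
    · simp only [rootLin, LinearMap.sub_apply, LinearMap.proj_apply, hΦ] at h0 ⊢
      have hi := hθpos (blk i)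
      have hj := hθpos (blk j)
      rcases hsg i with e | e | e <;> rcases hsg j with e' | e' | e' <;> rw [e, e'] at h0 ⊢ <;>
        first
        | (exfalso; linarith)
        | (rw [hθinj (blk i) (blk j) (by linarith)]; ring)
        | ring
    · simp only [rootLin, LinearMap.add_apply, LinearMap.proj_apply, hΦ] at h0 ⊢
      have hi := hθpos (blk i)
      have hj := hθpos (blk j)
      rcases hsg i with e | e | e <;> rcases hsg j with e' | e' | e' <;> rw [e, e'] at h0 ⊢ <;>
        first
        | (exfalso; linarith)
        | (rw [hθinj (blk i) (blk j) (by linarith)]; ring)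
        | ring
    · simp only [rootLin, LinearMap.proj_apply, hΦ] at h0 ⊢
      rw [(mul_eq_zero.1 h0).resolve_right (hθpos _).ne', zero_mul]

end Facets

/-! ### Coordinates of the points of a facet -/

section FacetRoots

variable {k : Type*} [Field k] [ValuativeRel k] [TopologicalSpace k] [IsNonarchimedeanLocalField k]
variable {m d : ℕ} {ρ : Fin d → k} {x y : Apt m}

theorem eq_zero_of_mem_facetOf (hy : y ∈ facetOf ρ x) {ψ : Apt m → ℝ} (hψ : ψ ∈ affineRoots m ρ)
    (h : ψ x = 0) : ψ y = 0 := by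
  have := hy ψ hψ
  rwa [h, sign_zero, sign_eq_zero_iff] at this

theorem sub_eq_of_mem_facetOf (hy : y ∈ facetOf ρ x) {i j : Fin m} (hij : i ≠ j) {N : ℤ}
    (h : x i - x j = N) : y i - y j = N := by
  have := eq_zero_of_mem_facetOf hy (ψ := fun x => x i - x j + (-N : ℤ))
    (Or.inl ⟨i, j, -N, hij, rfl⟩) (by push_cast; linarith)
  push_cast at this
  linarith

theorem add_eq_of_mem_facetOf (hy : y ∈ facetOf ρ x) {i j : Fin m} (hij : i ≠ j) {N : ℤ}
    (h : x i + x j = N) : y i + y j = N := by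
  have := eq_zero_of_mem_facetOf hy (ψ := fun x => x i + x j + (-N : ℤ))
    (Or.inr (Or.inl ⟨i, j, -N, hij, rfl⟩)) (by push_cast; linarith)
  push_cast at this
  linarith

theorem eq_of_mem_facetOf (hy : y ∈ facetOf ρ x) {i : Fin m} {l : Fin d}
    (h : x i = -(val (ρ l) : ℝ) / 2) : y i = -(val (ρ l) : ℝ) / 2 := by
  have := eq_zero_of_mem_facetOf hy (ψ := fun x => x i + (val (ρ l) : ℝ) / 2 + (0 : ℤ))
    (Or.inr (Or.inr ⟨i, l, 0, rfl⟩)) (by push_cast; linarith)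
  push_cast at this
  linarith

end FacetRoots

/-! ### Coordinates of the vectors of a realization -/

section Coordinates

variable {k : Type*} [Field k] {m d : ℕ}

@[simp] theorem vv_apply_v (i j : Fin m) :
    (vv i : WSpace k m d) (Sum.inl j) = if j = i then 1 else 0 := by
  simp [vv, Pi.single_apply]

@[simp] theorem vv_apply_w (i j : Fin m) : (vv i : WSpace k m d) (Sum.inr (Sum.inl j)) = 0 := by
  simp [vv]

@[simp] theorem vv_apply_z (i : Fin m) (l : Fin d) :
    (vv i : WSpace k m d) (Sum.inr (Sum.inr l)) = 0 := by
  simp [vv]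

@[simp] theorem ww_apply_v (i j : Fin m) : (ww i : WSpace k m d) (Sum.inl j) = 0 := by
  simp [ww]

@[simp] theorem ww_apply_w (i j : Fin m) :
    (ww i : WSpace k m d) (Sum.inr (Sum.inl j)) = if j = i then 1 else 0 := by
  simp [ww, Pi.single_apply]

@[simp] theorem ww_apply_z (i : Fin m) (l : Fin d) :
    (ww i : WSpace k m d) (Sum.inr (Sum.inr l)) = 0 := by
  simp [ww]

@[simp] theorem zz_apply_v (l : Fin d) (j : Fin m) : (zz l : WSpace k m d) (Sum.inl j) = 0 := by
  simp [zz]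

@[simp] theorem zz_apply_w (l : Fin d) (j : Fin m) :
    (zz l : WSpace k m d) (Sum.inr (Sum.inl j)) = 0 := by
  simp [zz]

@[simp] theorem zz_apply_z (l l' : Fin d) :
    (zz l : WSpace k m d) (Sum.inr (Sum.inr l')) = if l' = l then 1 else 0 := by
  simp [zz, Pi.single_apply]

theorem oddChain_of_lt {K : ℕ} (a : Fin K → Fin m) (τ ε : k) (c : WSpace k m d) {s : ℕ}
    (h : s < K) : oddChain a τ ε c s = τ • vv (a ⟨s, h⟩) := by
  rw [oddChain, dif_pos h]

theorem oddChain_of_gt {K : ℕ} (a : Fin K → Fin m) (τ ε : k) (c : WSpace k m d) {s : ℕ}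
    (h : K < s) (h' : s ≤ 2 * K) :
    oddChain a τ ε c s = (ε * (-1) ^ (s - K)) • ww (a ⟨2 * K - s, by omega⟩) := by
  rw [oddChain, dif_neg (by omega), dif_pos ⟨h, h'⟩]

theorem oddChain_self {K : ℕ} (a : Fin K → Fin m) (τ ε : k) (c : WSpace k m d) :
    oddChain a τ ε c K = c := by
  rw [oddChain, dif_neg (by omega), dif_neg (by omega)]

end Coordinates

/-! ### Blocks, and pairs of dual chains -/

section Blocks

variable {k : Type*} [Field k] [ValuativeRel k] [TopologicalSpace k] [IsNonarchimedeanLocalField k]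
variable {m d n : ℕ} {P : Nat.Partition n}

/-- What a block of a realization contributes: its chains, supported in the hyperbolic pairs `S` and
the vectors `z` of `T`, form a chain system (with opposition `σ` and constants `η`), and its part of
`B(Y, H, X)` consists of the points whose coordinates in `S` are `ctr a + sg a * t`, for some value
of the parameter `t`; it is a union of facets. The parameter is really there if and only if `free`
holds. -/
structure IsBlock (ρ : Fin d → k) (γ : Finset (PIdx P)) (S : Finset (Fin m)) (T : Finset (Fin d))
    (ch : PIdx P → ℕ → WSpace k m d) (σ : PIdx P → PIdx P) (η : PIdx P → k)
    (ctr sg : Fin m → ℝ) (free : Prop) : Prop where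
  mapsTo : ∀ x ∈ γ, σ x ∈ γ
  invol : ∀ x ∈ γ, σ (σ x) = x
  len_eq : ∀ x ∈ γ, len (σ x) = len x
  ne_zero : ∀ x ∈ γ, η x ≠ 0
  pair : ∀ x ∈ γ, ∀ s s', s + s' + 1 = len x → form ρ (ch x s) (ch (σ x) s') = η x * (-1) ^ s
  orth : ∀ x ∈ γ, ∀ y ∈ γ, ∀ s s', s < len x → s' < len y → ¬ (y = σ x ∧ s + s' + 1 = len x) →
    form ρ (ch x s) (ch y s') = 0
  supp_S : ∀ x ∈ γ, ∀ s < len x, ∀ a ∉ S, ch x s (Sum.inl a) = 0 ∧ ch x s (Sum.inr (Sum.inl a)) = 0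
  supp_T : ∀ x ∈ γ, ∀ s < len x, ∀ l ∉ T, ch x s (Sum.inr (Sum.inr l)) = 0
  sg_cases : ∀ a ∈ S, sg a = 0 ∨ sg a = 1 ∨ sg a = -1
  param : ∀ pt : Apt m, (∀ x ∈ γ, ∀ s < len x, ∀ s' < len x, ∀ t,
    InLattice ρ pt t (ch x s) ↔ InLattice ρ pt t (ch x s')) → ∃ t, ∀ a ∈ S, pt a = ctr a + sg a * t
  levels : ∀ (pt : Apt m) (t : ℝ), (∀ a ∈ S, pt a = ctr a + sg a * t) → ∃ o : PIdx P → ℝ,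
    (∀ x ∈ γ, ∀ s < len x, InLattice ρ pt (o x) (ch x s)) ∧
      ∀ x ∈ γ, (val (η x) : ℝ) ≤ o x + o (σ x)
  sat : ∀ (pt y : Apt m) (t : ℝ), y ∈ facetOf ρ pt → (∀ a ∈ S, pt a = ctr a + sg a * t) →
    ∃ t', ∀ a ∈ S, y a = ctr a + sg a * t'
  free_iff : (∃ a ∈ S, sg a ≠ 0) ↔ free

theorem val_neg_one_pow (s : ℕ) : val ((-1 : k) ^ s) = 0 := by
  rcases neg_one_pow_eq_or k s with e | e <;> rw [e] <;> simp

/-- Two chains in duality, formed of vectors spanning complementary isotropic subspaces. The set `ω`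
marks the hyperbolic pairs in which the roles of `v` and `w` are exchanged. -/
theorem isBlock_of_dual {ρ : Fin d → k} {ch : PIdx P → ℕ → WSpace k m d} {x y : PIdx P}
    {T : Finset (Fin d)}
    (hxy : x ≠ y) (hlen : len y = len x) (hpos : 0 < len x) (e : Fin (len x) ↪ Fin m)
    (ω : Fin (len x) → Prop) [DecidablePred ω] {κ : k} (hκ : κ = 1 ∨ κ = -1)
    (hx : ∀ s : Fin (len x), ch x s = if ω s then ww (e s) else vv (e s))
    (hy : ∀ s : Fin (len x), ch y s =
      (κ * (-1) ^ (s : ℕ)) • if ω s.rev then vv (e s.rev) else ww (e s.rev)) :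
    ∃ (σ : PIdx P → PIdx P) (η : PIdx P → k) (ctr sg : Fin m → ℝ),
      IsBlock ρ {x, y} (Finset.univ.map e) T ch σ η ctr sg True := by
  classical
  have hκ0 : κ ≠ 0 := by rcases hκ with rfl | rfl <;> simp
  have hκv : ∀ s : ℕ, val (κ * (-1) ^ s) = 0 := by
    intro s
    rw [val_mul hκ0 (by simp), val_neg_one_pow]
    rcases hκ with rfl | rfl <;> simp
  have hκne : ∀ s : ℕ, κ * (-1) ^ s ≠ 0 := fun s => mul_ne_zero hκ0 (by simp)
  -- the sign of the coordinate of `pt` seen by the `s`-th vector of the chain of `x`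
  let sgn : Fin (len x) → ℝ := fun s => if ω s then -1 else 1
  have hsgn : ∀ s, sgn s = 1 ∨ sgn s = -1 := by
    intro s
    by_cases h : ω s <;> simp [sgn, h]
  have hsgn2 : ∀ s, sgn s * sgn s = 1 := by
    intro s
    rcases hsgn s with h | h <;> rw [h] <;> norm_num
  have hxl : ∀ (pt : Apt m) (s : Fin (len x)) (t : ℝ),
      InLattice ρ pt t (ch x s) ↔ t ≤ sgn s * pt (e s) := by
    intro pt s t
    rw [hx]
    by_cases h : ω s <;> simp [sgn, h, inLattice_vv, inLattice_ww]
  have hyl : ∀ (pt : Apt m) (s : Fin (len x)) (t : ℝ),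
      InLattice ρ pt t (ch y s) ↔ t ≤ -(sgn s.rev * pt (e s.rev)) := by
    intro pt s t
    rw [hy, inLattice_smul_iff (hκne _), hκv]
    by_cases h : ω s.rev <;> simp [sgn, h, inLattice_vv, inLattice_ww]
  have hxx : ∀ s t : Fin (len x), form ρ (ch x s) (ch x t) = 0 := by
    intro s t
    rw [hx, hx]
    by_cases h : ω s <;> by_cases h' : ω t <;> simp only [h, h', if_true, if_false, form_vv, form_ww,
      vv_apply_v, vv_apply_w, ww_apply_v, ww_apply_w]
    · rw [if_neg]; rintro h0; obtain rfl := e.injective h0; exact h' h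
    · rw [if_neg]; rintro h0; obtain rfl := e.injective h0; exact h h'
  have hyy : ∀ s t : Fin (len x), form ρ (ch y s) (ch y t) = 0 := by
    intro s t
    rw [hy, hy, map_smul, map_smul, LinearMap.smul_apply]
    by_cases h : ω s.rev <;> by_cases h' : ω t.rev <;> simp only [h, h', if_true, if_false, form_vv,
      form_ww, vv_apply_v, vv_apply_w, ww_apply_v, ww_apply_w, smul_zero]
    · rw [if_neg]; · simp
      rintro h0; have h0 := e.injective h0; rw [h0] at h; exact h' h
    · rw [if_neg]; · simp
      rintro h0; have h0 := e.injective h0; rw [h0] at h; exact h h'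
  have hxy' : ∀ s t : Fin (len x), form ρ (ch x s) (ch y t) =
      if (s : ℕ) + t + 1 = len x then κ * (-1) ^ (t : ℕ) else 0 := by
    intro s t
    have hst : (t.rev = s) ↔ (s : ℕ) + t + 1 = len x := by
      rw [Fin.ext_iff, Fin.val_rev]; omega
    rw [hx, hy, map_smul, smul_eq_mul]
    by_cases h0 : t.rev = s
    · rw [if_pos (hst.1 h0), h0]
      by_cases h : ω s <;> simp [h]
    · rw [if_neg (mt hst.2 h0)]
      have h1 : e t.rev ≠ e s := fun h => h0 (e.injective h)
      by_cases h : ω s <;> by_cases h' : ω t.rev <;> simp [h, h', h1.symm]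
  have hσx : Equiv.swap x y x = y := Equiv.swap_apply_left x y
  have hσy : Equiv.swap x y y = x := Equiv.swap_apply_right x y
  have hpow : ∀ s t : ℕ, s + t + 1 = len x →
      (-1 : k) ^ t = (-1) ^ (len x - 1) * (-1) ^ s := by
    intro s t h
    rw [← h, Nat.add_sub_cancel, pow_add, mul_right_comm, ← pow_add, ← two_mul, pow_mul]
    simp
  let z : Fin (len x) := ⟨0, hpos⟩
  let sg : Fin m → ℝ := fun a => if ∃ s, e s = a ∧ ω s then -1 else 1
  have hsg : ∀ s, sg (e s) = sgn s := by
    intro s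
    simp [sg, sgn]
  have hS : ∀ (p : Fin m → Prop), (∀ a ∈ Finset.univ.map e, p a) ↔ ∀ s, p (e s) := by
    intro p; simp
  refine ⟨Equiv.swap x y, fun u => if u = x then κ * (-1) ^ (len x - 1) else κ, fun _ => 0, sg, ?_⟩
  refine ⟨?_, ?_, ?_, ?_, ?_, ?_, ?_, ?_, ?_, ?_, ?_, ?_, ?_⟩
  · simp
  · simp
  · simp [hlen]
  · simp [hxy.symm, hκ0]
  · simp only [Finset.mem_insert, Finset.mem_singleton, forall_eq_or_imp, forall_eq, hσx, hσy,
      if_true, hxy.symm, if_false]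
    constructor
    · intro s t h
      rw [hxy' ⟨s, by omega⟩ ⟨t, by omega⟩, if_pos h]
      simp only
      rw [hpow s t h, mul_assoc]
    · intro s t h
      rw [hlen] at h
      rw [form_comm, hxy' ⟨t, by omega⟩ ⟨s, by omega⟩, if_pos (by simp only; omega)]
  · simp only [Finset.mem_insert, Finset.mem_singleton, forall_eq_or_imp, forall_eq, hσx, hσy,
      hxy, hxy.symm, false_and, not_false_eq_true, true_and, forall_true_left, hlen]
    refine ⟨⟨?_, ?_⟩, ?_, ?_⟩
    · intro s t hs ht
      exact hxx ⟨s, hs⟩ ⟨t, ht⟩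
    · intro s t hs ht h
      rw [hxy' ⟨s, hs⟩ ⟨t, ht⟩, if_neg h]
    · intro s t hs ht h
      rw [form_comm, hxy' ⟨t, ht⟩ ⟨s, hs⟩, if_neg (by simp only; omega)]
    · intro s t hs ht
      exact hyy ⟨s, hs⟩ ⟨t, ht⟩
  · simp only [Finset.mem_insert, Finset.mem_singleton, forall_eq_or_imp, forall_eq, hlen]
    constructor
    · intro s hs a ha
      have : ∀ s, a ≠ e s := fun s h => ha (by simp [h])
      rw [hx ⟨s, hs⟩]
      split_ifs <;> simp [this]
    · intro s hs a ha
      have : ∀ s, a ≠ e s := fun s h => ha (by simp [h])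
      rw [hy ⟨s, hs⟩]
      split_ifs <;> simp [this]
  · simp only [Finset.mem_insert, Finset.mem_singleton, forall_eq_or_imp, forall_eq, hlen]
    constructor
    · intro s hs l _
      rw [hx ⟨s, hs⟩]
      split_ifs <;> simp
    · intro s hs l _
      rw [hy ⟨s, hs⟩]
      split_ifs <;> simp
  · rw [hS]
    intro s
    rw [hsg]
    exact Or.inr (hsgn s)
  · intro pt h
    refine ⟨sgn z * pt (e z), ?_⟩
    rw [hS]
    intro s
    have h1 := h x (by simp) z z.2 s s.2
    simp only [hxl] at h1
    have h2 : sgn z * pt (e z) = sgn s * pt (e s) :=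
      le_antisymm ((h1 _).1 le_rfl) ((h1 _).2 le_rfl)
    rw [h2, hsg, ← mul_assoc, hsgn2]
    ring
  · intro pt t h
    rw [hS] at h
    have h1 : ∀ s, sgn s * pt (e s) = t := by
      intro s
      rw [h, hsg, zero_add, ← mul_assoc, hsgn2, one_mul]
    refine ⟨fun u => if u = x then t else -t, ?_, ?_⟩
    · simp only [Finset.mem_insert, Finset.mem_singleton, forall_eq_or_imp, forall_eq, hlen,
        if_true, hxy.symm, if_false]
      constructor
      · intro s hs
        exact (hxl pt ⟨s, hs⟩ t).2 (h1 _).ge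
      · intro s hs
        exact (hyl pt ⟨s, hs⟩ (-t)).2 (by rw [h1])
    · simp only [Finset.mem_insert, Finset.mem_singleton, forall_eq_or_imp, forall_eq, hσx, hσy,
        if_true, hxy.symm, if_false, hκv]
      have := hκv 0
      rw [pow_zero, mul_one] at this
      rw [this]
      simp
  · intro pt y' t hy' h
    rw [hS] at h
    refine ⟨sgn z * y' (e z), ?_⟩
    rw [hS]
    intro s
    rw [hsg, zero_add]
    rcases eq_or_ne s z with rfl | hne
    · rw [← mul_assoc, hsgn2, one_mul]
    have hne' : e s ≠ e z := fun h => hne (e.injective h)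
    have h1 := h s
    have h2 := h z
    rw [hsg] at h1 h2
    have add := fun h0 => add_eq_of_mem_facetOf hy' hne' (N := 0) h0
    have sub := fun h0 => sub_eq_of_mem_facetOf hy' hne' (N := 0) h0
    push_cast at add sub
    rcases hsgn s with e1 | e1 <;> rcases hsgn z with e2 | e2 <;> rw [e1] at h1 ⊢ <;>
      rw [e2] at h2 ⊢
    · linarith [sub (by linarith)]
    · linarith [add (by linarith)]
    · linarith [add (by linarith)]
    · linarith [sub (by linarith)]
  · simp only [iff_true]
    refine ⟨e z, by simp, ?_⟩
    rw [hsg]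
    rcases hsgn z with h | h <;> rw [h] <;> norm_num

theorem SplitBlock.exists_isBlock {ρ : Fin d → k} {ch : PIdx P → ℕ → WSpace k m d} {x y : PIdx P}
    {S : Finset (Fin m)} {T : Finset (Fin d)} (hxy : x ≠ y) (hlen : len y = len x)
    (hpos : 0 < len x) (h : SplitBlock x y S T ch) :
    ∃ (σ : PIdx P → PIdx P) (η : PIdx P → k) (ctr sg : Fin m → ℝ),
      IsBlock ρ {x, y} S T ch σ η ctr sg True := by
  obtain ⟨e, rfl, rfl, h⟩ := h
  refine isBlock_of_dual hxy hlen hpos e (fun _ => False) (κ := -1) (Or.inr rfl) (fun s => ?_)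
    (fun s => ?_)
  · simp [(h s).1]
  · simp [(h s).2, pow_succ]

theorem TwistedSplitBlock.exists_isBlock {ρ : Fin d → k} {ch : PIdx P → ℕ → WSpace k m d}
    {x y : PIdx P} {S : Finset (Fin m)} {T : Finset (Fin d)} (hxy : x ≠ y) (hlen : len y = len x)
    (hpos : 0 < len x) (h : TwistedSplitBlock x y S T ch) :
    ∃ (σ : PIdx P → PIdx P) (η : PIdx P → k) (ctr sg : Fin m → ℝ),
      IsBlock ρ {x, y} S T ch σ η ctr sg True := by
  obtain ⟨e, rfl, rfl, h⟩ := h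
  refine isBlock_of_dual hxy hlen hpos e (fun s => (s : ℕ) + 1 = len x) (κ := 1) (Or.inl rfl)
    (fun s => (h s).1) (fun s => ?_)
  have hs := s.2
  rw [(h s).2, one_mul]
  by_cases h0 : (s : ℕ) = 0
  · rw [if_pos h0, if_pos (by rw [Fin.val_rev]; omega), h0, pow_zero, one_smul]
  · rw [if_neg h0, if_neg (by rw [Fin.val_rev]; omega)]

end Blocks

/-! ### Blocks of self-dual chains -/

section OddBlocks

variable {k : Type*} [Field k] [ValuativeRel k] [TopologicalSpace k] [IsNonarchimedeanLocalField k]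
variable {m d n : ℕ} {P : Nat.Partition n}

/-- A block consisting of self-dual chains of odd length. Their middle vectors `c t` form an
orthogonal basis of the zero weight space, which involves the hyperbolic pairs `e (inr j)`. In
`B(Y, H, X)` the coordinates belonging to the block are pinned down to half-integers. By `hsat` this
is visible on affine root hyperplanes: either because of a vector `z_ℓ`, or because all of these
half-integers agree and there are at least two coordinates. -/
theorem isBlock_of_oddChains {ρ : Fin d → k} {ch : PIdx P → ℕ → WSpace k m d}
    {ι C : Type} [Fintype ι] [DecidableEq ι] [Fintype C] {x : ι → PIdx P}
    {γ : Finset (PIdx P)} {T : Finset (Fin d)} (hinj : Function.Injective x)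
    (hγ : ∀ z, z ∈ γ ↔ ∃ t, x t = z) (hodd : ∀ t, Odd (len (x t)))
    (e : ((Σ t, Fin (len (x t) / 2)) ⊕ C) ↪ Fin m) (τ ε : ι → k) (c : ι → WSpace k m d)
    (hch : OddChains x e τ ε c ch) (hτ : ∀ t, τ t ≠ 0) (hε : ∀ t, ε t = 1 ∨ ε t = -1)
    (hc : ∀ t t', form ρ (c t) (c t') = if t = t' then τ t * ε t else 0)
    (hcS : ∀ t a, (∀ j, e (Sum.inr j) ≠ a) → c t (Sum.inl a) = 0 ∧ c t (Sum.inr (Sum.inl a)) = 0)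
    (hcT : ∀ t, ∀ l ∉ T, c t (Sum.inr (Sum.inr l)) = 0) (N : C → ℤ)
    (hparam : ∀ pt : Apt m,
      (∀ t, 0 < len (x t) / 2 → InLattice ρ pt ((val (τ t) : ℝ) / 2) (c t)) →
        ∀ j, pt (e (Sum.inr j)) = -(N j : ℝ) / 2)
    (hlevel : ∀ pt : Apt m, (∀ j, pt (e (Sum.inr j)) = -(N j : ℝ) / 2) →
      ∀ t, InLattice ρ pt ((val (τ t) : ℝ) / 2) (c t))
    (hsat : ((∀ t, ∃ l, val (τ t) = val (ρ l)) ∧ ∀ j, ∃ l, N j = val (ρ l)) ∨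
      ∃ M : ℤ, (∀ t, val (τ t) = M) ∧ (∀ j, N j = M) ∧ Nonempty C ∧ ∃ t, 0 < len (x t) / 2) :
    ∃ (σ : PIdx P → PIdx P) (η : PIdx P → k) (ctr sg : Fin m → ℝ),
      IsBlock ρ γ (Finset.univ.map e) T ch σ η ctr sg False := by
  classical
  have hε0 : ∀ t, ε t ≠ 0 := fun t => by rcases hε t with h | h <;> rw [h] <;> simp
  have hεv : ∀ t, val (ε t) = 0 := fun t => by rcases hε t with h | h <;> rw [h] <;> simp
  let K : ι → ℕ := fun t => len (x t) / 2
  have hlen : ∀ t, len (x t) = 2 * K t + 1 := fun t => by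
    obtain ⟨j, hj⟩ := hodd t
    simp only [K]
    omega
  let a : ∀ t, Fin (K t) → Fin m := fun t j => e (Sum.inl ⟨t, j⟩)
  have ha : ∀ t t' j j', a t j = a t' j' ↔ t = t' ∧ (j : ℕ) = j' := by
    intro t t' j j'
    constructor
    · intro h
      have h1 := Sum.inl.inj (e.injective h)
      obtain rfl : t = t' := congrArg Sigma.fst h1
      exact ⟨rfl, by simpa [Fin.ext_iff] using h1⟩
    · rintro ⟨rfl, h⟩
      rw [Fin.ext h]
  have hac : ∀ t j j', e (Sum.inr j') ≠ a t j := fun t j j' h => by simpa using e.injective h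
  have hca : ∀ t t' j, c t (Sum.inl (a t' j)) = 0 ∧ c t (Sum.inr (Sum.inl (a t' j))) = 0 :=
    fun t t' j => hcS t _ fun j' => hac t' j j'
  have hch1 : ∀ t s (h : s < K t), ch (x t) s = τ t • vv (a t ⟨s, h⟩) := fun t s h => by
    rw [hch t s (by have := hlen t; omega), oddChain_of_lt _ _ _ _ h]
  have hch2 : ∀ t s (h : K t < s) (h' : s ≤ 2 * K t), ch (x t) s =
      (ε t * (-1) ^ (s - K t)) • ww (a t ⟨2 * K t - s, by omega⟩) := fun t s h h' => by
    rw [hch t s (by have := hlen t; omega), oddChain_of_gt _ _ _ _ h h']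
  have hch3 : ∀ t, ch (x t) (K t) = c t := fun t => by
    rw [hch t _ (by have := hlen t; omega), oddChain_self]
  have hpow : ∀ a b : ℕ, a ≤ b → (-1 : k) ^ (b - a) = (-1) ^ b * (-1) ^ a := by
    intro a b h
    obtain ⟨j, rfl⟩ := Nat.exists_eq_add_of_le h
    rw [Nat.add_sub_cancel_left, pow_add, mul_right_comm, ← pow_add, ← two_mul, pow_mul]
    simp
  have hlt : ∀ t s, s < len (x t) → s < K t ∨ s = K t ∨ (K t < s ∧ s ≤ 2 * K t) := by
    intro t s hs
    have := hlen t
    omega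
  have hform : ∀ t t' s s', s < len (x t) → s' < len (x t') →
      form ρ (ch (x t) s) (ch (x t') s') =
        if t = t' ∧ s + s' = 2 * K t then τ t * ε t * (-1) ^ K t * (-1) ^ s else 0 := by
    intro t t' s s' hs hs'
    rcases hlt t s hs with h | rfl | ⟨h, h1⟩ <;> rcases hlt t' s' hs' with h' | rfl | ⟨h', h1'⟩
    · rw [hch1 t s h, hch1 t' s' h', if_neg]
      · simp
      · rintro ⟨rfl, h2⟩; omega
    · rw [hch1 t s h, hch3, if_neg]
      · simp [(hca t' t _).2]
      · rintro ⟨rfl, h2⟩; omega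
    · rw [hch1 t s h, hch2 t' s' h' h1']
      simp only [map_smul, LinearMap.smul_apply, form_vv, ww_apply_w, ha, smul_eq_mul]
      by_cases h2 : t = t' ∧ s + s' = 2 * K t
      · obtain ⟨rfl, h3⟩ := h2
        obtain rfl : s' = 2 * K t - s := by omega
        rw [if_pos ⟨rfl, by omega⟩, if_pos ⟨rfl, by omega⟩, hpow _ _ (by omega), hpow _ _ (by omega),
          pow_mul]
        simp
        ring
      · rw [if_neg h2, if_neg]
        · simp
        · rintro ⟨rfl, h3⟩
          exact h2 ⟨rfl, by omega⟩
    · rw [hch3, hch1 t' s' h', form_comm, if_neg]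
      · simp [(hca t t' _).2]
      · rintro ⟨rfl, h2⟩; omega
    · rw [hch3, hch3, hc]
      by_cases h2 : t = t'
      · subst h2
        rw [if_pos rfl, if_pos ⟨rfl, by omega⟩, mul_assoc _ _ ((-1) ^ K t), ← pow_add, ← two_mul,
          pow_mul]
        simp
      · rw [if_neg h2, if_neg fun h => h2 h.1]
    · rw [hch3, hch2 t' s' h' h1', form_comm, if_neg]
      · simp [(hca t t' _).1]
      · rintro ⟨rfl, h2⟩; omega
    · rw [hch2 t s h h1, hch1 t' s' h']
      simp only [map_smul, LinearMap.smul_apply, form_ww, vv_apply_v, ha, smul_eq_mul]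
      by_cases h2 : t = t' ∧ s + s' = 2 * K t
      · obtain ⟨rfl, h3⟩ := h2
        rw [if_pos ⟨rfl, by omega⟩, if_pos ⟨rfl, by omega⟩, hpow _ _ (by omega)]
        ring
      · rw [if_neg h2, if_neg]
        · simp
        · rintro ⟨rfl, h3⟩
          exact h2 ⟨rfl, by omega⟩
    · rw [hch2 t s h h1, hch3, if_neg]
      · simp [(hca t' t _).1]
      · rintro ⟨rfl, h2⟩; omega
    · rw [hch2 t s h h1, hch2 t' s' h' h1', if_neg]
      · simp
      · rintro ⟨rfl, h2⟩; omega
  have hγ' : ∀ p : PIdx P → Prop, (∀ z ∈ γ, p z) ↔ ∀ t, p (x t) := by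
    intro p
    simp only [hγ, forall_exists_index, forall_apply_eq_imp_iff]
  have hS : ∀ p : Fin m → Prop, (∀ a ∈ Finset.univ.map e, p a) ↔
      (∀ t j, p (a t j)) ∧ ∀ j, p (e (Sum.inr j)) := by
    intro p
    simp only [Finset.mem_map, Finset.mem_univ, true_and, forall_exists_index,
      forall_apply_eq_imp_iff]
    exact ⟨fun h => ⟨fun t j => h (Sum.inl ⟨t, j⟩), fun j => h (Sum.inr j)⟩, fun h i => match i with
      | Sum.inl ⟨t, j⟩ => h.1 t j
      | Sum.inr j => h.2 j⟩
  let η : PIdx P → k := Function.extend x (fun t => τ t * ε t * (-1) ^ K t) 1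
  have hη : ∀ t, η (x t) = τ t * ε t * (-1) ^ K t := fun t => hinj.extend_apply _ _ t
  let ctr : Fin m → ℝ :=
    Function.extend e (Sum.elim (fun i => -(val (τ i.1) : ℝ) / 2) fun j => -(N j : ℝ) / 2) 0
  have hctr1 : ∀ t j, ctr (a t j) = -(val (τ t) : ℝ) / 2 := fun t j =>
    e.injective.extend_apply _ _ (Sum.inl ⟨t, j⟩)
  have hctr2 : ∀ j, ctr (e (Sum.inr j)) = -(N j : ℝ) / 2 := fun j =>
    e.injective.extend_apply _ _ (Sum.inr j)
  have hl1 : ∀ (pt : Apt m) (o : ℝ) t s (h : s < K t), InLattice ρ pt o (ch (x t) s) ↔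
      o ≤ val (τ t) + pt (a t ⟨s, h⟩) := by
    intro pt o t s h
    rw [hch1 t s h, inLattice_smul_iff (hτ t), inLattice_vv, sub_le_iff_le_add']
  have hl2 : ∀ (pt : Apt m) (o : ℝ) t s (h : K t < s) (h' : s ≤ 2 * K t),
      InLattice ρ pt o (ch (x t) s) ↔ o ≤ -pt (a t ⟨2 * K t - s, by omega⟩) := by
    intro pt o t s h h'
    rw [hch2 t s h h', inLattice_smul_iff (mul_ne_zero (hε0 t) (by simp)), inLattice_ww,
      val_mul (hε0 t) (by simp), hεv, val_neg_one_pow]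
    simp
  refine ⟨id, η, ctr, fun _ => 0, ?_⟩
  refine ⟨fun _ h => h, fun _ _ => rfl, fun _ _ => rfl, ?_, ?_, ?_, ?_, ?_, ?_, ?_, ?_, ?_, ?_⟩
  · rw [hγ']
    intro t
    rw [hη]
    exact mul_ne_zero (mul_ne_zero (hτ t) (hε0 t)) (by simp)
  · rw [hγ']
    intro t s s' h
    have := hlen t
    rw [id, hform t t s s' (by omega) (by omega), if_pos ⟨rfl, by omega⟩, hη]
  · rw [hγ']
    intro t
    rw [hγ']
    intro t' s s' hs hs' h
    rw [hform t t' s s' hs hs', if_neg]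
    rintro ⟨rfl, h1⟩
    exact h ⟨rfl, by have := hlen t; omega⟩
  · rw [hγ']
    intro t s hs b hb
    have h1 : ∀ t j, b ≠ a t j := fun t j h => hb (by simp [a, h])
    have h2 : ∀ j, e (Sum.inr j) ≠ b := fun j h => hb (by simp [← h])
    rcases hlt t s hs with h | rfl | ⟨h, h'⟩
    · rw [hch1 t s h]; simp [h1]
    · rw [hch3]; exact hcS t b h2
    · rw [hch2 t s h h']; simp [h1]
  · rw [hγ']
    intro t s hs l hl
    rcases hlt t s hs with h | rfl | ⟨h, h'⟩
    · rw [hch1 t s h]; simp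
    · rw [hch3]; exact hcT t l hl
    · rw [hch2 t s h h']; simp
  · exact fun _ _ => Or.inl rfl
  · intro pt h
    refine ⟨0, ?_⟩
    simp only [zero_mul, add_zero]
    rw [hγ'] at h
    have hpt : ∀ t (j : Fin (K t)), pt (a t j) = -(val (τ t) : ℝ) / 2 := by
      intro t j
      have hj := j.2
      have h1 := h t j (by have := hlen t; omega) (2 * K t - j) (by have := hlen t; omega)
      have e1 := fun o => hl1 pt o t j j.2
      have e2 := fun o => hl2 pt o t (2 * K t - j) (by omega) (by omega)
      have e3 : (⟨2 * K t - (2 * K t - j), by omega⟩ : Fin (K t)) = j := Fin.ext (by simp only; omega)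
      simp only [e1, e2, e3, Fin.eta] at h1
      have := le_antisymm ((h1 _).1 le_rfl) ((h1 _).2 le_rfl)
      linarith
    rw [hS]
    refine ⟨fun t j => by rw [hpt, hctr1], fun j => ?_⟩
    rw [hctr2]
    refine hparam pt (fun t ht => ?_) j
    have h1 := h t 0 (by have := hlen t; omega) (K t) (by have := hlen t; omega)
    rw [← hch3, ← h1, hl1 pt _ t 0 ht, hpt]
    linarith
  · intro pt _ h
    simp only [zero_mul, add_zero] at h
    rw [hS] at h
    obtain ⟨h1, h2⟩ := h
    let o : PIdx P → ℝ := Function.extend x (fun t => (val (τ t) : ℝ) / 2) 0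
    have ho : ∀ t, o (x t) = (val (τ t) : ℝ) / 2 := fun t => hinj.extend_apply _ _ t
    refine ⟨o, ?_, ?_⟩
    · rw [hγ']
      intro t s hs
      rw [ho]
      rcases hlt t s hs with h | rfl | ⟨h, h'⟩
      · rw [hl1 pt _ t s h, h1, hctr1]; linarith
      · rw [hch3]
        exact hlevel pt (fun j => by rw [h2, hctr2]) t
      · rw [hl2 pt _ t s h h', h1, hctr1]; linarith
    · rw [hγ']
      intro t
      rw [id, ho, hη, val_mul (mul_ne_zero (hτ t) (hε0 t)) (by simp), val_mul (hτ t) (hε0 t), hεv,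
        val_neg_one_pow]
      push_cast
      linarith
  · intro pt y t hy h
    refine ⟨0, ?_⟩
    simp only [zero_mul, add_zero] at h ⊢
    rcases hsat with ⟨h1, h2⟩ | ⟨M, h1, h2, ⟨j₀⟩, t₀, ht₀⟩
    · rw [hS] at h ⊢
      constructor
      · intro t j
        obtain ⟨l, hl⟩ := h1 t
        have := h.1 t j
        rw [hctr1, hl] at this ⊢
        exact eq_of_mem_facetOf hy this
      · intro j
        obtain ⟨l, hl⟩ := h2 j
        have := h.2 j
        rw [hctr2, hl] at this ⊢
        exact eq_of_mem_facetOf hy this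
    · have hM : ∀ b ∈ Finset.univ.map e, ctr b = -(M : ℝ) / 2 := by
        rw [hS]
        exact ⟨fun t j => by rw [hctr1, h1], fun j => by rw [hctr2, h2]⟩
      have hne : ∀ b : Fin m, ∃ b' ∈ Finset.univ.map e, b ≠ b' := by
        intro b
        by_cases hb : b = e (Sum.inr j₀)
        · exact ⟨a t₀ ⟨0, ht₀⟩, by simp [a], hb ▸ hac _ _ _⟩
        · exact ⟨_, by simp, hb⟩
      intro b hb
      obtain ⟨b', hb', hbb⟩ := hne b
      have e1 := h b hb
      have e2 := h b' hb'
      rw [hM b hb] at e1 ⊢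
      rw [hM b' hb'] at e2
      have e3 := add_eq_of_mem_facetOf hy hbb (N := -M) (by push_cast; linarith)
      have e4 := sub_eq_of_mem_facetOf hy hbb (N := 0) (by push_cast; linarith)
      push_cast at e3 e4
      linarith
  · simp

end OddBlocks

/-! ### Square classes -/

section SquareClasses

variable {k : Type*} [Field k] {d : ℕ}

theorem SameClass.symm {a b : k} (h : SameClass a b) : SameClass b a := by
  obtain ⟨t, ht, rfl⟩ := h
  exact ⟨t⁻¹, inv_ne_zero ht, by field_simp⟩

theorem SameClass.trans {a b c : k} (h : SameClass a b) (h' : SameClass b c) : SameClass a c := by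
  obtain ⟨t, ht, rfl⟩ := h
  obtain ⟨t', ht', rfl⟩ := h'
  exact ⟨t * t', mul_ne_zero ht ht', by ring⟩

theorem SameClass.neg {a b : k} (h : SameClass a b) : SameClass (-a) (-b) := by
  obtain ⟨t, ht, rfl⟩ := h
  exact ⟨t, ht, by ring⟩

theorem SameClass.ne_zero {a b : k} (h : SameClass a b) (ha : a ≠ 0) : b ≠ 0 := by
  obtain ⟨t, -, rfl⟩ := h
  exact right_ne_zero_of_mul ha

variable {ρ : Fin d → k}

theorem ne_zero_of_anisotropic (hρ : (QuadraticMap.weightedSumSquares k ρ).Anisotropic)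
    (l : Fin d) : ρ l ≠ 0 := by
  intro h
  have := hρ (Pi.single l 1) (by
    simp only [QuadraticMap.weightedSumSquares_apply]
    refine Finset.sum_eq_zero fun i _ => ?_
    rcases eq_or_ne i l with rfl | hne
    · simp [h]
    · simp [hne])
  simpa using congrFun this l

theorem not_sameClass_neg_of_anisotropic (hρ : (QuadraticMap.weightedSumSquares k ρ).Anisotropic)
    {l l' : Fin d} (hl : l ≠ l') : ¬ SameClass (ρ l) (-ρ l') := by
  rintro ⟨t, -, h⟩
  have := hρ (Pi.single l 1 + Pi.single l' t) (by
    simp only [QuadraticMap.weightedSumSquares_apply]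
    rw [Finset.sum_eq_add_of_mem l l' (Finset.mem_univ _) (Finset.mem_univ _) hl]
    · simp [hl, hl.symm, h]; ring
    · rintro i - ⟨h1, h2⟩
      simp [h1, h2])
  simpa [hl.symm] using congrFun this l

end SquareClasses

/-! ### Shapes of index sets -/

section Shapes

variable {k : Type*} [Field k] {d n : ℕ} {P : Nat.Partition n} {r : PIdx P → k}
  {γ : Finset (PIdx P)}

theorem len_pos (x : PIdx P) : 0 < len x :=
  P.parts_pos (Multiset.mem_of_mem_toEnumFinset x.2)

theorem EvenRel.ne {x y : PIdx P} (h : EvenRel x y) : x ≠ y := by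
  rintro rfl
  have := h.2.2
  omega

theorem IsEvenPart.even_len (h : IsEvenPart γ) : ∀ x ∈ γ, Even (len x) := by
  obtain ⟨x, y, h, rfl⟩ := h
  simp only [Finset.mem_insert, Finset.mem_singleton, forall_eq_or_imp, forall_eq, h.2.1]
  exact ⟨h.1, h.1⟩

theorem IsHypPart.odd_len (h : IsHypPart r γ) : ∀ x ∈ γ, Odd (len x) := by
  obtain ⟨x, y, h, rfl⟩ := h
  simp only [Finset.mem_insert, Finset.mem_singleton, forall_eq_or_imp, forall_eq, h.2.1]
  exact ⟨h.1, h.1⟩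

theorem not_isEvenPart {x : PIdx P} (hx : x ∈ γ) (h : Odd (len x)) : ¬ IsEvenPart γ := fun h' =>
  Nat.not_even_iff_odd.2 h (h'.even_len x hx)

/-- A set of index pairs with distinct odd parts is of neither of the first two shapes. -/
theorem not_even_or_hyp {ι : Type*} [Nonempty ι] {x : ι → PIdx P}
    (hinj : Function.Injective fun t => len (x t))
    (hodd : ∀ t, Odd (len (x t))) (hγ : ∀ z, z ∈ γ ↔ ∃ t, x t = z) :
    ¬ (IsEvenPart γ ∨ IsHypPart r γ) := by
  rintro (h | h)
  · inhabit ι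
    exact not_isEvenPart ((hγ _).2 ⟨default, rfl⟩) (hodd default) h
  · obtain ⟨y, z, ⟨-, h1, h2, -⟩, rfl⟩ := h
    obtain ⟨t, rfl⟩ := (hγ y).1 (by simp)
    obtain ⟨t', rfl⟩ := (hγ z).1 (by simp)
    exact h2 (by rw [hinj h1])

end Shapes

/-! ### The blocks of the various shapes -/

section Blocks

variable {k : Type*} [Field k] [ValuativeRel k] [TopologicalSpace k] [IsNonarchimedeanLocalField k]
variable {m d n : ℕ} {P : Nat.Partition n} {ρ : Fin d → k} {r : PIdx P → k}
  {γ : Finset (PIdx P)} {S : Finset (Fin m)} {T : Finset (Fin d)} {ch : PIdx P → ℕ → WSpace k m d}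

theorem IsBlock.congr_free {σ : PIdx P → PIdx P} {η : PIdx P → k} {ctr sg : Fin m → ℝ}
    {p p' : Prop} (h : IsBlock ρ γ S T ch σ η ctr sg p) (hp : p ↔ p') :
    IsBlock ρ γ S T ch σ η ctr sg p' := propext hp ▸ h

theorem exists_isBlock_congr {p p' : Prop} (hp : p ↔ p')
    (h : ∃ (σ : PIdx P → PIdx P) (η : PIdx P → k) (ctr sg : Fin m → ℝ),
      IsBlock ρ γ S T ch σ η ctr sg p) :
    ∃ (σ : PIdx P → PIdx P) (η : PIdx P → k) (ctr sg : Fin m → ℝ),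
      IsBlock ρ γ S T ch σ η ctr sg p' := by
  obtain ⟨σ, η, ctr, sg, h⟩ := h
  exact ⟨σ, η, ctr, sg, h.congr_free hp⟩

/-- If the vector `c` of level `val u / 2` has coordinates `u` and `1`, up to units, in a hyperbolic
pair, this determines the coordinate of the point of the apartment. -/
theorem eq_of_inLattice_middle {pt : Apt m} {u : k} {c : WSpace k m d} {a : Fin m}
    (h : InLattice ρ pt ((val u : ℝ) / 2) c) (hv : c (Sum.inl a) ≠ 0)
    (hv' : val (c (Sum.inl a)) = val u) (hw : c (Sum.inr (Sum.inl a)) ≠ 0)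
    (hw' : val (c (Sum.inr (Sum.inl a))) = 0) : pt a = -(val u : ℝ) / 2 := by
  have h1 := h _ hv
  have h2 := h _ hw
  simp only [hv', hw', wt] at h1 h2
  push_cast at h2
  linarith

theorem inLattice_smul_vv {pt : Apt m} {N : ℤ} {a : Fin m} (hpt : pt a = -(N : ℝ) / 2) {α : k}
    (hα : α ≠ 0 → N ≤ val α) : InLattice ρ pt ((N : ℝ) / 2) (α • vv a) :=
  (inLattice_vv.2 le_rfl).smul fun h0 => by
    have : (N : ℝ) ≤ val α := by exact_mod_cast hα h0
    linarith

theorem inLattice_smul_ww {pt : Apt m} {N : ℤ} {a : Fin m} (hpt : pt a = -(N : ℝ) / 2) {α : k}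
    (hα : α ≠ 0 → 0 ≤ val α) : InLattice ρ pt ((N : ℝ) / 2) (α • ww a) :=
  (inLattice_ww.2 le_rfl).smul fun h0 => by
    have : (0 : ℝ) ≤ val α := by exact_mod_cast hα h0
    linarith

theorem inLattice_smul_zz {pt : Apt m} {l : Fin d} {α : k}
    (hα : α ≠ 0 → 0 ≤ val α) : InLattice ρ pt ((val (ρ l) : ℝ) / 2) (α • zz l) :=
  (inLattice_zz.2 le_rfl).smul fun h0 => by
    have : (0 : ℝ) ≤ val α := by exact_mod_cast hα h0
    linarith

variable (h2 : (2 : k) ≠ 0 ∧ val (2 : k) = 0)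
include h2

theorem val_div_two {u : k} (hu : u ≠ 0) : val (u / 2) = val u := by
  rw [val_div hu h2.1, h2.2, sub_zero]

theorem le_val_mul_div_two {c u : k} (hc : c ≠ 0 → 0 ≤ val c) (h : c * u / 2 ≠ 0) :
    val u ≤ val (c * u / 2) := by
  have h0 : c * u ≠ 0 := fun h0 => h (by rw [h0, zero_div])
  have hc0 := left_ne_zero_of_mul h0
  rw [val_div_two h2 h0, val_mul hc0 (right_ne_zero_of_mul h0)]
  linarith [hc hc0]

theorem PairsBlock.exists_isBlock (hr : ∀ x, Odd (len x) → r x ≠ 0)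
    (h : PairsBlock r γ S T ch) :
    ∃ (σ : PIdx P → PIdx P) (η : PIdx P → k) (ctr sg : Fin m → ℝ),
      IsBlock ρ γ S T ch σ η ctr sg (IsEvenPart γ ∨ IsHypPart r γ) := by
  obtain ⟨x, hx, rfl, u, hu, e, rfl, rfl, hch⟩ := h
  obtain ⟨ho0, ho1, hlt, -⟩ := hx
  have hu0 := hu.ne_zero (hr _ ho0)
  have hodd : ∀ t, Odd (len (x t)) := by simp [Fin.forall_fin_two, ho0, ho1]
  have hlinj : Function.Injective fun t => len (x t) := by
    intro t t'
    fin_cases t <;> fin_cases t' <;> simp <;> omega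
  have hγ : ∀ z, z ∈ ({x 0, x 1} : Finset (PIdx P)) ↔ ∃ t, x t = z := by
    simp [Fin.exists_fin_two, eq_comm]
  have hne : u / 2 ≠ 0 := div_ne_zero hu0 h2.1
  refine exists_isBlock_congr (p := False)
    (by simpa using not_even_or_hyp (r := r) hlinj hodd hγ) ?_
  refine isBlock_of_oddChains (fun t t' h => hlinj (congrArg len h)) hγ hodd e _ _ _ hch
    ?_ ?_ ?_ ?_ ?_ (fun _ => val u) ?_ ?_ ?_
  · simp [Fin.forall_fin_two, hu0]
  · simp [Fin.forall_fin_two]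
  · have := h2.1
    simp only [Fin.forall_fin_two]
    simp [map_add, map_sub]
    constructor <;> field_simp <;> ring1
  · intro t a ha
    have := ha 0
    fin_cases t <;> simp [this.symm]
  · intro t l _
    fin_cases t <;> simp
  · intro pt h j
    obtain rfl : j = 0 := Subsingleton.elim _ _
    have h0 := h 0 (by obtain ⟨a, ha⟩ := ho1; omega)
    refine eq_of_inLattice_middle (u := u) h0 ?_ ?_ ?_ ?_ <;> simp [hu0, h2.1, val_div_two h2 hu0]
  · intro pt h t
    have hv := inLattice_smul_vv (ρ := ρ) (h 0) (α := u / 2) fun _ => (val_div_two h2 hu0).ge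
    have hw := inLattice_smul_ww (ρ := ρ) (h 0) (α := 1) (by simp)
    have hw' := inLattice_smul_ww (ρ := ρ) (h 0) (α := -1) (by simp)
    fin_cases t
    · simpa using hv.add hw
    · simpa [sub_eq_add_neg] using hv.add hw'
  · refine Or.inr ⟨val u, by simp [Fin.forall_fin_two], fun _ => rfl, ⟨0⟩, 0, ?_⟩
    obtain ⟨a, ha⟩ := ho1
    omega

theorem QuadBlock.exists_isBlock (hr : ∀ x, Odd (len x) → r x ≠ 0)
    (h : QuadBlock r γ S T ch) :
    ∃ (σ : PIdx P → PIdx P) (η : PIdx P → k) (ctr sg : Fin m → ℝ),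
      IsBlock ρ γ S T ch σ η ctr sg (IsEvenPart γ ∨ IsHypPart r γ) := by
  classical
  obtain ⟨x, hx, rfl, u, hu, c, s, hcs, e, rfl, rfl, hch⟩ := h
  obtain ⟨hsq, hodd, hanti, -⟩ := hx
  have hu0 := hu.ne_zero (hr _ (hodd _))
  have hlinj := hanti.injective
  have hγ : ∀ z, z ∈ (Finset.univ.image x : Finset (PIdx P)) ↔ ∃ t, x t = z := by simp
  have hne : u / 2 ≠ 0 := div_ne_zero hu0 h2.1
  have hc := val_nonneg_of_sq_add_sq h2 hsq hcs
  have hs := val_nonneg_of_sq_add_sq h2 hsq ((add_comm _ _).trans hcs)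
  have hab : e (Sum.inr 0) ≠ e (Sum.inr 1) := e.injective.ne (by simp)
  have hba := hab.symm
  have hpos : ∀ t : Fin 3, 0 < len (x t.castSucc) / 2 := by
    intro t
    have h1 : len (x t.succ) < len (x t.castSucc) := hanti (Fin.castSucc_lt_succ (i := t))
    obtain ⟨a, ha⟩ := hodd t.succ
    omega
  refine exists_isBlock_congr (p := False)
    (by simpa using not_even_or_hyp (r := r) hlinj hodd hγ) ?_
  refine isBlock_of_oddChains (fun t t' h => hlinj (congrArg len h)) hγ hodd e _ _ _ hch
    (fun _ => hu0) (fun _ => Or.inl rfl) ?_ ?_ ?_ (fun _ => val u) ?_ ?_ ?_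
  · have := h2.1
    intro t t'
    fin_cases t <;> fin_cases t' <;> simp [map_add, map_sub, hab, hba] <;> field_simp <;>
      first
      | ring1
      | linear_combination (-2 * u) * hcs
      | linear_combination (-u) * hcs
      | linear_combination (-2) * hcs
  · intro t a ha
    have h0 := (ha 0).symm
    have h1 := (ha 1).symm
    fin_cases t <;> simp [h0, h1]
  · intro t l _
    fin_cases t <;> simp
  · intro pt h
    rw [Fin.forall_fin_two]
    constructor
    · refine eq_of_inLattice_middle (u := u) (h 0 (hpos 0)) ?_ ?_ ?_ ?_ <;>
        simp [hu0, h2.1, val_div_two h2 hu0]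
    · refine eq_of_inLattice_middle (u := u) (h 1 (hpos 1)) ?_ ?_ ?_ ?_ <;>
        simp [hu0, h2.1, val_div_two h2 hu0]
  · intro pt h t
    have hv := fun j => inLattice_smul_vv (ρ := ρ) (h j) (α := u / 2)
      fun _ => (val_div_two h2 hu0).ge
    have hw := fun j => inLattice_smul_ww (ρ := ρ) (h j) (α := 1) (by simp)
    have hcv := fun j => inLattice_smul_vv (ρ := ρ) (h j) (α := c * u / 2)
      (le_val_mul_div_two h2 hc)
    have hsv := fun j => inLattice_smul_vv (ρ := ρ) (h j) (α := s * u / 2)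
      (le_val_mul_div_two h2 hs)
    have hsv' := fun j => inLattice_smul_vv (ρ := ρ) (h j) (α := -(s * u / 2))
      (by simpa only [ne_eq, neg_eq_zero, val_neg] using le_val_mul_div_two h2 hs)
    have hcw := fun j => inLattice_smul_ww (ρ := ρ) (h j) (α := -c) (by simpa using hc)
    have hsw := fun j => inLattice_smul_ww (ρ := ρ) (h j) (α := s) hs
    have hsw' := fun j => inLattice_smul_ww (ρ := ρ) (h j) (α := -s) (by simpa using hs)
    fin_cases t
    · simpa using (hv 0).add (hw 0)
    · simpa using (hv 1).add (hw 1)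
    · have := (((hcv 0).add (hsv 1)).add (hcw 0)).add (hsw' 1)
      rw [neg_smul, neg_smul, ← sub_eq_add_neg, ← sub_eq_add_neg] at this
      exact this
    · have := (((hsv' 0).add (hcv 1)).add (hsw 0)).add (hcw 1)
      rw [neg_smul c, ← sub_eq_add_neg] at this
      exact this
  · exact Or.inr ⟨val u, fun _ => rfl, fun _ => rfl, ⟨0⟩, 0, hpos 0⟩

theorem TripBlock.exists_isBlock (hρ : ∀ l, ρ l ≠ 0)
    (h : TripBlock r ρ γ S T ch) :
    ∃ (σ : PIdx P → PIdx P) (η : PIdx P → k) (ctr sg : Fin m → ℝ),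
      IsBlock ρ γ S T ch σ η ctr sg (IsEvenPart γ ∨ IsHypPart r γ) := by
  classical
  obtain ⟨x, l, hx, rfl, c, s, hcs, e, rfl, rfl, hch⟩ := h
  obtain ⟨hsq, hodd, hanti, -⟩ := hx
  have hu0 := hρ l
  have hlinj := hanti.injective
  have hγ : ∀ z, z ∈ (Finset.univ.image x : Finset (PIdx P)) ↔ ∃ t, x t = z := by simp
  have hc := val_nonneg_of_sq_add_sq h2 hsq hcs
  have hs := val_nonneg_of_sq_add_sq h2 hsq ((add_comm _ _).trans hcs)
  have hpos : 0 < len (x 1) / 2 := by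
    have h1 : len (x 2) < len (x 1) := hanti (by decide)
    obtain ⟨a, ha⟩ := hodd 2
    omega
  refine exists_isBlock_congr (p := False)
    (by simpa using not_even_or_hyp (r := r) hlinj hodd hγ) ?_
  refine isBlock_of_oddChains (fun t t' h => hlinj (congrArg len h)) hγ hodd e _ _ _ hch
    (fun _ => neg_ne_zero.2 hu0) (fun _ => Or.inl rfl) ?_ ?_ ?_ (fun _ => val (ρ l)) ?_ ?_ ?_
  · have := h2.1
    intro t t'
    fin_cases t <;> fin_cases t' <;> simp [map_add, map_sub] <;> field_simp <;>
      first
      | ring1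
      | linear_combination (2 * ρ l) * hcs
      | linear_combination (ρ l) * hcs
      | linear_combination 2 * hcs
  · intro t a ha
    have h0 := (ha 0).symm
    fin_cases t <;> simp [h0]
  · intro t l' hl'
    have h0 : l' ≠ l := by simpa using hl'
    fin_cases t <;> simp [h0]
  · intro pt h j
    obtain rfl : j = 0 := Subsingleton.elim _ _
    have h1 := h 1 hpos
    rw [val_neg] at h1
    refine eq_of_inLattice_middle (u := ρ l) h1 ?_ ?_ ?_ ?_ <;>
      simp [hu0, h2.1, val_div_two h2 hu0]
  · intro pt h t
    rw [val_neg]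
    have hv := inLattice_smul_vv (ρ := ρ) (h 0) (α := ρ l / 2) fun _ => (val_div_two h2 hu0).ge
    have hw := inLattice_smul_ww (ρ := ρ) (h 0) (α := -1) (by simp)
    have hcv := inLattice_smul_vv (ρ := ρ) (h 0) (α := c * ρ l / 2) (le_val_mul_div_two h2 hc)
    have hsv := inLattice_smul_vv (ρ := ρ) (h 0) (α := -(s * ρ l / 2))
      (by simpa only [ne_eq, neg_eq_zero, val_neg] using le_val_mul_div_two h2 hs)
    have hcw := inLattice_smul_ww (ρ := ρ) (h 0) (α := c) hc
    have hsw := inLattice_smul_ww (ρ := ρ) (h 0) (α := -s) (by simpa using hs)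
    have hcz := inLattice_smul_zz (ρ := ρ) (pt := pt) (l := l) hc
    have hsz := inLattice_smul_zz (ρ := ρ) (pt := pt) (l := l) hs
    fin_cases t
    · exact (hcv.add hcw).add hsz
    · simpa [sub_eq_add_neg] using hv.add hw
    · have := (hsv.add hsw).add hcz
      rw [neg_smul s, ← sub_eq_add_neg] at this
      exact this
  · exact Or.inl ⟨fun _ => ⟨l, val_neg _⟩, fun _ => ⟨l, rfl⟩⟩

theorem SignBlock.exists_isBlock (hρ : ∀ l, ρ l ≠ 0)
    (hρ_rep : ∀ l l', SameClass (ρ l) (ρ l') → ρ l = ρ l')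
    (h : SignBlock r ρ γ S T ch) :
    ∃ (σ : PIdx P → PIdx P) (η : PIdx P → k) (ctr sg : Fin m → ℝ),
      IsBlock ρ γ S T ch σ η ctr sg (IsEvenPart γ ∨ IsHypPart r γ) := by
  classical
  obtain ⟨x, l, l', hx, rfl, c, s, hcs, e, rfl, rfl, hch⟩ := h
  obtain ⟨hsq, hodd, hanti, hlt, hcl⟩ := hx
  have hll : l ≠ l' := hlt.ne
  have hll' := hll.symm
  have hrep : ρ l' = ρ l := by
    have := ((hcl 0).2.symm.trans (hcl 0).1).neg
    rw [neg_neg, neg_neg] at this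
    exact hρ_rep _ _ this
  have hlinj := hanti.injective
  have hγ : ∀ z, z ∈ (Finset.univ.image x : Finset (PIdx P)) ↔ ∃ t, x t = z := by simp
  have hc := val_nonneg_of_sq_add_sq h2 hsq hcs
  have hs := val_nonneg_of_sq_add_sq h2 hsq ((add_comm _ _).trans hcs)
  refine exists_isBlock_congr (p := False)
    (by simpa using not_even_or_hyp (r := r) hlinj hodd hγ) ?_
  refine isBlock_of_oddChains (fun t t' h => hlinj (congrArg len h)) hγ hodd e _ _ _ hch
    (fun _ => neg_ne_zero.2 (hρ l)) (fun _ => Or.inl rfl) ?_ ?_ ?_ (fun _ => 0) ?_ ?_ ?_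
  · intro t t'
    fin_cases t <;> fin_cases t' <;> simp [map_add, map_sub, hll, hll', hrep] <;>
      first
      | ring1
      | linear_combination (ρ l) * hcs
  · intro t a _
    fin_cases t <;> simp
  · intro t l₀ hl₀
    simp only [Finset.mem_insert, Finset.mem_singleton, not_or] at hl₀
    fin_cases t <;> simp [hl₀.1, hl₀.2]
  · exact fun _ _ j => j.elim0
  · intro pt _ t
    rw [val_neg]
    have hcz := inLattice_smul_zz (ρ := ρ) (pt := pt) (l := l) hc
    have hsz := inLattice_smul_zz (ρ := ρ) (pt := pt) (l := l) hs
    have hcz' := inLattice_smul_zz (ρ := ρ) (pt := pt) (l := l') hc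
    have hsz' := inLattice_smul_zz (ρ := ρ) (pt := pt) (l := l') (α := -s) (by simpa using hs)
    rw [hrep] at hcz' hsz'
    fin_cases t
    · simpa [sub_eq_add_neg] using hcz.add hsz'
    · exact hsz.add hcz'
  · exact Or.inl ⟨fun _ => ⟨l, val_neg _⟩, fun j => j.elim0⟩

omit h2 in
theorem AniBlock.exists_isBlock (hρ : (QuadraticMap.weightedSumSquares k ρ).Anisotropic)
    (hne : γ.Nonempty) (h : AniBlock r ρ γ S T ch) :
    ∃ (σ : PIdx P → PIdx P) (η : PIdx P → k) (ctr sg : Fin m → ℝ),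
      IsBlock ρ γ S T ch σ η ctr sg (IsEvenPart γ ∨ IsHypPart r γ) := by
  classical
  obtain ⟨f, hf, rfl, e, rfl, hch⟩ := h
  have hρ0 := ne_zero_of_anisotropic hρ
  have hshape : ¬ (IsEvenPart γ ∨ IsHypPart r γ) := by
    rintro (h | h)
    · obtain ⟨x, hx⟩ := hne
      exact not_isEvenPart hx (hf ⟨x, hx⟩).1 h
    · obtain ⟨x, y, ⟨-, -, hxy, hcl⟩, rfl⟩ := h
      have hx := hf ⟨x, by simp⟩
      have hy := hf ⟨y, by simp⟩
      refine not_sameClass_neg_of_anisotropic hρ (l := f ⟨x, by simp⟩) (l' := f ⟨y, by simp⟩) ?_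
        (hx.2.symm.trans (hcl.trans hy.2.neg))
      exact f.injective.ne fun h => hxy (congrArg Subtype.val h)
  refine exists_isBlock_congr (p := False) (by simpa using hshape) ?_
  refine isBlock_of_oddChains Subtype.val_injective (by simp) (fun t => (hf t).1) e _ _ _ hch
    (fun t => hρ0 _) (fun _ => Or.inl rfl) ?_ ?_ ?_ (fun _ => 0) ?_ ?_ ?_
  · intro t t'
    simp only [form_zz, zz_apply_z, EmbeddingLike.apply_eq_iff_eq]
    split_ifs <;> simp
  · intro t a _
    simp
  · intro t l hl
    have : l ≠ f t := fun h => hl (by simp [h])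
    simp [this]
  · exact fun _ _ j => j.elim0
  · exact fun pt _ t => inLattice_zz.2 le_rfl
  · exact Or.inl ⟨fun t => ⟨f t, rfl⟩, fun j => j.elim0⟩

end Blocks

/-! ### Partitions -/

section Partition

variable {n : ℕ} {P : Nat.Partition n}

theorem sum_len (P : Nat.Partition n) : ∑ x : PIdx P, len x = n := by
  have h : ∑ x ∈ P.parts.toEnumFinset, x.1 = n := by
    rw [Finset.sum_eq_multiset_sum, Multiset.map_toEnumFinset_fst, P.parts_sum]
  exact (Finset.sum_coe_sort P.parts.toEnumFinset fun x => x.1).trans h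

theorem card_pIdx (P : Nat.Partition n) : Fintype.card (PIdx P) = P.parts.card := by
  rw [Fintype.card_coe, Multiset.card_toEnumFinset]

theorem len_le (x : PIdx P) : len x ≤ n :=
  (Finset.single_le_sum (f := fun x => len x) (fun _ _ => Nat.zero_le _)
    (Finset.mem_univ x)).trans (sum_len P).le

/-- All parts are at most `h + 1`, since a part equal to `n` cannot be even. -/
theorem len_le_coxeterNumber (hP : ∀ i, Even i → Even (P.parts.count i)) (x : PIdx P) :
    len x ≤ coxeterNumber n + 1 := by
  have h1 := len_le x
  have hpos := len_pos x
  rw [coxeterNumber]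
  split_ifs with hn
  · omega
  · by_contra! hlt
    -- the part is `n`, it is even, so it occurs twice
    have hx : len x = n := by
      rw [Nat.not_odd_iff_even] at hn
      obtain ⟨a, ha⟩ := hn
      omega
    have hmem : len x ∈ P.parts := Multiset.mem_of_mem_toEnumFinset x.2
    have h2 := hP (len x) (by rw [hx]; exact Nat.not_odd_iff_even.1 hn)
    have h3 : 2 ≤ P.parts.count (len x) := by
      have := Multiset.count_pos.2 hmem
      obtain ⟨a, ha⟩ := h2
      omega
    have h4 : Multiset.replicate 2 (len x) ≤ P.parts := Multiset.le_count_iff_replicate_le.1 h3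
    obtain ⟨Q, hQ⟩ := Multiset.le_iff_exists_add.1 h4
    have h5 := P.parts_sum
    rw [hQ, Multiset.sum_add, Multiset.sum_replicate, smul_eq_mul] at h5
    omega

section VeryEven

variable {k : Type*} [Field k] {d : ℕ} {ρ : Fin d → k} {r : PIdx P → k}
  {Γ : Finpartition (Finset.univ : Finset (PIdx P))}

/-- For a very even partition all members of `Γ` are of the first shape. -/
theorem two_mul_card_of_veryEven (hΓ : IsAdmissible r ρ Γ) (hP : VeryEven P) :
    2 * ((evenParts Γ).card + (hypParts r Γ).card) = P.parts.card := by
  classical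
  have heven : ∀ x : PIdx P, Even (len x) := fun x =>
    hP _ (Multiset.mem_of_mem_toEnumFinset x.2)
  have hno : ∀ x : PIdx P, ¬ Odd (len x) := fun x => Nat.not_odd_iff_even.2 (heven x)
  have hall : ∀ γ ∈ Γ.parts, IsEvenPart γ := by
    intro γ hγ
    obtain ⟨z, hz⟩ := Γ.nonempty_of_mem_parts hγ
    rcases hΓ.1 γ hγ with h | ⟨x, y, h, -⟩ | ⟨x, y, h, -⟩ | ⟨x, h, -⟩ | ⟨x, l, h, -⟩ |
      ⟨x, l, l', h, -⟩ | ⟨f, h⟩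
    · exact h
    · exact absurd h.1 (hno _)
    · exact absurd h.1 (hno _)
    · exact absurd (h.2.1 0) (hno _)
    · exact absurd (h.2.1 0) (hno _)
    · exact absurd (h.2.1 0) (hno _)
    · exact absurd (h ⟨z, hz⟩).1 (hno _)
  have h1 : evenParts Γ = Γ.parts := Finset.filter_true_of_mem hall
  have h2 : hypParts r Γ = ∅ := by
    refine Finset.filter_false_of_mem fun γ hγ h => ?_
    obtain ⟨z, hz⟩ := Γ.nonempty_of_mem_parts hγ
    exact hno z (h.odd_len z hz)
  rw [h1, h2, Finset.card_empty, add_zero, ← card_pIdx, ← Finset.card_univ, ← Γ.sum_card_parts,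
    Finset.sum_const_nat (m := 2), mul_comm]
  intro γ hγ
  obtain ⟨x, y, hxy, rfl⟩ := hall γ hγ
  exact Finset.card_pair hxy.ne

end VeryEven

end Partition

/-! ### Chains of a realization -/

section Gluing

variable {k : Type*} [Field k] [ValuativeRel k] [TopologicalSpace k] [IsNonarchimedeanLocalField k]
variable {m d n : ℕ} {P : Nat.Partition n} {ρ : Fin d → k} {r : PIdx P → k}

theorem exists_isBlock_of_plain (h2 : (2 : k) ≠ 0 ∧ val (2 : k) = 0)
    (hρ : (QuadraticMap.weightedSumSquares k ρ).Anisotropic)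
    (hρ_rep : ∀ l l', SameClass (ρ l) (ρ l') → ρ l = ρ l')
    (hr : ∀ x, Odd (len x) → r x ≠ 0)
    {γ : Finset (PIdx P)} {S : Finset (Fin m)} {T : Finset (Fin d)} {ch : PIdx P → ℕ → WSpace k m d}
    (hne : γ.Nonempty)
    (h : EvenBlock γ S T ch ∨ HypBlock r γ S T ch ∨ PairsBlock r γ S T ch ∨ QuadBlock r γ S T ch ∨
      TripBlock r ρ γ S T ch ∨ SignBlock r ρ γ S T ch ∨ AniBlock r ρ γ S T ch) :
    ∃ (σ : PIdx P → PIdx P) (η : PIdx P → k) (ctr sg : Fin m → ℝ),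
      IsBlock ρ γ S T ch σ η ctr sg (IsEvenPart γ ∨ IsHypPart r γ) := by
  rcases h with ⟨x, y, hxy, rfl, h⟩ | ⟨x, y, hxy, rfl, h⟩ | h | h | h | h | h
  · exact exists_isBlock_congr (by simpa using Or.inl ⟨x, y, hxy, rfl⟩)
      (h.exists_isBlock hxy.ne hxy.2.1 (len_pos x))
  · exact exists_isBlock_congr (by simpa using Or.inr ⟨x, y, hxy, rfl⟩)
      (h.exists_isBlock hxy.2.2.1 hxy.2.1 (len_pos x))
  · exact h.exists_isBlock h2 hr
  · exact h.exists_isBlock h2 hr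
  · exact h.exists_isBlock h2 (ne_zero_of_anisotropic hρ)
  · exact h.exists_isBlock h2 (ne_zero_of_anisotropic hρ) hρ_rep
  · exact h.exists_isBlock hρ hne

theorem TwistedEvenBlock.exists_isBlock
    {γ : Finset (PIdx P)} {S : Finset (Fin m)} {T : Finset (Fin d)} {ch : PIdx P → ℕ → WSpace k m d}
    (h : TwistedEvenBlock γ S T ch) :
    ∃ (σ : PIdx P → PIdx P) (η : PIdx P → k) (ctr sg : Fin m → ℝ),
      IsBlock ρ γ S T ch σ η ctr sg (IsEvenPart γ ∨ IsHypPart r γ) := by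
  obtain ⟨x, y, hxy, rfl, h⟩ := h
  exact exists_isBlock_congr (by simpa using Or.inl ⟨x, y, hxy, rfl⟩)
    (h.exists_isBlock hxy.ne hxy.2.1 (len_pos x))

variable {Γ : Finpartition (Finset.univ : Finset (PIdx P))} {W : Finset (Finset (PIdx P))}

/-- The chains of a realization form a chain system, and the parts of `B(Y, H, X)` belonging to its
blocks together make up a set to which the description of maximal facets applies. -/
theorem Realization.exists_isChainSystem (h2 : (2 : k) ≠ 0 ∧ val (2 : k) = 0)
    (hρ : (QuadraticMap.weightedSumSquares k ρ).Anisotropic)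
    (hρ_rep : ∀ l l', SameClass (ρ l) (ρ l') → ρ l = ρ l')
    (hr : ∀ x, Odd (len x) → r x ≠ 0) (hn : n = 2 * m + d)
    (hunit : ∀ x : PIdx P, ∀ N : ℕ, 0 < N → N < len x → (N : k) ≠ 0 ∧ val (N : k) = 0)
    (R : Realization r ρ m Γ W) :
    (∃ σ η, IsChainSystem ρ len R.ch σ η) ∧ ∀ D, R.Determines D →
      MaximalFacetsHaveDim ρ (buildingSet ρ D) ((evenParts Γ).card + (hypParts r Γ).card) := by
  classical
  have hblock : ∀ γ : Γ.parts, ∃ (σ : PIdx P → PIdx P) (η : PIdx P → k) (ctr sg : Fin m → ℝ),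
      IsBlock ρ γ.1 (R.S γ.1) (R.T γ.1) R.ch σ η ctr sg (IsEvenPart γ.1 ∨ IsHypPart r γ.1) := by
    rintro ⟨γ, hγ⟩
    by_cases hW : γ ∈ W
    · exact (R.twisted γ hγ hW).exists_isBlock
    · exact exists_isBlock_of_plain h2 hρ hρ_rep hr (Γ.nonempty_of_mem_parts hγ) (R.plain γ hγ hW)
  choose σ η ctr sg hB using hblock
  let pt : PIdx P → Γ.parts := fun x => ⟨Γ.part x, Γ.part_mem.2 (Finset.mem_univ x)⟩
  have hmem : ∀ x, x ∈ (pt x).1 := fun x => Γ.mem_part (Finset.mem_univ x)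
  have hpt : ∀ {x} {γ : Γ.parts}, x ∈ γ.1 → pt x = γ := fun {x γ} h =>
    Subtype.ext (Γ.part_eq_of_mem γ.2 h)
  have hptσ : ∀ x, pt (σ (pt x) x) = pt x := fun x => hpt ((hB _).mapsTo _ (hmem x))
  have hchain : IsChainSystem ρ len R.ch (fun x => σ (pt x) x) (fun x => η (pt x) x) := by
    refine ⟨fun x => ?_, fun x => (hB _).len_eq _ (hmem x), fun x => (hB _).ne_zero _ (hmem x),
      fun x s s' h => (hB _).pair _ (hmem x) s s' h, fun x y s s' hs hs' h => ?_⟩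
    · simp only [hptσ]
      exact (hB _).invol _ (hmem x)
    · by_cases hxy : pt y = pt x
      · exact (hB _).orth x (hmem x) y (hxy ▸ hmem y) s s' hs hs' h
      · have hne : (pt y).1 ≠ (pt x).1 := fun h => hxy (Subtype.ext h)
        refine form_eq_zero_of_disjoint ρ (fun a => ?_) fun l => ?_
        · by_cases ha : a ∈ R.S (pt x).1
          · exact Or.inr ((hB _).supp_S y (hmem y) s' hs' a
              fun ha' => (Finset.disjoint_left.1 (R.S_disj (pt y).2 (pt x).2 hne)) ha' ha)
          · exact Or.inl ((hB _).supp_S x (hmem x) s hs a ha)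
        · by_cases hl : l ∈ R.T (pt x).1
          · exact Or.inr ((hB _).supp_T y (hmem y) s' hs' l
              fun hl' => (Finset.disjoint_left.1 (R.T_disj (pt y).2 (pt x).2 hne)) hl' hl)
          · exact Or.inl ((hB _).supp_T x (hmem x) s hs l hl)
  refine ⟨⟨_, _, hchain⟩, fun D hD => ?_⟩
  have hL : ∑ x : PIdx P, len x = 2 * m + d := (sum_len P).trans hn
  choose blk hblk using fun a => (R.S_cover a : ∃ γ ∈ Γ.parts, a ∈ R.S γ)
  let b : Fin m → Γ.parts := fun a => ⟨blk a, (hblk a).1⟩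
  have hb : ∀ {a} {γ : Γ.parts}, a ∈ R.S γ.1 → b a = γ := by
    intro a γ h
    by_contra hne
    exact Finset.disjoint_left.1 (R.S_disj (b a).2 γ.2 fun h => hne (Subtype.ext h)) (hblk a).2 h
  -- the description of `B(Y, H, X)` in coordinates
  have hΩ : ∀ x, x ∈ buildingSet ρ D ↔
      ∃ t : Γ.parts → ℝ, ∀ a, x a = ctr (b a) a + sg (b a) a * t (b a) := by
    intro x
    constructor
    · intro hx
      have : ∀ γ : Γ.parts, ∃ t : ℝ, ∀ a ∈ R.S γ.1, x a = ctr γ a + sg γ a * t := fun γ =>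
        (hB γ).param x fun y _ s hs s' hs' t => inLattice_chain_iff (hD y) hx (hunit y) hs hs'
      choose t ht using this
      exact ⟨t, fun a => ht (b a) a (hblk a).2⟩
    · rintro ⟨t, ht⟩
      have : ∀ γ : Γ.parts, ∃ o : PIdx P → ℝ,
          (∀ y ∈ γ.1, ∀ s < len y, InLattice ρ x (o y) (R.ch y s)) ∧
            ∀ y ∈ γ.1, (val (η γ y) : ℝ) ≤ o y + o (σ γ y) := fun γ =>
        (hB γ).levels x (t γ) fun a ha => by rw [← hb ha]; exact ht a
      choose o ho ho' using this
      refine hchain.mem_buildingSet hL len_pos (ne_zero_of_anisotropic hρ)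
        (o := fun y => o (pt y) y) (fun y s hs => ho _ y (hmem y) s hs) (fun y => ?_) hD
      simp only [hptσ]
      exact ho' _ y (hmem y)
  have hsat : ∀ x ∈ buildingSet ρ D, facetOf ρ x ⊆ buildingSet ρ D := by
    intro x hx y hy
    obtain ⟨t, ht⟩ := (hΩ x).1 hx
    have : ∀ γ : Γ.parts, ∃ t' : ℝ, ∀ a ∈ R.S γ.1, y a = ctr γ a + sg γ a * t' := fun γ =>
      (hB γ).sat x y (t γ) hy fun a ha => by rw [← hb ha]; exact ht a
    choose t' ht' using this
    exact (hΩ y).2 ⟨t', fun a => ht' (b a) a (hblk a).2⟩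
  have hcard : {γ : Γ.parts | ∃ a, b a = γ ∧ sg (b a) a ≠ 0}.ncard =
      (evenParts Γ).card + (hypParts r Γ).card := by
    have hset : {γ : Γ.parts | ∃ a, b a = γ ∧ sg (b a) a ≠ 0} =
        {γ : Γ.parts | IsEvenPart γ.1 ∨ IsHypPart r γ.1} := by
      ext γ
      simp only [Set.mem_ofPred_eq]
      rw [← (hB γ).free_iff]
      constructor
      · rintro ⟨a, rfl, h⟩
        exact ⟨a, (hblk a).2, h⟩
      · rintro ⟨a, ha, h⟩
        have := hb ha
        subst this
        exact ⟨a, rfl, h⟩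
    have hdisj : Disjoint (evenParts Γ) (hypParts r Γ) := by
      rw [Finset.disjoint_left]
      intro γ h1 h2
      obtain ⟨hγ, h1⟩ := Finset.mem_filter.1 h1
      obtain ⟨x, hx⟩ := Γ.nonempty_of_mem_parts hγ
      exact not_isEvenPart hx ((Finset.mem_filter.1 h2).2.odd_len x hx) h1
    rw [hset, ← Finset.card_union_of_disjoint hdisj, evenParts, hypParts, ← Finset.filter_or,
      ← Set.ncard_coe_finset, ← Set.ncard_image_of_injective _ Subtype.val_injective]
    congr 1
    ext γ
    simp [and_comm]
  rw [← hcard]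
  exact maximalFacetsHaveDim_of_blocks ρ _ b (fun a => ctr (b a) a) (fun a => sg (b a) a)
    (fun a => (hB _).sg_cases a (hblk a).2) hΩ hsat

end Gluing

/-! ### Determinants of isometries commuting with a nilpotent operator -/

section Determinant

open Module Polynomial

variable {k : Type*} [Field k]

/-- All Jordan blocks of the nilpotent operator `f` at the eigenvalue `0` have even size: a vector of
the kernel that lies in the image of an even power of `f` lies in the image of the next power. -/
def HasEvenBlocks {V : Type*} [AddCommGroup V] [Module k V] (f : End k V) : Prop :=
  ∀ j w, (f ^ (2 * j + 1)) w = 0 → ∃ w', (f ^ (2 * j)) w = (f ^ (2 * j + 1)) w'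

theorem finrank_range_pow {V : Type*} [AddCommGroup V] [Module k V] [FiniteDimensional k V]
    (f : End k V) (j : ℕ) : finrank k (LinearMap.range (f ^ j)) =
      finrank k (LinearMap.range (f ^ (j + 1))) +
        finrank k ↥(LinearMap.ker f ⊓ LinearMap.range (f ^ j)) := by
  rw [← LinearMap.finrank_range_add_finrank_ker (f.domRestrict (LinearMap.range (f ^ j)))]
  congr 1
  · rw [LinearMap.range_domRestrict, ← LinearMap.range_comp, pow_succ']
    rfl
  · rw [LinearMap.domRestrict, LinearMap.ker_comp, ← Submodule.finrank_map_subtype_eq,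
      Submodule.map_comap_subtype, inf_comm]

theorem HasEvenBlocks.even_finrank {V : Type*} [AddCommGroup V] [Module k V] [FiniteDimensional k V]
    {f : End k V} (h : HasEvenBlocks f) (hf : IsNilpotent f) : Even (finrank k V) := by
  obtain ⟨N, hN⟩ := hf
  have hstep : ∀ j, Even (finrank k (LinearMap.range (f ^ (2 * (j + 1))))) →
      Even (finrank k (LinearMap.range (f ^ (2 * j)))) := by
    intro j hj
    have hker : LinearMap.ker f ⊓ LinearMap.range (f ^ (2 * j)) =
        LinearMap.ker f ⊓ LinearMap.range (f ^ (2 * j + 1)) := by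
      refine le_antisymm ?_ (inf_le_inf_left _ ?_)
      · rintro _ ⟨h1, w, rfl⟩
        refine ⟨h1, ?_⟩
        obtain ⟨w', hw'⟩ := h j w (by rw [pow_succ']; exact h1)
        exact ⟨w', hw'.symm⟩
      · rw [pow_succ]
        exact LinearMap.range_comp_le_range _ _
    have h1 := finrank_range_pow f (2 * j)
    have h2 := finrank_range_pow f (2 * j + 1)
    rw [hker] at h1
    rw [h1, h2, add_assoc, ← two_mul]
    exact hj.add (even_two_mul _)
  have hall : ∀ i ≤ N, Even (finrank k (LinearMap.range (f ^ (2 * (N - i))))) := by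
    intro i
    induction i with
    | zero =>
      intro _
      rw [Nat.sub_zero, mul_comm, pow_mul, hN]
      rw [zero_pow two_ne_zero, LinearMap.range_zero, finrank_bot]
      exact Even.zero
    | succ i ih =>
      intro hi
      refine hstep _ ?_
      rw [show N - (i + 1) + 1 = N - i by omega]
      exact ih (by omega)
  have := hall N le_rfl
  rwa [Nat.sub_self, mul_zero, pow_zero, Module.End.one_eq_id, LinearMap.range_id, finrank_top]
    at this

/-- Direct summands inherit the evenness of the Jordan blocks. -/
theorem HasEvenBlocks.even_finrank_of_isCompl {V : Type*} [AddCommGroup V] [Module k V]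
    [FiniteDimensional k V] {f : End k V} (h : HasEvenBlocks f) (hf : IsNilpotent f)
    {U U' : Submodule k V} (hUU' : IsCompl U U') (hU : ∀ u ∈ U, f u ∈ U) (hU' : ∀ u ∈ U', f u ∈ U') :
    Even (finrank k U) := by
  have hpow : ∀ (j : ℕ) (u : U), (((f.restrict hU) ^ j) u : V) = (f ^ j) u := by
    intro j u
    rw [Module.End.pow_restrict]
    rfl
  have hU'pow : ∀ (j : ℕ), ∀ u ∈ U', (f ^ j) u ∈ U' := by
    intro j
    induction j with
    | zero => intro u hu; simpa using hu
    | succ j ih => intro u hu; rw [pow_succ']; exact hU' _ (ih u hu)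
  refine HasEvenBlocks.even_finrank (f := f.restrict hU) (fun j w hw => ?_) ?_
  · obtain ⟨w', hw'⟩ := h j w (by rw [← hpow, hw]; rfl)
    obtain ⟨a, ha, b, hb, rfl⟩ := Submodule.mem_sup.1
      (hUU'.sup_eq_top ▸ Submodule.mem_top : w' ∈ U ⊔ U')
    refine ⟨⟨a, ha⟩, Subtype.ext ?_⟩
    rw [hpow, hpow]
    have h1 : (f ^ (2 * j)) w - (f ^ (2 * j + 1)) a ∈ U :=
      U.sub_mem (hpow (2 * j) w ▸ Subtype.property _)
        (hpow (2 * j + 1) ⟨a, ha⟩ ▸ Subtype.property _)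
    have h2 : (f ^ (2 * j)) w - (f ^ (2 * j + 1)) a = (f ^ (2 * j + 1)) b := by
      rw [hw', map_add, add_sub_cancel_left]
    have h3 := Submodule.disjoint_def.1 hUU'.disjoint _ h1 (h2 ▸ hU'pow _ b hb)
    exact sub_eq_zero.1 h3
  · obtain ⟨N, hN⟩ := hf
    refine ⟨N, LinearMap.ext fun u => Subtype.ext ?_⟩
    rw [hpow, hN]
    rfl

/-- An isometry commuting with a nilpotent operator whose Jordan blocks are all even has determinant
`1`. Its characteristic polynomial is self-reciprocal up to the sign `det h`, so that `det h` is the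
parity of the multiplicity of the eigenvalue `-1`; and the generalized eigenspace of `-1` is a direct
summand for the nilpotent operator, hence of even dimension. -/
theorem det_eq_one_of_commute {ι : Type*} [Fintype ι] [DecidableEq ι] {G h Z : Matrix ι ι k}
    (hG : IsUnit G) (hcard : Even (Fintype.card ι)) (hh : hᵀ * G * h = G) (hZ : h * Z = Z * h)
    (hnil : IsNilpotent Z) (hev : HasEvenBlocks (Matrix.toLin' Z)) : h.det = 1 := by
  have hGdet := (Matrix.isUnit_iff_isUnit_det G).1 hG
  have hdet2 : h.det * h.det = 1 := by
    have := congrArg Matrix.det hh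
    rw [Matrix.det_mul, Matrix.det_mul, Matrix.det_transpose] at this
    exact mul_right_cancel₀ hGdet.ne_zero (by linear_combination this)
  have hunit : IsUnit h := (Matrix.isUnit_iff_isUnit_det h).2
    (isUnit_iff_ne_zero.2 (left_ne_zero_of_mul_eq_one hdet2))
  have hinv : h⁻¹ = G⁻¹ * hᵀ * G := by
    refine Matrix.inv_eq_left_inv ?_
    rw [mul_assoc, mul_assoc, ← mul_assoc hᵀ, hh, Matrix.nonsing_inv_mul _ hGdet]
  have hchar : h.charpoly = C h.det * h.charpoly.reverse := by
    have h1 := Matrix.charpoly_inv h hunit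
    have h2 : (h⁻¹).charpoly = h.charpoly := by
      have h3 := Matrix.charpoly_units_conj' hG.unit hᵀ
      rw [Matrix.charpoly_transpose] at h3
      rw [hinv, ← h3]
      simp
    rw [h2, hcard.neg_one_pow, one_mul, Ring.inverse_eq_inv', inv_eq_of_mul_eq_one_left hdet2] at h1
    rw [Matrix.reverse_charpoly]
    exact h1
  -- the generalized eigenspace of `-1` has even dimension
  set φ : End k (ι → k) := Matrix.toLin' h with hφ
  have heven : Even (h.charpoly.rootMultiplicity (-1)) := by
    rw [← Matrix.charpoly_toLin', ← LinearMap.finrank_maxGenEigenspace_eq]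
    obtain ⟨N, hN, hN'⟩ := ((φ - (-1 : k) • 1).eventually_isCompl_ker_pow_range_pow.and
      (Filter.eventually_ge_atTop (finrank k (ι → k)))).exists
    have hcomm : Commute (Matrix.toLin' Z) ((φ - (-1 : k) • 1) ^ N) := by
      refine Commute.pow_right (Commute.sub_right ?_ (Commute.smul_right (Commute.one_right _) _)) _
      change Matrix.toLin' Z ∘ₗ Matrix.toLin' h = Matrix.toLin' h ∘ₗ Matrix.toLin' Z
      rw [← Matrix.toLin'_mul, ← Matrix.toLin'_mul, hZ]
    rw [Module.End.maxGenEigenspace_eq_genEigenspace_finrank,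
      ← Module.End.genEigenspace_eq_genEigenspace_finrank_of_le _ _ hN',
      Module.End.genEigenspace_nat]
    refine hev.even_finrank_of_isCompl ?_ hN ?_ ?_
    · obtain ⟨M, hM⟩ := hnil
      exact ⟨M, by rw [← Matrix.toLin'_pow, hM, map_zero]⟩
    · intro u hu
      rw [LinearMap.mem_ker] at hu ⊢
      have := LinearMap.congr_fun hcomm.eq u
      simp only [Module.End.mul_apply] at this
      rw [← this, hu, map_zero]
    · rintro _ ⟨u, rfl⟩
      have := LinearMap.congr_fun hcomm.eq u
      simp only [Module.End.mul_apply] at this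
      exact ⟨_, this.symm⟩
  -- cancel the powers of `X + 1` in the functional equation, and evaluate at `-1`
  have hne : h.charpoly ≠ 0 := h.charpoly_monic.ne_zero
  obtain ⟨f, hf, hndvd⟩ := h.charpoly.exists_eq_pow_rootMultiplicity_mul_and_not_dvd hne (-1)
  set a := h.charpoly.rootMultiplicity (-1)
  have hX1 : (X - C (-1) : k[X]) = X + 1 := by simp
  rw [hX1] at hf hndvd
  have hrevX : ∀ b : ℕ, ((X + 1 : k[X]) ^ b).reverse = (X + 1) ^ b := by
    intro b
    induction b with
    | zero => simpa using reverse_C (1 : k)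
    | succ b ih =>
      rw [pow_succ, reverse_mul_of_domain, ih]
      congr 1
      have h1 := reverse_X_mul (C (1 : k))
      rw [reverse_C, C_1, mul_one] at h1
      rw [← C_1, reverse_add_C, h1, natDegree_X, pow_one, C_1, one_mul, add_comm]
  have hX1ne : (X + 1 : k[X]) ≠ 0 := hX1 ▸ X_sub_C_ne_zero (-1 : k)
  have hfrev : f = C h.det * f.reverse := by
    rw [hf, reverse_mul_of_domain, hrevX] at hchar
    exact mul_left_cancel₀ (pow_ne_zero a hX1ne) (by rw [hchar]; ring)
  have hroot : f.eval (-1) ≠ 0 := by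
    intro h0
    exact hndvd (hX1 ▸ dvd_iff_isRoot.2 h0)
  have hfdeg : Even f.natDegree := by
    have h1 := congrArg natDegree hf
    rw [Matrix.charpoly_natDegree_eq_dim, natDegree_mul (pow_ne_zero _ hX1ne) (by
      rintro rfl; simp at hroot), natDegree_pow, ← hX1, natDegree_X_sub_C, mul_one] at h1
    rw [h1, Nat.even_add] at hcard
    exact hcard.1 heven
  have hevrev : f.reverse.eval (-1) = f.eval (-1) := by
    let := invertibleOfNonzero (neg_ne_zero.2 (one_ne_zero (α := k)))
    have h1 := eval₂_reverse_mul_pow (RingHom.id k) (-1) f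
    rw [hfdeg.neg_one_pow, mul_one, invOf_eq_inv, inv_neg, inv_one] at h1
    exact h1
  have h1 := congrArg (eval (-1)) hfrev
  rw [eval_mul, eval_C, hevrev] at h1
  exact mul_right_cancel₀ hroot (by rw [one_mul]; exact h1.symm)

end Determinant

/-! ### Nilpotent operators with chains of even length -/

section EvenChains

variable {k : Type*} [Field k] {m d : ℕ} {I : Type*} {ρ : Fin d → k} {L : I → ℕ}
  {ch : I → ℕ → WSpace k m d} {σ : I → I} {η : I → k} {D : Triple k m d}

theorem pow_mulVec_chain (hpos : ∀ x, 0 < L x) (hD : ∀ x, D.ActsStandard (L x) (ch x)) (j : ℕ)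
    {x : I} {s : ℕ} (hs : s < L x) :
    (D.X ^ j) *ᵥ ch x s = if j ≤ s then ch x (s - j) else 0 := by
  simp only [actsStandard_iff _ (hpos _)] at hD
  induction j with
  | zero => simp
  | succ j ih =>
    rw [pow_succ', ← Matrix.mulVec_mulVec, ih]
    by_cases h1 : j ≤ s
    · rw [if_pos h1, (hD x (s - j) (by omega)).2.1]
      by_cases h2 : s = j
      · rw [if_pos (by omega), if_neg (by omega)]
      · rw [if_neg (by omega), if_pos (by omega), Nat.sub_sub]
    · rw [if_neg h1, if_neg (by omega), Matrix.mulVec_zero]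

theorem IsSkew.form_pow_mulVec {X : Matrix (WIdx m d) (WIdx m d) k} (hX : IsSkew ρ X) (j : ℕ)
    (u u' : WSpace k m d) :
    form ρ ((X ^ j) *ᵥ u) u' = (-1) ^ j * form ρ u ((X ^ j) *ᵥ u') := by
  induction j generalizing u' with
  | zero => simp
  | succ j ih =>
    rw [pow_succ', ← Matrix.mulVec_mulVec, (isSkew_iff ρ X).1 hX, ih, ← pow_succ' X, pow_succ X,
      ← Matrix.mulVec_mulVec, pow_succ' (-1 : k)]
    ring

namespace IsChainSystem

variable [Fintype I] (hL : ∑ x, L x = 2 * m + d)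
include hL

theorem isNilpotent (h : IsChainSystem ρ L ch σ η) (hpos : ∀ x, 0 < L x)
    (hD : ∀ x, D.ActsStandard (L x) (ch x)) : IsNilpotent D.X := by
  refine ⟨2 * m + d, h.matrix_ext hL fun x s hs => ?_⟩
  have h1 : L x ≤ 2 * m + d := hL ▸
    Finset.single_le_sum (f := L) (fun _ _ => Nat.zero_le _) (Finset.mem_univ x)
  rw [pow_mulVec_chain hpos hD _ hs, if_neg (by omega), Matrix.zero_mulVec]

/-- If all chains have even length, the Jordan blocks of `X` have even size. -/
theorem hasEvenBlocks (h : IsChainSystem ρ L ch σ η) (hpos : ∀ x, 0 < L x)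
    (hD : ∀ x, D.ActsStandard (L x) (ch x)) (heven : ∀ x, Even (L x)) :
    HasEvenBlocks (Matrix.toLin' D.X) := by
  intro j w hw
  rw [← Matrix.toLin'_pow, Matrix.toLin'_apply] at hw
  simp only [← Matrix.toLin'_pow, Matrix.toLin'_apply]
  have hskew := (h.isLieTriple hL hpos hD).2.2.1
  -- the coordinates of `w` beyond the place `2 * j` vanish
  have hcoord : ∀ i : Σ x, Fin (L x), 2 * j + 1 ≤ i.2 → (h.basis hL).repr w i = 0 := by
    rintro ⟨x, s⟩ hs
    have h1 := s.2
    simp only at hs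
    rw [basis_repr]
    have h2 := hskew.form_pow_mulVec (2 * j + 1) w (ch (σ x) (L x - 1 - s + (2 * j + 1)))
    rw [hw, map_zero, LinearMap.zero_apply, pow_mulVec_chain hpos hD _ (by rw [h.len_eq]; omega),
      if_pos (by omega), Nat.add_sub_cancel] at h2
    rw [(mul_eq_zero.1 h2.symm).resolve_left (by simp), zero_mul]
  have hsum := (h.basis hL).sum_repr w
  simp only [basis_apply] at hsum
  refine ⟨∑ i : Σ x, Fin (L x), (h.basis hL).repr w i •
    (if (i.2 : ℕ) = 2 * j then ch i.1 (2 * j + 1) else 0), ?_⟩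
  conv_lhs => rw [← hsum]
  rw [Matrix.mulVec_sum, Matrix.mulVec_sum]
  refine Finset.sum_congr rfl fun i _ => ?_
  rw [Matrix.mulVec_smul, Matrix.mulVec_smul]
  have hi := i.2.2
  rcases lt_trichotomy (i.2 : ℕ) (2 * j) with h1 | h1 | h1
  · rw [pow_mulVec_chain hpos hD _ hi, if_neg (by omega), if_neg (by omega), Matrix.mulVec_zero]
  · obtain ⟨a, ha⟩ := heven i.1
    rw [pow_mulVec_chain hpos hD _ hi, if_pos (by omega), if_pos h1,
      pow_mulVec_chain hpos hD _ (by omega), if_pos le_rfl, h1, Nat.sub_self, Nat.sub_self]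
  · rw [hcoord i (by omega), zero_smul, zero_smul]

end IsChainSystem

end EvenChains

/-! ### Permutations of the hyperbolic pairs -/

section PermMatrix

variable {k : Type*} [Field k] {m d : ℕ}

/-- The operator permuting the basis vectors of `V`. -/
def permOp (k : Type*) [Field k] (ϖ : Equiv.Perm (WIdx m d)) : Matrix (WIdx m d) (WIdx m d) k :=
  Equiv.Perm.permMatrix k ϖ⁻¹

theorem permOp_mulVec_single (ϖ : Equiv.Perm (WIdx m d)) (a : WIdx m d) :
    permOp k ϖ *ᵥ Pi.single a 1 = Pi.single (ϖ a) 1 := by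
  rw [permOp, Matrix.permMatrix_mulVec]
  ext b
  simp [Pi.single_apply, Equiv.symm_apply_eq]

theorem det_permOp (ϖ : Equiv.Perm (WIdx m d)) :
    (permOp k ϖ).det = ((Equiv.Perm.sign ϖ : ℤ) : k) := by
  rw [permOp, Matrix.det_permutation, Equiv.Perm.sign_inv]

theorem isOrth_permOp {ρ : Fin d → k} {ϖ : Equiv.Perm (WIdx m d)}
    (h : ∀ a b, gram ρ (ϖ a) (ϖ b) = gram ρ a b) : IsOrth ρ (permOp k ϖ) := by
  have hform : ∀ a b : WIdx m d, form ρ (Pi.single a 1) (Pi.single b 1) = gram ρ a b := by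
    intro a b
    simp [form_eq_dotProduct]
  have := LinearMap.ext_basis (Pi.basisFun k (WIdx m d)) (Pi.basisFun k (WIdx m d))
    (B := (form ρ).compl₁₂ (permOp k ϖ).mulVecLin (permOp k ϖ).mulVecLin) (B' := form ρ)
    (fun a b => by
      simp only [Pi.basisFun_apply, LinearMap.compl₁₂_apply, Matrix.mulVecLin_apply,
        permOp_mulVec_single, hform, h])
  rw [isOrth_iff]
  intro u u'
  simpa using LinearMap.congr_fun₂ this u u'

/-- The permutation of the basis vectors that permutes the hyperbolic pairs by `π` and then
exchanges the two members of the `l`-th pair. -/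
def pairPerm (d : ℕ) (π : Equiv.Perm (Fin m)) (l : Fin m) : Equiv.Perm (WIdx m d) :=
  (Equiv.sumCongr π (Equiv.sumCongr π 1)).trans (Equiv.swap (Sum.inl l) (Sum.inr (Sum.inl l)))

theorem pairPerm_inl (π : Equiv.Perm (Fin m)) (l i : Fin m) :
    pairPerm d π l (Sum.inl i) =
      if π i = l then Sum.inr (Sum.inl (π i)) else Sum.inl (π i) := by
  rw [pairPerm, Equiv.trans_apply, Equiv.sumCongr_apply, Sum.map_inl]
  split_ifs with h
  · rw [h, Equiv.swap_apply_left]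
  · exact Equiv.swap_apply_of_ne_of_ne (by simpa using h) (by simp)

theorem pairPerm_inr_inl (π : Equiv.Perm (Fin m)) (l i : Fin m) :
    pairPerm d π l (Sum.inr (Sum.inl i)) =
      if π i = l then Sum.inl (π i) else Sum.inr (Sum.inl (π i)) := by
  rw [pairPerm, Equiv.trans_apply, Equiv.sumCongr_apply, Sum.map_inr, Equiv.sumCongr_apply,
    Sum.map_inl]
  split_ifs with h
  · rw [h, Equiv.swap_apply_right]
  · exact Equiv.swap_apply_of_ne_of_ne (by simp) (by simpa using h)

theorem pairPerm_inr_inr (π : Equiv.Perm (Fin m)) (l : Fin m) (i : Fin d) :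
    pairPerm d π l (Sum.inr (Sum.inr i)) = Sum.inr (Sum.inr i) := by
  rw [pairPerm, Equiv.trans_apply, Equiv.sumCongr_apply, Sum.map_inr, Equiv.sumCongr_apply,
    Sum.map_inr]
  exact Equiv.swap_apply_of_ne_of_ne (by simp) (by simp)

theorem gram_pairPerm (ρ : Fin d → k) (π : Equiv.Perm (Fin m)) (l : Fin m) (a b : WIdx m d) :
    gram ρ (pairPerm d π l a) (pairPerm d π l b) = gram ρ a b := by
  have hinj : ∀ {i j}, π i = l → π j = l → i = j := fun h1 h2 => π.injective (h1.trans h2.symm)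
  rcases a with i | i | i <;> rcases b with j | j | j <;>
    simp only [pairPerm_inl, pairPerm_inr_inl, pairPerm_inr_inr] <;> split_ifs <;>
    simp [gram, *] <;>
    first
    | exact hinj (by assumption) (by assumption)
    | (rintro rfl; contradiction)

theorem sign_pairPerm (π : Equiv.Perm (Fin m)) (l : Fin m) :
    Equiv.Perm.sign (pairPerm d π l) = -1 := by
  rw [pairPerm, Equiv.Perm.sign_trans, Equiv.Perm.sign_swap (by simp), Equiv.Perm.sign_sumCongr,
    Equiv.Perm.sign_sumCongr, Equiv.Perm.sign_one, mul_one, Int.units_mul_self, mul_one]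

theorem det_permOp_pairPerm (π : Equiv.Perm (Fin m)) (l : Fin m) :
    (permOp k (pairPerm d π l)).det = -1 := by
  rw [det_permOp, sign_pairPerm]
  simp

end PermMatrix

/-! ### Conjugacy of the two triples of a very even partition -/

section Orbits

variable {k : Type*} [Field k] {m d n : ℕ} {P : Nat.Partition n} {ρ : Fin d → k} {r : PIdx P → k}
  {Γ : Finpartition (Finset.univ : Finset (PIdx P))}

/-- A set of the first shape can be listed in one order only. -/
theorem EvenRel.pair_unique {x y x' y' : PIdx P} (h : EvenRel x y) (h' : EvenRel x' y')
    (heq : ({x, y} : Finset (PIdx P)) = {x', y'}) : x = x' ∧ y = y' := by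
  have hx : x = x' ∨ x = y' := by
    have h0 : x ∈ ({x', y'} : Finset (PIdx P)) := by rw [← heq]; simp
    simpa using h0
  have hy : y = x' ∨ y = y' := by
    have h0 : y ∈ ({x', y'} : Finset (PIdx P)) := by rw [← heq]; simp
    simpa using h0
  have h1 := h.2.2
  have h2 := h'.2.2
  rcases hx with rfl | rfl <;> rcases hy with rfl | rfl
  · omega
  · exact ⟨rfl, rfl⟩
  · omega
  · omega

theorem Realization.evenBlock_of_veryEven (hP : VeryEven P) {W : Finset (Finset (PIdx P))}
    (R : Realization r ρ m Γ W) {γ : Finset (PIdx P)} (hγ : γ ∈ Γ.parts) (hW : γ ∉ W) :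
    EvenBlock γ (R.S γ) (R.T γ) R.ch := by
  have hno : ∀ x : PIdx P, ¬ Odd (len x) := fun x =>
    Nat.not_odd_iff_even.2 (hP _ (Multiset.mem_of_mem_toEnumFinset x.2))
  obtain ⟨z, hz⟩ := Γ.nonempty_of_mem_parts hγ
  rcases R.plain γ hγ hW with h | ⟨x, y, h, -⟩ | ⟨x, h, -⟩ | ⟨x, h, -⟩ | ⟨x, l, h, -⟩ |
    ⟨x, l, l', h, -⟩ | ⟨f, h, -⟩
  · exact h
  · exact absurd h.1 (hno _)
  · exact absurd h.1 (hno _)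
  · exact absurd (h.2.1 0) (hno _)
  · exact absurd (h.2.1 0) (hno _)
  · exact absurd (h.2.1 0) (hno _)
  · exact absurd (h ⟨z, hz⟩).1 (hno _)

/-- The hyperbolic pairs used by the blocks of a realization are all the hyperbolic pairs, each
once. -/
theorem Realization.bijective_pairs {W : Finset (Finset (PIdx P))} (R : Realization r ρ m Γ W)
    {N : Γ.parts → ℕ} (e : ∀ γ, Fin (N γ) ↪ Fin m) (he : ∀ γ, R.S γ.1 = Finset.univ.map (e γ)) :
    Function.Bijective fun i : Σ γ, Fin (N γ) => e i.1 i.2 := by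
  constructor
  · rintro ⟨γ, s⟩ ⟨γ', s'⟩ h
    simp only at h
    have h1 : e γ s ∈ R.S γ.1 := by simp [he]
    have h2 : e γ s ∈ R.S γ'.1 := by simp [he, h]
    obtain rfl : γ = γ' := by
      by_contra hne
      exact Finset.disjoint_left.1 (R.S_disj γ.2 γ'.2 fun h => hne (Subtype.ext h)) h1 h2
    rw [(e γ).injective h]
  · intro a
    obtain ⟨γ, hγ, ha⟩ := R.S_cover a
    rw [he ⟨γ, hγ⟩] at ha
    obtain ⟨s, -, rfl⟩ := Finset.mem_map.1 ha
    exact ⟨⟨⟨γ, hγ⟩, s⟩, rfl⟩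

/-- The element conjugating the untwisted triple to the twisted one: it matches the hyperbolic pairs
of the two realizations and exchanges the two members of the twisted pair, so it lies in `O(q)` but
not in `SO(q)`. -/
theorem Realization.exists_conj (hP : VeryEven P) {γ₀ : Finset (PIdx P)} (hγ₀ : γ₀ ∈ Γ.parts)
    (R : Realization r ρ m Γ ∅) (R' : Realization r ρ m Γ {γ₀}) :
    ∃ g : Matrix (WIdx m d) (WIdx m d) k, IsOrth ρ g ∧ g.det = -1 ∧
      ∃ θ : PIdx P → k, ∀ x, ∀ s < len x, g *ᵥ R.ch x s = θ x • R'.ch x s := by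
  classical
  have hR := fun γ : Γ.parts => R.evenBlock_of_veryEven hP γ.2 (Finset.notMem_empty _)
  choose x y hxy hγ e hS hT hch using hR
  have hR' : ∀ γ : Γ.parts, ∃ e' : Fin (len (x γ)) ↪ Fin m, R'.S γ.1 = Finset.univ.map e' ∧
      (γ.1 ≠ γ₀ → ∀ s : Fin (len (x γ)), R'.ch (x γ) s = vv (e' s) ∧
        R'.ch (y γ) s = ((-1 : k) ^ ((s : ℕ) + 1)) • ww (e' s.rev)) ∧
      (γ.1 = γ₀ → ∀ s : Fin (len (x γ)),
        R'.ch (x γ) s = (if (s : ℕ) + 1 = len (x γ) then ww (e' s) else vv (e' s)) ∧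
        R'.ch (y γ) s =
          (if (s : ℕ) = 0 then vv (e' s.rev) else ((-1 : k) ^ (s : ℕ)) • ww (e' s.rev))) := by
    intro γ
    by_cases h0 : γ.1 = γ₀
    · obtain ⟨x', y', hxy', hγ', e', h1, h2, h3⟩ := R'.twisted γ.1 γ.2 (by simp [h0])
      obtain ⟨rfl, rfl⟩ := (hxy γ).pair_unique hxy' ((hγ γ).symm.trans hγ')
      exact ⟨e', h1, fun h => absurd h0 h, fun _ => h3⟩
    · obtain ⟨x', y', hxy', hγ', e', h1, h2, h3⟩ :=
        R'.evenBlock_of_veryEven hP γ.2 (by simpa using h0)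
      obtain ⟨rfl, rfl⟩ := (hxy γ).pair_unique hxy' ((hγ γ).symm.trans hγ')
      exact ⟨e', h1, fun _ => h3, fun h => absurd h h0⟩
  choose e' hS' hplain htwist using hR'
  let E := Equiv.ofBijective _ (R.bijective_pairs e hS)
  let E' := Equiv.ofBijective _ (R'.bijective_pairs e' hS')
  let π : Equiv.Perm (Fin m) := E.symm.trans E'
  have hπ : ∀ γ s, π (e γ s) = e' γ s := by
    intro γ s
    change E' (E.symm (E ⟨γ, s⟩)) = _
    rw [Equiv.symm_apply_apply]
    rfl
  let last : Fin (len (x ⟨γ₀, hγ₀⟩)) := ⟨len (x ⟨γ₀, hγ₀⟩) - 1, Nat.sub_lt (len_pos _) one_pos⟩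
  let l : Fin m := e' ⟨γ₀, hγ₀⟩ last
  have hl : ∀ γ s, e' γ s = l ↔ γ.1 = γ₀ ∧ (s : ℕ) + 1 = len (x γ) := by
    intro γ s
    constructor
    · intro h
      have h1 := (R'.bijective_pairs e' hS').1 (a₁ := ⟨γ, s⟩) (a₂ := ⟨⟨γ₀, hγ₀⟩, last⟩) h
      obtain ⟨rfl, h2⟩ := Sigma.mk.inj_iff.1 h1
      refine ⟨rfl, ?_⟩
      rw [heq_eq_eq] at h2
      rw [h2]
      exact Nat.sub_add_cancel (len_pos _)
    · rintro ⟨h1, h2⟩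
      obtain rfl : γ = ⟨γ₀, hγ₀⟩ := Subtype.ext h1
      congr 1
      ext
      simp only [last]
      omega
  have hv : ∀ γ s, permOp k (pairPerm d π l) *ᵥ vv (e γ s) =
      if γ.1 = γ₀ ∧ (s : ℕ) + 1 = len (x γ) then ww (e' γ s) else vv (e' γ s) := by
    intro γ s
    rw [vv, permOp_mulVec_single, pairPerm_inl, hπ]
    simp only [hl]
    split_ifs <;> rfl
  have hw : ∀ γ s, permOp k (pairPerm d π l) *ᵥ ww (e γ s) =
      if γ.1 = γ₀ ∧ (s : ℕ) + 1 = len (x γ) then vv (e' γ s) else ww (e' γ s) := by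
    intro γ s
    rw [ww, permOp_mulVec_single, pairPerm_inr_inl, hπ]
    simp only [hl]
    split_ifs <;> rfl
  refine ⟨permOp k (pairPerm d π l), isOrth_permOp (gram_pairPerm ρ π l), det_permOp_pairPerm π l,
    fun z => if z = y ⟨γ₀, hγ₀⟩ then -1 else 1, fun z s hs => ?_⟩
  beta_reduce
  let γ : Γ.parts := ⟨Γ.part z, Γ.part_mem.2 (Finset.mem_univ z)⟩
  have hz : z ∈ γ.1 := Γ.mem_part (Finset.mem_univ z)
  have hxγ : ∀ γ : Γ.parts, x γ ∈ γ.1 := fun γ => by rw [hγ]; simp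
  have hyγ : ∀ γ : Γ.parts, y γ ∈ γ.1 := fun γ => by rw [hγ]; simp
  -- the sign is `-1` exactly for the second chain of the twisted block
  have hθx : x γ ≠ y ⟨γ₀, hγ₀⟩ := by
    intro h
    have h1 : γ = ⟨γ₀, hγ₀⟩ := Subtype.ext (Γ.eq_of_mem_parts γ.2 hγ₀ (hxγ γ) (h ▸ hyγ ⟨γ₀, hγ₀⟩))
    exact (hxy γ).ne (h.trans (by rw [h1]))
  have hθy : y γ = y ⟨γ₀, hγ₀⟩ ↔ γ.1 = γ₀ := by
    constructor
    · intro h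
      exact Γ.eq_of_mem_parts γ.2 hγ₀ (hyγ γ) (h ▸ hyγ ⟨γ₀, hγ₀⟩)
    · intro h
      congr 1
      exact Subtype.ext h
  have hz' : z = x γ ∨ z = y γ := by
    rw [hγ γ] at hz
    simpa using hz
  rcases hz' with hzx | hzy
  · rw [hzx] at hs ⊢
    rw [if_neg hθx, one_smul, (hch γ ⟨s, hs⟩).1, hv]
    by_cases h0 : γ.1 = γ₀
    · rw [(htwist γ h0 ⟨s, hs⟩).1]
      simp [h0]
    · rw [(hplain γ h0 ⟨s, hs⟩).1]
      simp [h0]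
  · rw [hzy] at hs ⊢
    rw [(hxy γ).2.1] at hs
    rw [(hch γ ⟨s, hs⟩).2, Matrix.mulVec_smul, hw]
    by_cases h0 : γ.1 = γ₀
    · rw [(htwist γ h0 ⟨s, hs⟩).2, if_pos (hθy.2 h0), Fin.val_rev]
      by_cases h1 : s = 0
      · subst h1
        rw [if_pos ⟨h0, by simp only; omega⟩]
        simp
      · rw [if_neg (by rintro ⟨-, h2⟩; simp only at h2; omega), if_neg h1, smul_smul, pow_succ']
    · rw [(hplain γ h0 ⟨s, hs⟩).2, if_neg (mt hθy.1 h0), one_smul, if_neg fun h => h0 h.1]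

/-- The two triples of a very even partition are conjugate under `O(q)` but not under `SO(q)`: the
conjugating elements form a coset of the centralizer of `X` in `O(q)`, on which the determinant is
constant, and one of them has determinant `-1`. -/
theorem oConj_and_not_soConj (h2 : (2 : k) ≠ 0) (hρ : ∀ l, ρ l ≠ 0) (hn : n = 2 * m + d)
    (hP : VeryEven P) {γ₀ : Finset (PIdx P)} (hγ₀ : γ₀ ∈ Γ.parts)
    (R : Realization r ρ m Γ ∅) (R' : Realization r ρ m Γ {γ₀})
    {σ : PIdx P → PIdx P} {η : PIdx P → k} (hR : IsChainSystem ρ len R.ch σ η)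
    {D D' : Triple k m d} (hD : R.Determines D) (hD' : R'.Determines D') :
    OConj ρ D.X D'.X ∧ ¬ SOConj ρ D.X D'.X := by
  have hL : ∑ x : PIdx P, len x = 2 * m + d := (sum_len P).trans hn
  have heven : ∀ x : PIdx P, Even (len x) := fun x => hP _ (Multiset.mem_of_mem_toEnumFinset x.2)
  obtain ⟨g, hg, hdet, θ, hθ⟩ := R.exists_conj hP hγ₀ R'
  have hgX : g * D.X = D'.X * g := by
    refine hR.matrix_ext hL fun x s hs => ?_
    have h1 := ((actsStandard_iff D (len_pos x) _).1 (hD x) s hs).2.1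
    have h1' := ((actsStandard_iff D' (len_pos x) _).1 (hD' x) s hs).2.1
    rw [← Matrix.mulVec_mulVec, ← Matrix.mulVec_mulVec, h1, hθ x s hs, Matrix.mulVec_smul, h1']
    split_ifs
    · simp
    · exact hθ x (s - 1) (by omega)
  refine ⟨⟨g, hg, hgX⟩, ?_⟩
  rintro ⟨g', hg', hdet', hg'X⟩
  have hgdet : IsUnit g.det := by rw [hdet]; exact isUnit_one.neg
  have hcent : (g⁻¹ * g').det = 1 := by
    refine det_eq_one_of_commute (G := gram ρ) (Z := D.X) ?_ ?_ ?_ ?_ (hR.isNilpotent hL len_pos hD)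
      (hR.hasEvenBlocks hL len_pos hD heven)
    · rw [Matrix.isUnit_iff_isUnit_det, isUnit_iff_ne_zero, Ne, ← Matrix.exists_mulVec_eq_zero_iff]
      rintro ⟨u, hu0, hu⟩
      refine hu0 (form_nondegenerate hρ fun u' => ?_)
      rw [form_comm, form_eq_dotProduct, hu, dotProduct_zero]
    · have h1 : Fintype.card (WIdx m d) = ∑ x : PIdx P, len x := by
        rw [hL]; simp; ring
      rw [h1]
      exact Finset.even_sum _ fun x _ => heven x
    · have h1 : g⁻¹ᵀ * gram ρ * g⁻¹ = gram ρ := by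
        have h3 : g * g⁻¹ = 1 := Matrix.mul_nonsing_inv g hgdet
        have h4 : g⁻¹ᵀ * gᵀ = 1 := by rw [← Matrix.transpose_mul, h3, Matrix.transpose_one]
        calc g⁻¹ᵀ * gram ρ * g⁻¹ = g⁻¹ᵀ * (gᵀ * gram ρ * g) * g⁻¹ := by rw [hg]
          _ = (g⁻¹ᵀ * gᵀ) * gram ρ * (g * g⁻¹) := by simp only [mul_assoc]
          _ = gram ρ := by rw [h3, h4, one_mul, mul_one]
      calc (g⁻¹ * g')ᵀ * gram ρ * (g⁻¹ * g') = g'ᵀ * (g⁻¹ᵀ * gram ρ * g⁻¹) * g' := by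
            rw [Matrix.transpose_mul]; simp only [mul_assoc]
        _ = gram ρ := by rw [h1]; exact hg'
    · have h3 : g⁻¹ * g = 1 := Matrix.nonsing_inv_mul g hgdet
      have h4 : g⁻¹ * D'.X = D.X * g⁻¹ := by
        calc g⁻¹ * D'.X = g⁻¹ * (D'.X * g) * g⁻¹ := by
              rw [mul_assoc, mul_assoc D'.X, Matrix.mul_nonsing_inv g hgdet, mul_one]
          _ = (g⁻¹ * g) * D.X * g⁻¹ := by rw [← hgX]; simp only [mul_assoc]
          _ = D.X * g⁻¹ := by rw [h3, one_mul]
      rw [mul_assoc, hg'X, ← mul_assoc, h4, mul_assoc]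
  rw [Matrix.det_mul, hdet', mul_one, Matrix.det_nonsing_inv, hdet, Ring.inverse_eq_inv', inv_neg,
    inv_one] at hcent
  exact h2 (by linear_combination -hcent)

end Orbits

end OrthNil

end

theorem proposition7p1
    {k : Type*} [Field k] [ValuativeRel k] [TopologicalSpace k] [IsNonarchimedeanLocalField k]
    {p : ℕ} [CharP 𝓀[k] p] (hp2 : p ≠ 2)
    {m d : ℕ} (hp : OrthNil.coxeterNumber (2 * m + d) < p)
    (ρ : Fin d → k)
    (hρ : (QuadraticMap.weightedSumSquares k ρ).Anisotropic)
    (hρ_rep : ∀ l l', OrthNil.SameClass (ρ l) (ρ l') → ρ l = ρ l')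
    (P : Nat.Partition (2 * m + d))
    (hP : ∀ i, Even i → Even (P.parts.count i))
    (r : OrthNil.PIdx P → k)
    (hr : ∀ x, Odd (OrthNil.len x) → r x ≠ 0)
    (hq : OrthNil.WittEquiv
      (fun x : ↥(Finset.univ.filter fun x : OrthNil.PIdx P => Odd (OrthNil.len x)) => r x.1) ρ)
    (Γ : Finpartition (Finset.univ : Finset (OrthNil.PIdx P)))
    (hΓ : OrthNil.IsAdmissible r ρ Γ) :
    (∀ R : OrthNil.Realization r ρ m Γ ∅,
      (∃! D : OrthNil.Triple k m d, R.Determines D) ∧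
      ∀ D : OrthNil.Triple k m d, R.Determines D →
        D.IsLieTriple ρ ∧
        OrthNil.MaximalFacetsHaveDim ρ (OrthNil.buildingSet ρ D)
          ((OrthNil.evenParts Γ).card + (OrthNil.hypParts r Γ).card)) ∧
    (OrthNil.VeryEven P → ∃ N : ℕ, 2 * N = P.parts.card ∧
      (∀ (R : OrthNil.Realization r ρ m Γ ∅) (D : OrthNil.Triple k m d), R.Determines D →
        OrthNil.MaximalFacetsHaveDim ρ (OrthNil.buildingSet ρ D) N) ∧
      ∀ γ ∈ Γ.parts, ∀ R' : OrthNil.Realization r ρ m Γ {γ},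
        (∃! D' : OrthNil.Triple k m d, R'.Determines D') ∧
        ∀ D' : OrthNil.Triple k m d, R'.Determines D' →
          D'.IsLieTriple ρ ∧
          OrthNil.MaximalFacetsHaveDim ρ (OrthNil.buildingSet ρ D') N ∧
          ∀ (R : OrthNil.Realization r ρ m Γ ∅) (D : OrthNil.Triple k m d), R.Determines D →
            OrthNil.OConj ρ D.X D'.X ∧ ¬ OrthNil.SOConj ρ D.X D'.X) := by
  have hprime : p.Prime := by
    rcases CharP.char_is_prime_or_zero 𝓀[k] p with h | h
    · exact h
    · omega
  have h2 : (2 : k) ≠ 0 ∧ OrthNil.val (2 : k) = 0 := by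
    have := OrthNil.val_natCast_of_not_dvd (k := k) (p := p) (N := 2)
      (fun h => hp2 ((Nat.prime_dvd_prime_iff_eq hprime Nat.prime_two).1 h))
    simpa using this
  -- all parts are at most `h + 1`, and `h < p`
  have hunit : ∀ x : OrthNil.PIdx P, ∀ N : ℕ, 0 < N → N < OrthNil.len x →
      (N : k) ≠ 0 ∧ OrthNil.val (N : k) = 0 := fun x N h0 hN =>
    OrthNil.val_natCast_of_not_dvd (p := p) (Nat.not_dvd_of_pos_of_lt h0 (by
      have := OrthNil.len_le_coxeterNumber hP x
      omega))
  have hρ0 := OrthNil.ne_zero_of_anisotropic hρ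
  have hL := OrthNil.sum_len P
  have main : ∀ {W : Finset (Finset (OrthNil.PIdx P))} (R : OrthNil.Realization r ρ m Γ W),
      (∃ σ η, OrthNil.IsChainSystem ρ OrthNil.len R.ch σ η) ∧
        (∃! D : OrthNil.Triple k m d, R.Determines D) ∧
        ∀ D : OrthNil.Triple k m d, R.Determines D → D.IsLieTriple ρ ∧
          OrthNil.MaximalFacetsHaveDim ρ (OrthNil.buildingSet ρ D)
            ((OrthNil.evenParts Γ).card + (OrthNil.hypParts r Γ).card) := by
    intro W R
    obtain ⟨⟨σ, η, hch⟩, hdim⟩ := R.exists_isChainSystem h2 hρ hρ_rep hr rfl hunit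
    exact ⟨⟨σ, η, hch⟩, hch.existsUnique_triple hL OrthNil.len_pos,
      fun D hD => ⟨hch.isLieTriple hL OrthNil.len_pos hD, hdim D hD⟩⟩
  refine ⟨fun R => (main R).2, fun hVE => ⟨_, OrthNil.two_mul_card_of_veryEven hΓ hVE,
    fun R D hD => ((main R).2.2 D hD).2, fun γ hγ R' => ⟨(main R').2.1, fun D' hD' =>
      ⟨((main R').2.2 D' hD').1, ((main R').2.2 D' hD').2, fun R D hD => ?_⟩⟩⟩⟩
  obtain ⟨σ, η, hch⟩ := (main R).1
  exact OrthNil.oConj_and_not_soConj h2.1 hρ0 rfl hVE hγ R R' hch hD hD'
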